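/- Let $\gamma_z,\gamma_w,\gamma_\varepsilon>0$. A random vector $x$ is called $\gamma$ sub-Gaussian if it has mean zero and $\mathbb E\exp(t\langle x,v\rangle)\le\exp(t^2\gamma^2/2)$ for all $t\in\mathbb R$ and all unit vectors $v$. Let $\theta=(K,A,\beta,\Sigma_Z,\Sigma_W,\sigma^2)$ with $A\in\mathbb R^{p\times K}$ and $\Sigma_Z\in\mathbb R^{K\times K}$ both of rank $K$, $\beta\in\mathbb R^K$, $\Sigma_W\in\mathbb R^{p\times p}$ and $\sigma\ge 0$. The pair $(X,Y)\in\mathbb R^p\times\mathbb R$ follows the sub-Gaussian factor regression model sG-FRM$(\theta)$ if $X=AZ+W$ and $Y=Z^\top\beta+\varepsilon$ with $Z\in\mathbb R^K$, $W\in\mathbb R^p$, $\varepsilon\in\mathbb R$ mutually independent, of mean zero, with $\mathbb E[ZZ^\top]=\Sigma_Z$, $\mathbb E[WW^\top]=\Sigma_W$, $\mathbb E[\varepsilon^2]=\sigma^2$, where $\varepsilon$ is $\sigma\gamma_\varepsilon$ sub-Gaussian, $Z=\Sigma_Z^{1/2}\widetilde Z$ and $W=\Sigma_W^{1/2}\widetilde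 W$ with $\widetilde Z$ a $\gamma_z$ sub-Gaussian and $\widetilde W$ a $\gamma_w$ sub-Gaussian vector, $\mathbb E[\widetilde Z\widetilde Z^\top]=I_K$ and $\mathbb E[\widetilde W\widetilde W^\top]=I_p$. Let $n\ge 1$, let $(X_i,Y_i)$, $i=1,\dots,n$, be independent copies of $(X,Y)$, put $\bm X=(X_1,\dots,X_n)^\top\in\mathbb R^{n\times p}$ and $\bm Y=(Y_1,\dots,Y_n)^\top$, let $\sigma_1(\bm X)\ge\sigma_2(\bm X)\ge\cdots$ be the singular values of $\bm X$, and let $\widehat\lambda_k=\sigma_k^2(\bm X)/n$ for $k\ge1$ and $\widehat\lambda_0=\infty$. For $0\le k\le\operatorname{rank}(\bm X)$ let $\bm U_k\in\mathbb R^{p\times k}$ have as columns orthonormal right singular vectors of $\bm X$ for its $k$ largest singular values, and let $$\mathcal R(\bm U_k)=\mathbb E_{(X_*,Y_*)}\big[(Y_*-X_*^\top\bm U_k(\bm X\bm U_k)^+\bm Y)^2\big],$$ where $M^+$ is the Moore-Penrose inverse and the expectation is over an independent new copy $(X_*,Y_*)$ of $(X,Y)$ only, the data being held fixed. For a constant $c_W>0$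 put $$\delta_W=c_W\Big(\|\Sigma_W\|_{\mathrm{op}}+\frac{\operatorname{tr}(\Sigma_W)}{n}\Big),\qquad \widehat s=\max\{0\le k\le\operatorname{rank}(\bm X):\ \widehat\lambda_k\ge C_0\,\delta_W\}.$$ There are an absolute constant $c>0$, a constant $C=C(\gamma_z)>0$ and a constant $c_0=c_0(\gamma_w)>0$ such that for every $c_W\ge c_0$ and every $C_0>1$ there is a constant $C_1>0$, depending only on $\gamma_z,\gamma_w,\gamma_\varepsilon,c_W,C_0$, such that for all $n\ge1$, $p$, $K$ with $K\log n\le Cn$ and all $\theta$ such that $(X,Y)$ follows sG-FRM$(\theta)$, $$\mathbb P\left\{\mathcal R(\bm U_{\widehat s})-\sigma^2\le C_1\Big[(K+\log n)\frac{\sigma^2}{n}+\delta_W\,\beta^\top(A^\top A)^{-1}\beta\Big]\ \text{ for every choice of } \bm U_{\widehat s}\right\}\ \ge\ 1-\frac cn .$$ -/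

import Mathlib

open MeasureTheory ProbabilityTheory Matrix

noncomputable section

namespace FactorRegression

/-! ### Linear algebra -/

/-- The four Penrose equations for real matrices: `N` is the Moore-Penrose inverse of `M`. -/
structure IsMoorePenrose {m n : Type*} [Fintype m] [Fintype n]
    (M : Matrix m n ℝ) (N : Matrix n m ℝ) : Prop where
  mul_mul_left : M * N * M = M
  mul_mul_right : N * M * N = N
  symm_left : (M * N)ᵀ = M * N
  symm_right : (N * M)ᵀ = N * M

theorem exists_isMoorePenrose {m n : Type*} [Fintype m] [Fintype n] [DecidableEq n]
    (M : Matrix m n ℝ) : ∃ N : Matrix n m ℝ, IsMoorePenrose M N := by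
  have hG : (Mᵀ * M).IsHermitian := by
    simpa [conjTranspose_eq_transpose_of_trivial] using isHermitian_conjTranspose_mul_self M
  obtain ⟨H, h1, h2, h3, h4⟩ : ∃ H : Matrix n n ℝ, (Mᵀ * M) * H * (Mᵀ * M) = Mᵀ * M ∧
      H * (Mᵀ * M) * H = H ∧ Hᵀ = H ∧ (Mᵀ * M) * H = H * (Mᵀ * M) := by
    set V : Matrix n n ℝ := (hG.eigenvectorUnitary : Matrix n n ℝ) with hV
    have hVV : Vᵀ * V = 1 := by
      have := (mem_unitaryGroup_iff' (A := V)).1 hG.eigenvectorUnitary.2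
      simpa [star_eq_conjTranspose, conjTranspose_eq_transpose_of_trivial] using this
    have hsp : Mᵀ * M = V * diagonal hG.eigenvalues * Vᵀ := by
      have := hG.spectral_theorem
      simpa [Unitary.conjStarAlgAut_apply, star_eq_conjTranspose,
        conjTranspose_eq_transpose_of_trivial, Function.comp_def] using this
    have key : ∀ a b : n → ℝ, (V * diagonal a * Vᵀ) * (V * diagonal b * Vᵀ) =
        V * diagonal (fun i => a i * b i) * Vᵀ := by
      intro a b
      calc (V * diagonal a * Vᵀ) * (V * diagonal b * Vᵀ)
          = V * diagonal a * (Vᵀ * V) * diagonal b * Vᵀ := by simp only [Matrix.mul_assoc]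
        _ = _ := by rw [hVV, Matrix.mul_one, Matrix.mul_assoc V, diagonal_mul_diagonal]
    generalize hG.eigenvalues = l at hsp
    refine ⟨V * diagonal (fun i => (l i)⁻¹) * Vᵀ, ?_, ?_, ?_, ?_⟩
    · rw [hsp, key, key]; congr 3; funext i; exact mul_inv_mul_cancel _
    · rw [hsp, key, key]; congr 3; funext i
      by_cases h : l i = 0 <;> simp [h]
    · simp [transpose_mul, Matrix.mul_assoc]
    · rw [hsp, key, key]; congr 3; funext i; exact mul_comm _ _
  have hT : (Mᵀ * M)ᵀ = Mᵀ * M := by simp [transpose_mul]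
  refine ⟨H * Mᵀ, ?_, ?_, ?_, ?_⟩
  · have h0 : (M * H * (Mᵀ * M) - M)ᵀ * (M * H * (Mᵀ * M) - M) = 0 := by
      have e : (M * H * (Mᵀ * M) - M)ᵀ = (Mᵀ * M) * H * Mᵀ - Mᵀ := by
        rw [transpose_sub, transpose_mul, hT, transpose_mul, h3,
          Matrix.mul_assoc _ H]
      have e2 : Mᵀ * (M * H * (Mᵀ * M) - M) = 0 := by
        rw [Matrix.mul_sub, sub_eq_zero]
        calc Mᵀ * (M * H * (Mᵀ * M)) = (Mᵀ * M) * H * (Mᵀ * M) := by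
              simp only [Matrix.mul_assoc]
          _ = _ := h1
      rw [e, Matrix.sub_mul, Matrix.mul_assoc, e2]; simp
    have h5 : M * H * (Mᵀ * M) - M = 0 := by
      rw [← conjTranspose_mul_self_eq_zero]
      simpa [conjTranspose_eq_transpose_of_trivial] using h0
    simpa only [Matrix.mul_assoc] using sub_eq_zero.1 h5
  · calc H * Mᵀ * M * (H * Mᵀ) = (H * (Mᵀ * M) * H) * Mᵀ := by simp only [Matrix.mul_assoc]
      _ = _ := by rw [h2]
  · simp only [transpose_mul, transpose_transpose, h3, Matrix.mul_assoc]
  · rw [Matrix.mul_assoc, transpose_mul, hT, h3, h4]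

/-- The Moore-Penrose inverse `M⁺`. -/
def pinv {m n : Type*} [Fintype m] [Fintype n] [DecidableEq n] (M : Matrix m n ℝ) :
    Matrix n m ℝ :=
  (exists_isMoorePenrose M).choose

/-- The operator norm with respect to the Euclidean norms. -/
def opNorm {p : ℕ} (M : Matrix (Fin p) (Fin p) ℝ) : ℝ :=
  ‖Matrix.toEuclideanCLM (n := Fin p) (𝕜 := ℝ) M‖

/-- `singVal M j` is the `(j+1)`-st largest singular value of `M`, zero once `rank M ≤ j`. -/
def singVal {n p : ℕ} (M : Matrix (Fin n) (Fin p) ℝ) (j : ℕ) : ℝ :=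
  (Matrix.toEuclideanLin M).singularValues j

/-- `S` is the positive semidefinite square root of `M`. -/
def IsPSDSqrt {d : ℕ} (S M : Matrix (Fin d) (Fin d) ℝ) : Prop :=
  S.PosSemidef ∧ S * S = M

/-! ### Sub-Gaussian random variables and vectors -/

/-- A mean zero random variable `x` with `E exp(t x) ≤ exp(t² γ² / 2)` for all `t`. -/
def IsSubGaussian {Ω : Type*} [MeasurableSpace Ω] (P : Measure Ω) (x : Ω → ℝ) (γ : ℝ) : Prop :=
  (∫ ω, x ω ∂P) = 0 ∧ HasSubgaussianMGF x (Real.toNNReal (γ ^ 2)) P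

/-- A random vector whose inner product with every unit vector is `γ` sub-Gaussian. -/
def IsSubGaussianVec {Ω : Type*} [MeasurableSpace Ω] (P : Measure Ω) {d : ℕ}
    (x : Ω → Fin d → ℝ) (γ : ℝ) : Prop :=
  ∀ v : Fin d → ℝ, v ⬝ᵥ v = 1 → IsSubGaussian P (fun ω => x ω ⬝ᵥ v) γ

/-- `E[x xᵀ] = S`, with square integrable coordinates. -/
def HasSecondMoment {Ω : Type*} [MeasurableSpace Ω] (P : Measure Ω) {d : ℕ}
    (x : Ω → Fin d → ℝ) (S : Matrix (Fin d) (Fin d) ℝ) : Prop :=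
  (∀ i, MemLp (fun ω => x ω i) 2 P) ∧ ∀ i j, (∫ ω, x ω i * x ω j ∂P) = S i j

/-! ### The factor regression model -/

/-- The parameter `θ = (K, β, A, Σ_Z, Σ_W, σ²)`; the noise level is stored as `σ ≥ 0`. -/
structure Param (p K : ℕ) where
  β : Fin K → ℝ
  A : Matrix (Fin p) (Fin K) ℝ
  SigmaZ : Matrix (Fin K) (Fin K) ℝ
  SigmaW : Matrix (Fin p) (Fin p) ℝ
  σ : ℝ
  σ_nonneg : 0 ≤ σ

/-- `X = A Z + W`. -/
def Param.X {p K : ℕ} (θ : Param p K) (z : Fin K → ℝ) (w : Fin p → ℝ) : Fin p → ℝ :=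
  θ.A *ᵥ z + w

/-- `Y = Zᵀ β + ε`. -/
def Param.Y {p K : ℕ} (θ : Param p K) (z : Fin K → ℝ) (e : ℝ) : ℝ :=
  z ⬝ᵥ θ.β + e

/-- The `n × p` data matrix with rows `X_i = A Z_i + W_i`. -/
def Param.dataX {n p K : ℕ} (θ : Param p K) (z : Fin n → Fin K → ℝ) (w : Fin n → Fin p → ℝ) :
    Matrix (Fin n) (Fin p) ℝ :=
  Matrix.of fun i => θ.X (z i) (w i)

/-- The response vector with entries `Y_i = Z_iᵀ β + ε_i`. -/
def Param.dataY {n p K : ℕ} (θ : Param p K) (z : Fin n → Fin K → ℝ) (e : Fin n → ℝ) :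
    Fin n → ℝ :=
  fun i => θ.Y (z i) (e i)

/-- The factor regression model: the latent variables `Z`, `W`, `ε`, from which
`X = A Z + W` and `Y = Zᵀ β + ε` are formed, satisfy the moment, independence and rank
conditions of FRM(`θ`). Mutual independence of the three is expressed as independence of `Z` and
`W` and independence of `(Z, W)` and `ε`. -/
structure IsFRM {Ω : Type*} [MeasurableSpace Ω] (P : Measure Ω) {p K : ℕ} (θ : Param p K)
    (Z : Ω → Fin K → ℝ) (W : Ω → Fin p → ℝ) (ε : Ω → ℝ) : Prop where
  aemeasurable_Z : AEMeasurable Z P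
  aemeasurable_W : AEMeasurable W P
  aemeasurable_ε : AEMeasurable ε P
  indep_ZW : IndepFun Z W P
  indep_ZW_ε : IndepFun (fun ω => (Z ω, W ω)) ε P
  mean_Z : ∀ i, (∫ ω, Z ω i ∂P) = 0
  mean_W : ∀ i, (∫ ω, W ω i ∂P) = 0
  mean_ε : (∫ ω, ε ω ∂P) = 0
  moment_Z : HasSecondMoment P Z θ.SigmaZ
  moment_W : HasSecondMoment P W θ.SigmaW
  memLp_ε : MemLp ε 2 P
  moment_ε : (∫ ω, ε ω ^ 2 ∂P) = θ.σ ^ 2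
  rank_A : θ.A.rank = K
  rank_SigmaZ : θ.SigmaZ.rank = K

/-- `x = S^{1/2} x̃` almost surely, with `x̃` a `γ` sub-Gaussian vector and `E[x̃ x̃ᵀ] = I`. -/
def IsWhitenedSubGaussian {Ω : Type*} [MeasurableSpace Ω] (P : Measure Ω) {d : ℕ}
    (x : Ω → Fin d → ℝ) (S : Matrix (Fin d) (Fin d) ℝ) (γ : ℝ) : Prop :=
  ∃ (R : Matrix (Fin d) (Fin d) ℝ) (x' : Ω → Fin d → ℝ), IsPSDSqrt R S ∧
    AEMeasurable x' P ∧ (∀ᵐ ω ∂P, x ω = R *ᵥ x' ω) ∧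
    IsSubGaussianVec P x' γ ∧ HasSecondMoment P x' 1

/-- The sub-Gaussian factor regression model sG-FRM(`θ`) with sub-Gaussian constants
`γε`, `γw`, `γz`. -/
structure IsSGFRM {Ω : Type*} [MeasurableSpace Ω] (P : Measure Ω) {p K : ℕ} (θ : Param p K)
    (γε γw γz : ℝ) (Z : Ω → Fin K → ℝ) (W : Ω → Fin p → ℝ) (ε : Ω → ℝ) : Prop
    extends IsFRM P θ Z W ε where
  subGaussian_ε : IsSubGaussian P ε (θ.σ * γε)
  subGaussian_Z : IsWhitenedSubGaussian P Z θ.SigmaZ γz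
  subGaussian_W : IsWhitenedSubGaussian P W θ.SigmaW γw

/-- The noise level `δ_W = c (‖Σ_W‖_op + tr(Σ_W) / n)`. -/
def Param.deltaW {p K : ℕ} (θ : Param p K) (c : ℝ) (n : ℕ) : ℝ :=
  c * (opNorm θ.SigmaW + θ.SigmaW.trace / n)

/-- `βᵀ (Aᵀ A)⁻¹ β`. -/
def Param.quad {p K : ℕ} (θ : Param p K) : ℝ :=
  θ.β ⬝ᵥ ((θ.Aᵀ * θ.A)⁻¹ *ᵥ θ.β)

/-! ### Principal component regression -/

/-- The coefficient vector `B (X B)⁺ Y` of the linear predictor based on `B`. -/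
def coef {n p q : ℕ} (X : Matrix (Fin n) (Fin p) ℝ) (Y : Fin n → ℝ)
    (B : Matrix (Fin p) (Fin q) ℝ) : Fin p → ℝ :=
  B *ᵥ (pinv (X * B) *ᵥ Y)

/-- The prediction risk `E[(Y_* - X_*ᵀ α)²]` of a coefficient vector `α`, the expectation being
over the new data point only. -/
def Param.risk {Ω : Type*} [MeasurableSpace Ω] (P : Measure Ω) {p K : ℕ} (θ : Param p K)
    (Z : Ω → Fin K → ℝ) (W : Ω → Fin p → ℝ) (ε : Ω → ℝ) (α : Fin p → ℝ) : ℝ :=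
  ∫ ω, (θ.Y (Z ω) (ε ω) - θ.X (Z ω) (W ω) ⬝ᵥ α) ^ 2 ∂P

/-- The columns of `U` are first `k` right singular vectors of `X`: they are orthonormal, and
the `j`-th one is an eigenvector of `Xᵀ X` for its `j`-th largest eigenvalue `σ_j²(X)`. -/
def IsTopRightSingular {n p k : ℕ} (X : Matrix (Fin n) (Fin p) ℝ)
    (U : Matrix (Fin p) (Fin k) ℝ) : Prop :=
  Uᵀ * U = 1 ∧ ∀ j : Fin k, (Xᵀ * X) *ᵥ U.col j = (singVal X j ^ 2) • U.col j

theorem exists_isTopRightSingular {n p k : ℕ} (X : Matrix (Fin n) (Fin p) ℝ) (hk : k ≤ p) :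
    ∃ U : Matrix (Fin p) (Fin k) ℝ, IsTopRightSingular X U := by
  have hp : Module.finrank ℝ (EuclideanSpace ℝ (Fin p)) = p := by simp
  let T := Matrix.toEuclideanLin X
  have hs := T.isSymmetric_adjoint_comp_self
  let b := hs.eigenvectorBasis hp
  refine ⟨Matrix.of fun i j => b (Fin.castLE hk j) i, ?_, ?_⟩
  · ext i j
    have h := orthonormal_iff_ite.1 b.orthonormal (Fin.castLE hk i) (Fin.castLE hk j)
    rw [PiLp.inner_apply] at h
    simp only [Fin.castLE_inj] at h
    rw [Matrix.one_apply, ← h, Matrix.mul_apply]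
    exact Finset.sum_congr rfl fun x _ => mul_comm _ _
  · intro j
    have h1 := hs.apply_eigenvectorBasis hp (Fin.castLE hk j)
    have h2 := T.sq_singularValues_fin hp (Fin.castLE hk j)
    have h3 : singVal X j ^ 2 = hs.eigenvalues hp (Fin.castLE hk j) := h2
    have h4 : ∀ v, LinearMap.adjoint T v = Matrix.toEuclideanLin Xᵀ v := fun v => by
      rw [← conjTranspose_eq_transpose_of_trivial, Matrix.toEuclideanLin_conjTranspose_eq_adjoint]
    have h5 := congrArg WithLp.ofLp ((h4 _).symm.trans h1)
    rw [h3, ← Matrix.mulVec_mulVec]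
    exact h5

/-- `λ̂_k = σ_k²(X) / n`, with `λ̂_0 = ∞`. -/
def lambdaHat {n p : ℕ} (X : Matrix (Fin n) (Fin p) ℝ) : ℕ → EReal
  | 0 => ⊤
  | k + 1 => ((singVal X k ^ 2 / n : ℝ) : EReal)

open Classical in
/-- The elbow rule at threshold `τ`: the largest `k` with `0 ≤ k ≤ rank X` and `λ̂_k ≥ τ`. -/
def sHat {n p : ℕ} (X : Matrix (Fin n) (Fin p) ℝ) (τ : ℝ) : ℕ :=
  Nat.findGreatest (fun k => (τ : EReal) ≤ lambdaHat X k) X.rank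

end FactorRegression

end

namespace FactorRegression

/-! ### Gaussian decoupling -/

/-! Write δ for δ_W. With a = A(AᵀA)⁻¹β one has Aᵀa = β and ‖a‖² = βᵀ(AᵀA)⁻¹β
(`exists_coef_of_rank`), so the sample satisfies Y = Xa − Wa + ε: a linear model in X, contaminated
by Wa. The excess risk of a coefficient vector α is uᵀΣ_Z u + αᵀΣ_W α with u = β − Aᵀα
(`IsFRM.risk_sub_eq`).

Three events are needed, with total failure probability at most 4/n: (i) ‖W‖² ≤ nδ
(`measure_op_noise_le`); (ii) ‖Zu‖² ≥ (n/8) uᵀΣ_Z u for all u (`exists_measure_design_le`); (iii)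
the projection of ε onto the range of XU has squared norm of order (K + log n)σ². On them the rest
is deterministic (`coef_error_le`): the elbow rule keeps singular values with σ_j²(X) ≥ nC₀δ, so
(XU)⁺ amplifies errors by at most (nC₀δ)^(-1/2), while X has norm at most (nC₀δ)^(1/2) on the
orthogonal complement of U. This bounds both ‖α‖ and ‖Zu‖, and (ii) turns ‖Zu‖ into uᵀΣ_Z u.

Events (i) and (ii) follow from nets of the sphere and Chernoff bounds. Event (iii) must hold for
every choice of U at once, and no measurable choice of U is made. The projection is instead
dominated by F = Mᵐ(Mᵐ + tᵐ)⁻¹ with M = XXᵀ and t = nC₀δ: F is measurable in (Z, W), 0 ≤ F ≤ 1, and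
F ≥ 1/2 on the range of XU, so that the squared norm of the projected noise is at most 2εᵀFε. On
(i), M ≤ nδ on the kernel of Zᵀ, so at most K eigenvalues of M exceed nδ; each of the others adds at
most C₀⁻ᵐ to tr F. Choosing C₀ᵐ > n gives tr F ≤ K + 1. If δ = 0, the projection onto the columns of
Z replaces F (`exists_noise_majorant`). Since ε is independent of (Z, W), Fubini and a Chernoff
bound for quadratic forms finish (`measure_sample_quadratic_gt_le`).

The upper tails all come from one exponential moment, `lintegral_exp_sq_le`, obtained by Gaussian
decoupling. -/

theorem integral_exp_mul_sq_gaussianReal {a : ℝ} (ha : a < 1 / 2) :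
    Integrable (fun x => Real.exp (a * x ^ 2)) (gaussianReal 0 1) ∧
      ∫ x, Real.exp (a * x ^ 2) ∂(gaussianReal 0 1) = √(1 / (1 - 2 * a)) := by
  have hb : 0 < 1 / 2 - a := by linarith
  have key : ∀ x : ℝ, gaussianPDFReal 0 1 x * Real.exp (a * x ^ 2)
      = (√(2 * Real.pi))⁻¹ * Real.exp (-(1 / 2 - a) * x ^ 2) := by
    intro x
    simp only [gaussianPDFReal, NNReal.coe_one, mul_one, sub_zero]
    rw [mul_assoc, ← Real.exp_add]
    congr 2
    ring
  constructor
  · rw [gaussianReal_of_var_ne_zero _ one_ne_zero]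
    rw [integrable_withDensity_iff_integrable_smul₀' (by fun_prop) (by simp [gaussianPDF])]
    simp only [gaussianPDF, smul_eq_mul, ENNReal.toReal_ofReal (gaussianPDFReal_nonneg _ _ _), key]
    exact (integrable_exp_neg_mul_sq hb).const_mul _
  · rw [integral_gaussianReal_eq_integral_smul one_ne_zero]
    simp only [smul_eq_mul, key]
    rw [integral_const_mul, integral_gaussian, ← Real.sqrt_inv, ← Real.sqrt_mul (by positivity)]
    congr 1
    have : 1 - 2 * a ≠ 0 := by linarith
    field_simp

/-- After squaring, the claim is 1 ≤ (1 − 2a)exp(4a). It follows from exp(4a) ≥ 1 + 4a, since (1 −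
2a)(1 + 4a) = 1 + 2a(1 − 4a); this is where a ≤ 1/4 enters. -/
theorem lintegral_exp_mul_sq_gaussianReal_le {a : ℝ} (ha0 : 0 ≤ a) (ha : a ≤ 1 / 4) :
    ∫⁻ x, ENNReal.ofReal (Real.exp (a * x ^ 2)) ∂(gaussianReal 0 1)
      ≤ ENNReal.ofReal (Real.exp (2 * a)) := by
  obtain ⟨h1, h2⟩ := integral_exp_mul_sq_gaussianReal (a := a) (by linarith)
  rw [← ofReal_integral_eq_lintegral_ofReal h1 (ae_of_all _ fun x => (Real.exp_pos _).le), h2]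
  apply ENNReal.ofReal_le_ofReal
  rw [Real.sqrt_le_left (Real.exp_pos _).le, ← Real.exp_nat_mul, div_le_iff₀ (by linarith)]
  have h3 : 4 * a + 1 ≤ Real.exp (4 * a) := Real.add_one_le_exp _
  have h4 : ((2 : ℕ) : ℝ) * (2 * a) = 4 * a := by push_cast; ring
  rw [h4]
  nlinarith

theorem lintegral_exp_mul_gaussianReal (t : ℝ) :
    ∫⁻ x, ENNReal.ofReal (Real.exp (t * x)) ∂(gaussianReal 0 1)
      = ENNReal.ofReal (Real.exp (t ^ 2 / 2)) := by
  rw [← ofReal_integral_eq_lintegral_ofReal (integrable_exp_mul_gaussianReal t)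
    (ae_of_all _ fun x => (Real.exp_pos _).le)]
  have := mgf_gaussianReal (p := gaussianReal 0 1) (X := id) (μ := 0) (v := 1) (by simp) t
  simp only [mgf, id] at this
  rw [this]
  simp

theorem lintegral_prod_pi {ι : Type*} [Fintype ι] (μ : ι → Measure ℝ)
    [∀ i, IsProbabilityMeasure (μ i)] (f : ι → ℝ → ENNReal) (hf : ∀ i, Measurable (f i)) :
    ∫⁻ g, ∏ i, f i (g i) ∂(Measure.pi μ) = ∏ i, ∫⁻ x, f i x ∂(μ i) := by
  have h := lintegral_prod_eq_prod_lintegral_of_indepFun (μ := Measure.pi μ) Finset.univ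
    (fun i (g : ι → ℝ) => f i (g i))
    (iIndepFun_pi (X := fun i x => f i x) fun i => (hf i).aemeasurable)
    (fun i => (hf i).comp (measurable_pi_apply i))
  rw [h]
  refine Finset.prod_congr rfl fun i _ => ?_
  exact (measurePreserving_eval μ i).lintegral_comp (hf i)

/-- The moment generating function of a standard Gaussian vector g, read backwards: a quadratic
exponent in y becomes an average of linear ones, to which a sub-Gaussian hypothesis applies. -/
theorem ofReal_exp_sq_eq_lintegral {ι : Type*} [Fintype ι] {s : ℝ} (hs : 0 ≤ s) (y : ι → ℝ) :
    ENNReal.ofReal (Real.exp (s * (y ⬝ᵥ y)))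
      = ∫⁻ g, ENNReal.ofReal (Real.exp ((√(2 * s) • g) ⬝ᵥ y))
          ∂(Measure.pi fun _ : ι => gaussianReal 0 1) := by
  have : ∀ g : ι → ℝ, ENNReal.ofReal (Real.exp ((√(2 * s) • g) ⬝ᵥ y))
      = ∏ j, ENNReal.ofReal (Real.exp ((√(2 * s) * y j) * g j)) := by
    intro g
    rw [← ENNReal.ofReal_prod_of_nonneg fun _ _ => (Real.exp_pos _).le, ← Real.exp_sum]
    congr 2
    simp only [dotProduct, Pi.smul_apply, smul_eq_mul]
    exact Finset.sum_congr rfl fun j _ => by ring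
  simp_rw [this]
  rw [lintegral_prod_pi _ (fun j t => ENNReal.ofReal (Real.exp ((√(2 * s) * y j) * t)))
    (fun j => by fun_prop)]
  simp_rw [lintegral_exp_mul_gaussianReal]
  rw [← ENNReal.ofReal_prod_of_nonneg fun _ _ => (Real.exp_pos _).le, ← Real.exp_sum]
  congr 2
  simp only [dotProduct, Finset.mul_sum]
  refine Finset.sum_congr rfl fun j _ => ?_
  rw [mul_pow, Real.sq_sqrt (by positivity)]
  ring

/-- A random vector with `E exp⟨x, u⟩ ≤ exp(½ ∑ l_j u_j²)` has
`E exp(s ‖x‖²) ≤ exp(2 s ∑ l_j)` as long as `4 s l_j ≤ 1`. -/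
theorem lintegral_exp_sq_le_of_diagonal {Ω ι : Type*} [MeasurableSpace Ω] [Fintype ι]
    {P : Measure Ω} [SFinite P] {x : Ω → ι → ℝ} (hx : AEMeasurable x P) {l : ι → ℝ}
    (hl : ∀ j, 0 ≤ l j)
    (hmgf : ∀ u : ι → ℝ, ∫⁻ ω, ENNReal.ofReal (Real.exp (u ⬝ᵥ x ω)) ∂P
      ≤ ENNReal.ofReal (Real.exp ((∑ j, l j * u j ^ 2) / 2)))
    {s : ℝ} (hs : 0 ≤ s) (hsl : ∀ j, 4 * s * l j ≤ 1) :
    ∫⁻ ω, ENNReal.ofReal (Real.exp (s * (x ω ⬝ᵥ x ω))) ∂P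
      ≤ ENNReal.ofReal (Real.exp (2 * s * ∑ j, l j)) := by
  calc ∫⁻ ω, ENNReal.ofReal (Real.exp (s * (x ω ⬝ᵥ x ω))) ∂P
      = ∫⁻ ω, ∫⁻ g, ENNReal.ofReal (Real.exp ((√(2 * s) • g) ⬝ᵥ x ω))
          ∂(Measure.pi fun _ : ι => gaussianReal 0 1) ∂P :=
        lintegral_congr fun ω => ofReal_exp_sq_eq_lintegral hs (x ω)
    -- Decoupling: integrating over x first, for fixed g, leaves a diagonal Gaussian integral that
    -- factors over coordinates.
    _ = ∫⁻ g, ∫⁻ ω, ENNReal.ofReal (Real.exp ((√(2 * s) • g) ⬝ᵥ x ω)) ∂P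
          ∂(Measure.pi fun _ : ι => gaussianReal 0 1) := by
        refine lintegral_lintegral_swap
          (f := fun ω g => ENNReal.ofReal (Real.exp ((√(2 * s) • g) ⬝ᵥ x ω))) ?_
        have hm (j : ι) : AEMeasurable (fun q : Ω × (ι → ℝ) => x q.1 j)
            (P.prod (Measure.pi fun _ : ι => gaussianReal 0 1)) :=
          ((measurable_pi_apply j).comp_aemeasurable hx).comp_fst
        simp only [Function.uncurry_def, dotProduct, Pi.smul_apply, smul_eq_mul]
        refine ENNReal.measurable_ofReal.comp_aemeasurable
          (Real.measurable_exp.comp_aemeasurable ?_)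
        refine Finset.aemeasurable_fun_sum _ fun j _ => AEMeasurable.mul ?_ (hm j)
        exact Measurable.aemeasurable (by fun_prop)
    _ ≤ ∫⁻ g, ∏ j, ENNReal.ofReal (Real.exp ((s * l j) * g j ^ 2))
          ∂(Measure.pi fun _ : ι => gaussianReal 0 1) := by
        refine lintegral_mono fun g => (hmgf _).trans (le_of_eq ?_)
        rw [← ENNReal.ofReal_prod_of_nonneg fun _ _ => (Real.exp_pos _).le, ← Real.exp_sum]
        congr 2
        rw [Finset.sum_div]
        refine Finset.sum_congr rfl fun j _ => ?_
        rw [Pi.smul_apply, smul_eq_mul, mul_pow, Real.sq_sqrt (by positivity)]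
        ring
    _ = ∏ j, ∫⁻ t, ENNReal.ofReal (Real.exp ((s * l j) * t ^ 2)) ∂(gaussianReal 0 1) :=
        lintegral_prod_pi _ (fun j t => ENNReal.ofReal (Real.exp ((s * l j) * t ^ 2)))
          (fun j => by fun_prop)
    _ ≤ ∏ j, ENNReal.ofReal (Real.exp (2 * (s * l j))) :=
        Finset.prod_le_prod' fun j _ => lintegral_exp_mul_sq_gaussianReal_le
          (mul_nonneg hs (hl j)) (by linarith [hsl j])
    _ = _ := by
        rw [← ENNReal.ofReal_prod_of_nonneg fun _ _ => (Real.exp_pos _).le, ← Real.exp_sum]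
        congr 2
        rw [Finset.mul_sum]
        exact Finset.sum_congr rfl fun j _ => by ring

/-! ### Spectral decomposition of real symmetric matrices -/

theorem transpose_mulVec_dotProduct {m n : Type*} [Fintype m] [Fintype n] (M : Matrix m n ℝ)
    (x : m → ℝ) (y : n → ℝ) : (Mᵀ *ᵥ x) ⬝ᵥ y = x ⬝ᵥ (M *ᵥ y) := by
  rw [mulVec_transpose, dotProduct_mulVec]

theorem mulVec_dotProduct_mulVec {m n k : Type*} [Fintype m] [Fintype n] [Fintype k]
    (M : Matrix m n ℝ) (N : Matrix m k ℝ) (x : n → ℝ) (y : k → ℝ) :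
    (M *ᵥ x) ⬝ᵥ (N *ᵥ y) = x ⬝ᵥ ((Mᵀ * N) *ᵥ y) := by
  rw [← mulVec_mulVec, ← transpose_mulVec_dotProduct Mᵀ, transpose_transpose]

theorem mulVec_dotProduct_self_of_orthogonal {m n : Type*} [Fintype m] [Fintype n]
    [DecidableEq n] {V : Matrix m n ℝ} (hV : Vᵀ * V = 1) (x : n → ℝ) :
    (V *ᵥ x) ⬝ᵥ (V *ᵥ x) = x ⬝ᵥ x := by
  rw [mulVec_dotProduct_mulVec, hV, one_mulVec]

theorem dotProduct_diagonal_mulVec {n : Type*} [Fintype n] [DecidableEq n] (l x : n → ℝ) :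
    x ⬝ᵥ (diagonal l *ᵥ x) = ∑ j, l j * x j ^ 2 := by
  simp only [dotProduct, mulVec_diagonal]
  exact Finset.sum_congr rfl fun j _ => by ring

theorem exists_spectral_decomposition {n : Type*} [Fintype n] [DecidableEq n]
    {M : Matrix n n ℝ} (hM : M.IsHermitian) :
    ∃ (V : Matrix n n ℝ) (l : n → ℝ), Vᵀ * V = 1 ∧ V * Vᵀ = 1 ∧ M = V * diagonal l * Vᵀ := by
  have hVV : (hM.eigenvectorUnitary : Matrix n n ℝ)ᵀ * (hM.eigenvectorUnitary : Matrix n n ℝ)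
      = 1 := by
    have := (mem_unitaryGroup_iff' (A := (hM.eigenvectorUnitary : Matrix n n ℝ))).1
      hM.eigenvectorUnitary.2
    simpa [star_eq_conjTranspose, conjTranspose_eq_transpose_of_trivial] using this
  refine ⟨hM.eigenvectorUnitary, hM.eigenvalues, hVV, mul_eq_one_comm.1 hVV, ?_⟩
  have := hM.spectral_theorem
  simpa [Unitary.conjStarAlgAut_apply, star_eq_conjTranspose,
    conjTranspose_eq_transpose_of_trivial, Function.comp_def] using this

theorem dotProduct_mulVec_of_decomposition {n : Type*} [Fintype n] [DecidableEq n]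
    {M V : Matrix n n ℝ} {l : n → ℝ} (hM : M = V * diagonal l * Vᵀ) (x : n → ℝ) :
    x ⬝ᵥ (M *ᵥ x) = ∑ j, l j * (Vᵀ *ᵥ x) j ^ 2 := by
  rw [hM, ← mulVec_mulVec, ← mulVec_mulVec, ← transpose_mulVec_dotProduct,
    dotProduct_diagonal_mulVec]

theorem eigenvalue_eq_dotProduct {n : Type*} [Fintype n] [DecidableEq n]
    {M V : Matrix n n ℝ} {l : n → ℝ} (hV : Vᵀ * V = 1) (hM : M = V * diagonal l * Vᵀ) (j : n) :
    l j = (V *ᵥ Pi.single j 1) ⬝ᵥ (M *ᵥ (V *ᵥ Pi.single j 1)) := by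
  rw [dotProduct_mulVec_of_decomposition hM, mulVec_mulVec, hV, one_mulVec]
  simp [Pi.single_apply]

theorem trace_of_decomposition {n : Type*} [Fintype n] [DecidableEq n]
    {M V : Matrix n n ℝ} {l : n → ℝ} (hV : Vᵀ * V = 1) (hM : M = V * diagonal l * Vᵀ) :
    M.trace = ∑ j, l j := by
  rw [hM, trace_mul_comm, ← Matrix.mul_assoc, hV, Matrix.one_mul, trace_diagonal]

theorem PosSemidef.dotProduct_mulVec_self_nonneg {n : Type*} [Fintype n] {M : Matrix n n ℝ}
    (hM : M.PosSemidef) (x : n → ℝ) : 0 ≤ x ⬝ᵥ (M *ᵥ x) := by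
  simpa using hM.dotProduct_mulVec_nonneg x

/-- The exponential moment of the squared norm of a sub-Gaussian vector with variance proxy `S`. -/
theorem lintegral_exp_sq_le {Ω ι : Type*} [MeasurableSpace Ω] [Fintype ι]
    {P : Measure Ω} [SFinite P] {x : Ω → ι → ℝ} (hx : AEMeasurable x P) {S : Matrix ι ι ℝ}
    (hS : S.PosSemidef) {b : ℝ} (hb : ∀ u, u ⬝ᵥ (S *ᵥ u) ≤ b * (u ⬝ᵥ u))
    (hmgf : ∀ u : ι → ℝ, ∫⁻ ω, ENNReal.ofReal (Real.exp (u ⬝ᵥ x ω)) ∂P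
      ≤ ENNReal.ofReal (Real.exp (u ⬝ᵥ (S *ᵥ u) / 2)))
    {s : ℝ} (hs : 0 ≤ s) (hsb : 4 * s * b ≤ 1) :
    ∫⁻ ω, ENNReal.ofReal (Real.exp (s * (x ω ⬝ᵥ x ω))) ∂P
      ≤ ENNReal.ofReal (Real.exp (2 * s * S.trace)) := by
  classical
  obtain ⟨V, l, hV, hV', hSV⟩ := exists_spectral_decomposition hS.1
  have hl : ∀ j, 0 ≤ l j := fun j => by
    rw [eigenvalue_eq_dotProduct hV hSV]
    exact PosSemidef.dotProduct_mulVec_self_nonneg hS _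
  have hlb : ∀ j, l j ≤ b := fun j => by
    rw [eigenvalue_eq_dotProduct hV hSV]
    refine (hb _).trans (le_of_eq ?_)
    rw [mulVec_dotProduct_self_of_orthogonal hV]
    simp
  have hVt : Vᵀᵀ * Vᵀ = 1 := by rw [transpose_transpose, hV']
  -- Rotation by `Vᵀ` preserves the norm and makes the variance proxy diagonal.
  have hnorm : ∀ ω, x ω ⬝ᵥ x ω = (Vᵀ *ᵥ x ω) ⬝ᵥ (Vᵀ *ᵥ x ω) := fun ω =>
    (mulVec_dotProduct_self_of_orthogonal hVt _).symm
  simp_rw [hnorm]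
  rw [trace_of_decomposition hV hSV]
  refine lintegral_exp_sq_le_of_diagonal (x := fun ω => Vᵀ *ᵥ x ω) ?_ hl ?_ hs ?_
  · have : Measurable fun y : ι → ℝ => Vᵀ *ᵥ y :=
      (Continuous.matrix_mulVec continuous_const continuous_id).measurable
    exact this.comp_aemeasurable hx
  · intro u
    have h1 : ∀ ω, u ⬝ᵥ (Vᵀ *ᵥ x ω) = (V *ᵥ u) ⬝ᵥ x ω := fun ω => by
      rw [← transpose_mulVec_dotProduct, transpose_transpose]
    simp_rw [h1]
    refine (hmgf _).trans (le_of_eq ?_)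
    rw [dotProduct_mulVec_of_decomposition hSV, mulVec_mulVec, hV, one_mulVec]
  · intro j
    exact (mul_le_mul_of_nonneg_left (hlb j) (by positivity)).trans hsb

/-- The Chernoff bound for the squared norm of a sub-Gaussian vector. -/
theorem measure_sq_gt_le {Ω ι : Type*} [MeasurableSpace Ω] [Fintype ι]
    {P : Measure Ω} [SFinite P] {x : Ω → ι → ℝ} (hx : AEMeasurable x P) {S : Matrix ι ι ℝ}
    (hS : S.PosSemidef) {b : ℝ} (hb : ∀ u, u ⬝ᵥ (S *ᵥ u) ≤ b * (u ⬝ᵥ u)) (hb0 : 0 < b)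
    (hmgf : ∀ u : ι → ℝ, ∫⁻ ω, ENNReal.ofReal (Real.exp (u ⬝ᵥ x ω)) ∂P
      ≤ ENNReal.ofReal (Real.exp (u ⬝ᵥ (S *ᵥ u) / 2))) (r : ℝ) :
    P {ω | 4 * b * r + 2 * S.trace < x ω ⬝ᵥ x ω} ≤ ENNReal.ofReal (Real.exp (-r)) := by
  have hmeas : AEMeasurable (fun ω => ENNReal.ofReal (Real.exp (1 / (4 * b) * (x ω ⬝ᵥ x ω)))) P := by
    have : Measurable fun y : ι → ℝ => ENNReal.ofReal (Real.exp (1 / (4 * b) * (y ⬝ᵥ y))) := by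
      simp only [dotProduct]; fun_prop
    exact this.comp_aemeasurable hx
  -- s = 1/(4b) is the largest exponent allowed; the threshold 4br + 2 tr S is then exactly r + 2s
  -- tr S after multiplication by s.
  have hI := lintegral_exp_sq_le hx hS hb hmgf (s := 1 / (4 * b)) (by positivity)
    (by field_simp; norm_num)
  have hM := mul_meas_ge_le_lintegral₀ hmeas
    (ENNReal.ofReal (Real.exp (r + 2 * (1 / (4 * b)) * S.trace)))
  have hsub : {ω | 4 * b * r + 2 * S.trace < x ω ⬝ᵥ x ω} ⊆
      {ω | ENNReal.ofReal (Real.exp (r + 2 * (1 / (4 * b)) * S.trace)) ≤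
        ENNReal.ofReal (Real.exp (1 / (4 * b) * (x ω ⬝ᵥ x ω)))} := by
    intro ω hω
    simp only [Set.mem_ofPred_eq] at hω ⊢
    apply ENNReal.ofReal_le_ofReal
    apply Real.exp_le_exp.2
    have h4 : 1 / (4 * b) * (4 * b * r + 2 * S.trace) ≤ 1 / (4 * b) * (x ω ⬝ᵥ x ω) :=
      mul_le_mul_of_nonneg_left hω.le (by positivity)
    refine le_trans (le_of_eq ?_) h4
    field_simp
  refine (measure_mono hsub).trans ?_
  have hpos := Real.exp_pos (r + 2 * (1 / (4 * b)) * S.trace)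
  rw [← ENNReal.mul_le_mul_iff_right
    (a := ENNReal.ofReal (Real.exp (r + 2 * (1 / (4 * b)) * S.trace)))
    (by simpa using hpos) ENNReal.ofReal_ne_top]
  refine (hM.trans hI).trans (le_of_eq ?_)
  rw [← ENNReal.ofReal_mul hpos.le, ← Real.exp_add]
  congr 2
  ring

/-! ### Singular values -/

theorem exists_mulVec_eq_zero_of_card_lt {m n : Type*} [Fintype m] [Fintype n]
    (M : Matrix m n ℝ) (h : Fintype.card m < Fintype.card n) : ∃ c : n → ℝ, c ≠ 0 ∧ M *ᵥ c = 0 := by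
  have hk : LinearMap.ker M.mulVecLin ≠ ⊥ := LinearMap.ker_ne_bot_of_finrank_lt (by simpa using h)
  obtain ⟨c, hc, h0⟩ := Submodule.exists_mem_ne_zero_of_ne_bot hk
  exact ⟨c, h0, by simpa using hc⟩

theorem dotProduct_self_nonneg {m : Type*} [Fintype m] (v : m → ℝ) : 0 ≤ v ⬝ᵥ v :=
  Finset.sum_nonneg fun i _ => mul_self_nonneg (v i)

theorem dotProduct_self_pos {m : Type*} [Fintype m] {v : m → ℝ} (hv : v ≠ 0) : 0 < v ⬝ᵥ v :=
  (dotProduct_self_nonneg v).lt_of_ne fun h => hv (dotProduct_self_eq_zero.1 h.symm)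

theorem dotProduct_self_eq_sum {m : Type*} [Fintype m] (v : m → ℝ) : v ⬝ᵥ v = ∑ j, v j ^ 2 :=
  Finset.sum_congr rfl fun j _ => by ring

theorem singVal_antitone {n p : ℕ} (X : Matrix (Fin n) (Fin p) ℝ) : Antitone (singVal X) :=
  LinearMap.singularValues_antitone _

theorem singVal_nonneg {n p : ℕ} (X : Matrix (Fin n) (Fin p) ℝ) (j : ℕ) : 0 ≤ singVal X j :=
  LinearMap.singularValues_nonneg _ _

theorem finrank_range_toEuclideanLin {n p : ℕ} (X : Matrix (Fin n) (Fin p) ℝ) :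
    Module.finrank ℝ (Matrix.toEuclideanLin X).range = X.rank := by
  rw [Matrix.rank_eq_finrank_range_toLin X (PiLp.basisFun 2 ℝ (Fin n)) (PiLp.basisFun 2 ℝ (Fin p)),
    ← Matrix.toLpLin_eq_toLin]

theorem singVal_pos_iff {n p : ℕ} (X : Matrix (Fin n) (Fin p) ℝ) {j : ℕ} :
    0 < singVal X j ↔ j < X.rank := by
  rw [← finrank_range_toEuclideanLin]
  exact LinearMap.singularValues_pos_iff_lt_finrank_range _

theorem singVal_eq_zero {n p : ℕ} (X : Matrix (Fin n) (Fin p) ℝ) {j : ℕ} (h : X.rank ≤ j) :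
    singVal X j = 0 :=
  le_antisymm (not_lt.1 fun h' => absurd ((singVal_pos_iff X).1 h') (not_lt.2 h))
    (singVal_nonneg X j)

theorem IsTopRightSingular.gram_mul {n p k : ℕ} {X : Matrix (Fin n) (Fin p) ℝ}
    {U : Matrix (Fin p) (Fin k) ℝ} (hU : IsTopRightSingular X U) :
    Xᵀ * X * U = U * diagonal fun j : Fin k => singVal X j ^ 2 := by
  ext i j
  have := congrFun (hU.2 j) i
  rw [mul_diagonal, mul_comm]
  simpa [Matrix.mul_apply, mulVec, dotProduct] using this

theorem IsTopRightSingular.gram_mul_self {n p k : ℕ} {X : Matrix (Fin n) (Fin p) ℝ}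
    {U : Matrix (Fin p) (Fin k) ℝ} (hU : IsTopRightSingular X U) :
    (X * U)ᵀ * (X * U) = diagonal fun j : Fin k => singVal X j ^ 2 := by
  rw [transpose_mul, Matrix.mul_assoc, ← Matrix.mul_assoc Xᵀ, hU.gram_mul, ← Matrix.mul_assoc,
    hU.1, Matrix.one_mul]

theorem IsTopRightSingular.sq_mulVec {n p k : ℕ} {X : Matrix (Fin n) (Fin p) ℝ}
    {U : Matrix (Fin p) (Fin k) ℝ} (hU : IsTopRightSingular X U) (c : Fin k → ℝ) :
    (X *ᵥ (U *ᵥ c)) ⬝ᵥ (X *ᵥ (U *ᵥ c)) = ∑ j : Fin k, singVal X j ^ 2 * c j ^ 2 := by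
  rw [mulVec_mulVec, mulVec_dotProduct_mulVec, hU.gram_mul_self, dotProduct_diagonal_mulVec]

/-- One half of the Courant-Fischer theorem. -/
theorem exists_sq_mulVec_le_singVal {n p : ℕ} (X : Matrix (Fin n) (Fin p) ℝ) (k : ℕ) :
    ∃ L : Matrix (Fin k) (Fin p) ℝ, ∀ x, L *ᵥ x = 0 →
      (X *ᵥ x) ⬝ᵥ (X *ᵥ x) ≤ singVal X k ^ 2 * (x ⬝ᵥ x) := by
  obtain ⟨V, hV⟩ := exists_isTopRightSingular X le_rfl
  have hV' : V * Vᵀ = 1 := mul_eq_one_comm.1 hV.1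
  -- The rows of `L` are the first k right singular vectors, padded with zero rows if k > p.
  refine ⟨Matrix.of fun i l => if h : (i : ℕ) < p then V l ⟨i, h⟩ else 0, fun x hx => ?_⟩
  have hx0 : ∀ j : Fin p, (j : ℕ) < k → (Vᵀ *ᵥ x) j = 0 := by
    intro j hj
    have := congrFun hx ⟨j, hj⟩
    simpa [mulVec, dotProduct] using this
  have hxV : x = V *ᵥ (Vᵀ *ᵥ x) := by rw [mulVec_mulVec, hV', one_mulVec]
  have h1 : (X *ᵥ x) ⬝ᵥ (X *ᵥ x) = ∑ j : Fin p, singVal X j ^ 2 * (Vᵀ *ᵥ x) j ^ 2 := by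
    conv_lhs => rw [hxV]
    exact hV.sq_mulVec _
  have h2 : x ⬝ᵥ x = ∑ j : Fin p, (Vᵀ *ᵥ x) j ^ 2 := by
    conv_lhs => rw [hxV]
    rw [mulVec_dotProduct_self_of_orthogonal hV.1, dotProduct_self_eq_sum]
  rw [h1, h2, Finset.mul_sum]
  refine Finset.sum_le_sum fun j _ => ?_
  rcases lt_or_ge (j : ℕ) k with hj | hj
  · rw [hx0 j hj]; simp
  · exact mul_le_mul_of_nonneg_right
      (pow_le_pow_left₀ (singVal_nonneg X _) (singVal_antitone X hj) 2) (sq_nonneg _)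

/-- On the orthogonal complement of the top `k` right singular vectors, `X` is bounded by the
next singular value, provided that there is a gap. -/
theorem IsTopRightSingular.sq_mulVec_le_of_orthogonal {n p k : ℕ} {X : Matrix (Fin n) (Fin p) ℝ}
    {U : Matrix (Fin p) (Fin k) ℝ} (hU : IsTopRightSingular X U)
    (hgap : ∀ j < k, singVal X k ^ 2 < singVal X j ^ 2) {v : Fin p → ℝ} (hv : Uᵀ *ᵥ v = 0) :
    (X *ᵥ v) ⬝ᵥ (X *ᵥ v) ≤ singVal X k ^ 2 * (v ⬝ᵥ v) := by
  by_contra! hlt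
  obtain ⟨L, hL⟩ := exists_sq_mulVec_le_singVal X k
  -- The columns of U together with v number k + 1, so some nonzero combination lies in the kernel
  -- of `L`, of codimension at most k. There ‖X·‖² ≤ σ²‖·‖² with σ = `singVal X k`; but the cross
  -- terms vanish, and the gap and the assumed failure at v make every nonzero coefficient
  -- contribute strictly in the other direction.
  let B : Matrix (Fin p) (Fin k ⊕ Unit) ℝ := fromCols U (Matrix.of fun i _ => v i)
  obtain ⟨c, hc, h0⟩ := exists_mulVec_eq_zero_of_card_lt (L * B) (by simp)
  set c₁ : Fin k → ℝ := fun j => c (Sum.inl j) with hc₁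
  set d : ℝ := c (Sum.inr ()) with hd
  have hBc : B *ᵥ c = U *ᵥ c₁ + d • v := by
    ext i
    simp [B, mulVec, dotProduct, fromCols, hc₁, hd, mul_comm]
  have hUv : (U *ᵥ c₁) ⬝ᵥ v = 0 := by
    have := transpose_mulVec_dotProduct Uᵀ c₁ v
    rw [transpose_transpose, hv] at this
    simpa using this
  have hXUv : (X *ᵥ (U *ᵥ c₁)) ⬝ᵥ (X *ᵥ v) = 0 := by
    rw [dotProduct_comm, mulVec_dotProduct_mulVec, mulVec_mulVec, hU.gram_mul, ← mulVec_mulVec,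
      ← transpose_mulVec_dotProduct, hv, zero_dotProduct]
  have h1 := hL (B *ᵥ c) (by rw [mulVec_mulVec, h0])
  rw [hBc, mulVec_add, mulVec_smul] at h1
  simp only [add_dotProduct, dotProduct_add, smul_dotProduct, dotProduct_smul, smul_eq_mul,
    hUv, hXUv, dotProduct_comm v (U *ᵥ c₁), dotProduct_comm (X *ᵥ v) (X *ᵥ (U *ᵥ c₁)), mul_zero,
    add_zero, zero_add] at h1
  rw [hU.sq_mulVec, mulVec_dotProduct_self_of_orthogonal hU.1] at h1
  have h2 : 0 ≤ ∑ j : Fin k, (singVal X j ^ 2 - singVal X k ^ 2) * c₁ j ^ 2 :=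
    Finset.sum_nonneg fun j _ => mul_nonneg (sub_pos.2 (hgap j j.2)).le (sq_nonneg _)
  have h3 : ∑ j : Fin k, (singVal X j ^ 2 - singVal X k ^ 2) * c₁ j ^ 2
      + d ^ 2 * ((X *ᵥ v) ⬝ᵥ (X *ᵥ v) - singVal X k ^ 2 * (v ⬝ᵥ v)) ≤ 0 := by
    rw [dotProduct_self_eq_sum c₁] at h1
    simp only [sub_mul, Finset.sum_sub_distrib, ← Finset.mul_sum]
    linarith
  have hd0 : d = 0 := by
    by_contra hd0
    have : 0 < d ^ 2 * ((X *ᵥ v) ⬝ᵥ (X *ᵥ v) - singVal X k ^ 2 * (v ⬝ᵥ v)) :=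
      mul_pos (by positivity) (sub_pos.2 hlt)
    linarith
  have hc0 : ∀ j, c₁ j = 0 := by
    intro j
    by_contra hj
    have : 0 < ∑ j : Fin k, (singVal X j ^ 2 - singVal X k ^ 2) * c₁ j ^ 2 :=
      Finset.sum_pos' (fun j _ => mul_nonneg (sub_pos.2 (hgap j j.2)).le (sq_nonneg _))
        ⟨j, Finset.mem_univ _, mul_pos (sub_pos.2 (hgap j j.2)) (by positivity)⟩
    rw [hd0] at h3
    simp at h3
    linarith
  apply hc
  ext (j | j)
  · exact hc0 j
  · exact hd0

/-! ### The elbow rule -/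

theorem sHat_le_rank {n p : ℕ} (X : Matrix (Fin n) (Fin p) ℝ) (τ : ℝ) : sHat X τ ≤ X.rank :=
  Nat.findGreatest_le _

theorem le_singVal_sq_of_lt_sHat {n p : ℕ} (hn : 1 ≤ n) (X : Matrix (Fin n) (Fin p) ℝ) (τ : ℝ)
    {j : ℕ} (hj : j < sHat X τ) : n * τ ≤ singVal X j ^ 2 := by
  classical
  have hn' : (0 : ℝ) < n := by exact_mod_cast hn
  -- The candidate k = 0 always qualifies because λ̂_0 = ∞.
  have h := Nat.findGreatest_spec (P := fun k => (τ : EReal) ≤ lambdaHat X k) (m := 0)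
    (n := X.rank) (Nat.zero_le _) le_top
  have h' : (τ : EReal) ≤ lambdaHat X (sHat X τ) := by
    unfold sHat; convert h
  obtain ⟨k, hk⟩ : ∃ k, sHat X τ = k + 1 := ⟨sHat X τ - 1, by omega⟩
  rw [hk] at h' hj
  have h2 : τ ≤ singVal X k ^ 2 / n := by
    have : (τ : EReal) ≤ ((singVal X k ^ 2 / n : ℝ) : EReal) := h'
    exact_mod_cast this
  rw [le_div_iff₀ hn'] at h2
  have h3 : singVal X k ^ 2 ≤ singVal X j ^ 2 :=
    pow_le_pow_left₀ (singVal_nonneg X _) (singVal_antitone X (by omega)) 2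
  linarith

theorem singVal_sHat_sq_lt {n p : ℕ} (hn : 1 ≤ n) (X : Matrix (Fin n) (Fin p) ℝ) (τ : ℝ)
    (hlt : sHat X τ < X.rank) : singVal X (sHat X τ) ^ 2 < n * τ := by
  classical
  have hn' : (0 : ℝ) < n := by exact_mod_cast hn
  have h : ¬ (τ : EReal) ≤ lambdaHat X (sHat X τ + 1) :=
    Nat.findGreatest_is_greatest (Nat.lt_succ_self _) hlt
  have h2 : ¬ τ ≤ singVal X (sHat X τ) ^ 2 / n := fun h' => h (by
    change (τ : EReal) ≤ ((singVal X (sHat X τ) ^ 2 / n : ℝ) : EReal)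
    exact_mod_cast h')
  rw [not_le, div_lt_iff₀ hn'] at h2
  linarith

theorem singVal_sHat_sq_le {n p : ℕ} (hn : 1 ≤ n) (X : Matrix (Fin n) (Fin p) ℝ) {τ : ℝ}
    (hτ : 0 ≤ τ) : singVal X (sHat X τ) ^ 2 ≤ n * τ := by
  rcases (sHat_le_rank X τ).lt_or_eq with h | h
  · exact (singVal_sHat_sq_lt hn X τ h).le
  · rw [h, singVal_eq_zero X le_rfl]
    have : (0 : ℝ) ≤ n * τ := by positivity
    simpa using this

/-- The rule stops either because the next singular value falls below the threshold or because the
rank is exhausted, and then the next one is 0; both leave a strict gap. Hence ties among singular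
values never make the span of U ambiguous. -/
theorem singVal_sHat_gap {n p : ℕ} (hn : 1 ≤ n) (X : Matrix (Fin n) (Fin p) ℝ) (τ : ℝ) :
    ∀ j < sHat X τ, singVal X (sHat X τ) ^ 2 < singVal X j ^ 2 := by
  intro j hj
  rcases (sHat_le_rank X τ).lt_or_eq with h | h
  · exact (singVal_sHat_sq_lt hn X τ h).trans_le (le_singVal_sq_of_lt_sHat hn X τ hj)
  · have h0 : 0 < singVal X j := (singVal_pos_iff X).2 (h ▸ hj)
    have h1 : singVal X (sHat X τ) = 0 := singVal_eq_zero X h.ge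
    rw [h1]
    simpa using pow_pos h0 2

/-! ### Principal component regression with fixed data -/

theorem isMoorePenrose_pinv {m n : Type*} [Fintype m] [Fintype n] [DecidableEq n]
    (M : Matrix m n ℝ) : IsMoorePenrose M (pinv M) :=
  (exists_isMoorePenrose M).choose_spec

theorem IsMoorePenrose.gram_mul {m n : Type*} [Fintype m] [Fintype n]
    {M : Matrix m n ℝ} {N : Matrix n m ℝ} (h : IsMoorePenrose M N) : Mᵀ * M * N = Mᵀ := by
  rw [Matrix.mul_assoc, ← h.symm_left, ← transpose_mul, h.mul_mul_left]

/-- Two Penrose equations make `M * N` symmetric and idempotent, hence an orthogonal projection.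
This identity is all that is used of it in the contraction estimates and for the projected noise. -/
theorem IsMoorePenrose.sq_mulVec {m n : Type*} [Fintype m] [Fintype n]
    {M : Matrix m n ℝ} {N : Matrix n m ℝ} (h : IsMoorePenrose M N) (y : m → ℝ) :
    (M *ᵥ (N *ᵥ y)) ⬝ᵥ (M *ᵥ (N *ᵥ y)) = (M *ᵥ (N *ᵥ y)) ⬝ᵥ y := by
  rw [mulVec_mulVec, mulVec_dotProduct_mulVec, h.symm_left, ← Matrix.mul_assoc, h.mul_mul_left,
    dotProduct_comm]

theorem IsMoorePenrose.sq_sub_mulVec_le {m n : Type*} [Fintype m] [Fintype n]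
    {M : Matrix m n ℝ} {N : Matrix n m ℝ} (h : IsMoorePenrose M N) (y : m → ℝ) :
    (y - M *ᵥ (N *ᵥ y)) ⬝ᵥ (y - M *ᵥ (N *ᵥ y)) ≤ y ⬝ᵥ y := by
  have h1 := h.sq_mulVec y
  have h2 := dotProduct_self_nonneg (M *ᵥ (N *ᵥ y))
  simp only [sub_dotProduct, dotProduct_sub, dotProduct_comm y (M *ᵥ (N *ᵥ y))]
  linarith

theorem IsMoorePenrose.sq_mulVec_le {m n : Type*} [Fintype m] [Fintype n]
    {M : Matrix m n ℝ} {N : Matrix n m ℝ} (h : IsMoorePenrose M N) (y : m → ℝ) :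
    (M *ᵥ (N *ᵥ y)) ⬝ᵥ (M *ᵥ (N *ᵥ y)) ≤ y ⬝ᵥ y := by
  have h1 := h.sq_mulVec y
  have h2 := dotProduct_self_nonneg (y - M *ᵥ (N *ᵥ y))
  simp only [sub_dotProduct, dotProduct_sub, dotProduct_comm y (M *ᵥ (N *ᵥ y))] at h2
  linarith

theorem sq_add_three_le {m : Type*} [Fintype m] (a b c : m → ℝ) :
    (a - b + c) ⬝ᵥ (a - b + c) ≤ 3 * (a ⬝ᵥ a + b ⬝ᵥ b + c ⬝ᵥ c) := by
  simp only [dotProduct, ← Finset.sum_add_distrib, Finset.mul_sum, Pi.add_apply, Pi.sub_apply]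
  refine Finset.sum_le_sum fun i _ => ?_
  nlinarith [sq_nonneg (a i + b i), sq_nonneg (a i - c i), sq_nonneg (b i + c i)]

theorem sq_add_four_le {m : Type*} [Fintype m] (a b c d : m → ℝ) :
    (a - b - c + d) ⬝ᵥ (a - b - c + d) ≤ 4 * (a ⬝ᵥ a + b ⬝ᵥ b + c ⬝ᵥ c + d ⬝ᵥ d) := by
  simp only [dotProduct, ← Finset.sum_add_distrib, Finset.mul_sum, Pi.add_apply, Pi.sub_apply]
  refine Finset.sum_le_sum fun i _ => ?_
  nlinarith [sq_nonneg (a i + b i), sq_nonneg (a i + c i), sq_nonneg (a i - d i),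
    sq_nonneg (b i - c i), sq_nonneg (b i + d i), sq_nonneg (c i + d i)]

theorem sq_transpose_mulVec_le {m n : Type*} [Fintype m] [Fintype n] [DecidableEq n]
    {U : Matrix m n ℝ} (hU : Uᵀ * U = 1) (v : m → ℝ) :
    (Uᵀ *ᵥ v) ⬝ᵥ (Uᵀ *ᵥ v) ≤ v ⬝ᵥ v ∧
      (v - U *ᵥ (Uᵀ *ᵥ v)) ⬝ᵥ (v - U *ᵥ (Uᵀ *ᵥ v)) ≤ v ⬝ᵥ v := by
  have h1 : (U *ᵥ (Uᵀ *ᵥ v)) ⬝ᵥ (U *ᵥ (Uᵀ *ᵥ v)) = (Uᵀ *ᵥ v) ⬝ᵥ (Uᵀ *ᵥ v) :=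
    mulVec_dotProduct_self_of_orthogonal hU _
  have h2 : v ⬝ᵥ (U *ᵥ (Uᵀ *ᵥ v)) = (Uᵀ *ᵥ v) ⬝ᵥ (Uᵀ *ᵥ v) :=
    (transpose_mulVec_dotProduct U v _).symm
  have h3 := dotProduct_self_nonneg (v - U *ᵥ (Uᵀ *ᵥ v))
  have h4 := dotProduct_self_nonneg (Uᵀ *ᵥ v)
  have h5 : (v - U *ᵥ (Uᵀ *ᵥ v)) ⬝ᵥ (v - U *ᵥ (Uᵀ *ᵥ v)) = v ⬝ᵥ v - (Uᵀ *ᵥ v) ⬝ᵥ (Uᵀ *ᵥ v) := by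
    simp only [sub_dotProduct, dotProduct_sub, dotProduct_comm (U *ᵥ (Uᵀ *ᵥ v)) v, h1, h2]
    rw [← h1, dotProduct_comm (U *ᵥ (Uᵀ *ᵥ v)), h1]
    ring
  constructor <;> linarith

/-- The deterministic error bound for principal component regression. -/
theorem coef_error_le {n p k K : ℕ} {Z : Matrix (Fin n) (Fin K) ℝ} {W X : Matrix (Fin n) (Fin p) ℝ}
    {A : Matrix (Fin p) (Fin K) ℝ} (hX : X = Z * Aᵀ + W) {a : Fin p → ℝ} {β : Fin K → ℝ}
    (ha : Aᵀ *ᵥ a = β) (e : Fin n → ℝ) {U : Matrix (Fin p) (Fin k) ℝ}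
    (hU : IsTopRightSingular X U) {B T : ℝ} (hB : 0 ≤ B) (hBT : B ≤ T)
    (hpos : ∀ j < k, 0 < singVal X j) (hT : ∀ j < k, T ≤ singVal X j ^ 2)
    (horth : ∀ v, Uᵀ *ᵥ v = 0 → (X *ᵥ v) ⬝ᵥ (X *ᵥ v) ≤ T * (v ⬝ᵥ v))
    (hW : ∀ v, (W *ᵥ v) ⬝ᵥ (W *ᵥ v) ≤ B * (v ⬝ᵥ v)) {w : Fin n → ℝ}
    (hw : w = (X * U) *ᵥ (pinv (X * U) *ᵥ e)) :
    B * (coef X (Z *ᵥ β + e) U ⬝ᵥ coef X (Z *ᵥ β + e) U) ≤ 6 * B * (a ⬝ᵥ a) + 3 * (w ⬝ᵥ w) ∧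
    (Z *ᵥ (β - Aᵀ *ᵥ coef X (Z *ᵥ β + e) U)) ⬝ᵥ (Z *ᵥ (β - Aᵀ *ᵥ coef X (Z *ᵥ β + e) U))
      ≤ 4 * (T * (a ⬝ᵥ a) + 7 * B * (a ⬝ᵥ a) + 4 * (w ⬝ᵥ w)) := by
  set D := X * U with hD
  set N := pinv D with hN
  set α := coef X (Z *ᵥ β + e) U with hα
  have hMP : IsMoorePenrose D N := isMoorePenrose_pinv D
  have hg := hU.gram_mul_self
  have hα' : α = U *ᵥ (N *ᵥ (Z *ᵥ β + e)) := rfl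
  -- Although `N` is only the pseudo-inverse of XU, it acts on all of X: both sides agree after
  -- multiplication by DᵀD, which is diagonal with positive entries.
  have hNX : N * X = Uᵀ := by
    have h1 : diagonal (fun j : Fin k => singVal X j ^ 2) * (N * X)
        = diagonal (fun j : Fin k => singVal X j ^ 2) * Uᵀ := by
      rw [← Matrix.mul_assoc, ← hg, hMP.gram_mul, hg, hD, transpose_mul, Matrix.mul_assoc]
      have := congrArg transpose hU.gram_mul
      simpa [transpose_mul, diagonal_transpose, Matrix.mul_assoc] using this
    ext i j
    have := congrFun (congrFun h1 i) j
    rw [diagonal_mul, diagonal_mul] at this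
    exact mul_left_cancel₀ (pow_pos (hpos i i.2) 2).ne' this
  have hZβ : Z *ᵥ β = X *ᵥ a - W *ᵥ a := by
    rw [hX, add_mulVec, ← mulVec_mulVec, ha]; simp
  -- Each retained singular value satisfies σ_j² ≥ T, so D expands squared norms by at least T. This
  -- is how the threshold controls the inverse.
  have hNT : ∀ y, T * ((N *ᵥ y) ⬝ᵥ (N *ᵥ y)) ≤ (D *ᵥ (N *ᵥ y)) ⬝ᵥ (D *ᵥ (N *ᵥ y)) := by
    intro y
    rw [mulVec_dotProduct_mulVec D D, hg, dotProduct_diagonal_mulVec, dotProduct_self_eq_sum,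
      Finset.mul_sum]
    exact Finset.sum_le_sum fun j _ => mul_le_mul_of_nonneg_right (hT j j.2) (sq_nonneg _)
  have hq := dotProduct_self_nonneg a
  have hNY : N *ᵥ (Z *ᵥ β + e) = Uᵀ *ᵥ a - N *ᵥ (W *ᵥ a) + N *ᵥ e := by
    rw [hZβ, mulVec_add, mulVec_sub, mulVec_mulVec, hNX]
  have hαα : α ⬝ᵥ α = (N *ᵥ (Z *ᵥ β + e)) ⬝ᵥ (N *ᵥ (Z *ᵥ β + e)) := by
    rw [hα', mulVec_dotProduct_self_of_orthogonal hU.1]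
  have hN1 : B * ((N *ᵥ (W *ᵥ a)) ⬝ᵥ (N *ᵥ (W *ᵥ a))) ≤ B * (a ⬝ᵥ a) :=
    calc _ ≤ T * ((N *ᵥ (W *ᵥ a)) ⬝ᵥ (N *ᵥ (W *ᵥ a))) :=
          mul_le_mul_of_nonneg_right hBT (dotProduct_self_nonneg _)
      _ ≤ _ := hNT _
      _ ≤ _ := hMP.sq_mulVec_le _
      _ ≤ _ := hW a
  have hN2 : B * ((N *ᵥ e) ⬝ᵥ (N *ᵥ e)) ≤ w ⬝ᵥ w :=
    calc _ ≤ T * ((N *ᵥ e) ⬝ᵥ (N *ᵥ e)) :=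
          mul_le_mul_of_nonneg_right hBT (dotProduct_self_nonneg _)
      _ ≤ _ := hNT _
      _ = _ := by rw [hw]
  have hfirst : B * (α ⬝ᵥ α) ≤ 6 * B * (a ⬝ᵥ a) + 3 * (w ⬝ᵥ w) := by
    have h1 := sq_add_three_le (Uᵀ *ᵥ a) (N *ᵥ (W *ᵥ a)) (N *ᵥ e)
    rw [← hNY, ← hαα] at h1
    have h2 := mul_le_mul_of_nonneg_left h1 hB
    have h3 := mul_le_mul_of_nonneg_left (sq_transpose_mulVec_le hU.1 a).1 hB
    nlinarith
  refine ⟨hfirst, ?_⟩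
  have hPX : D *ᵥ (N *ᵥ (X *ᵥ a)) = X *ᵥ (U *ᵥ (Uᵀ *ᵥ a)) := by
    rw [mulVec_mulVec a N X, hNX, hD, mulVec_mulVec _ X U]
  -- The four sources of error: the part of a lost by truncation, the component of Wa orthogonal to
  -- the range of XU, the projected regression noise, and the noise W seen through the estimated
  -- coefficients.
  have hdec : Z *ᵥ (β - Aᵀ *ᵥ α) = X *ᵥ (a - U *ᵥ (Uᵀ *ᵥ a))
      - (W *ᵥ a - D *ᵥ (N *ᵥ (W *ᵥ a))) - w + W *ᵥ α := by
    have h1 : Z *ᵥ (Aᵀ *ᵥ α) = X *ᵥ α - W *ᵥ α := by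
      rw [hX, add_mulVec, ← mulVec_mulVec]; simp
    have h2 : X *ᵥ α = X *ᵥ (U *ᵥ (Uᵀ *ᵥ a)) - D *ᵥ (N *ᵥ (W *ᵥ a)) + w := by
      rw [hα', mulVec_mulVec _ X U, ← hD, hNY, mulVec_add, mulVec_sub, hw, hD,
        ← mulVec_mulVec _ X U]
    rw [mulVec_sub, h1, h2, hZβ, mulVec_sub]
    abel
  have h1 := sq_add_four_le (X *ᵥ (a - U *ᵥ (Uᵀ *ᵥ a))) (W *ᵥ a - D *ᵥ (N *ᵥ (W *ᵥ a))) w (W *ᵥ α)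
  rw [← hdec] at h1
  have hort0 : Uᵀ *ᵥ (a - U *ᵥ (Uᵀ *ᵥ a)) = 0 := by
    rw [mulVec_sub, mulVec_mulVec _ Uᵀ U, hU.1, one_mulVec, sub_self]
  have h2 : (X *ᵥ (a - U *ᵥ (Uᵀ *ᵥ a))) ⬝ᵥ (X *ᵥ (a - U *ᵥ (Uᵀ *ᵥ a))) ≤ T * (a ⬝ᵥ a) :=
    (horth _ hort0).trans (mul_le_mul_of_nonneg_left (sq_transpose_mulVec_le hU.1 a).2
      (hB.trans hBT))
  have h3 := (hMP.sq_sub_mulVec_le (W *ᵥ a)).trans (hW a)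
  have h4 := hW α
  linarith

/-! ### Smooth majorants of spectral projections -/

/-- If `w = F w'` is the orthogonal projection of `e` onto some subspace and `F ≥ 1/2` along `w`,
then `‖w‖² ≤ 2 eᵀ F e`. -/
theorem sq_le_two_mul_of_eq_mulVec {n : Type*} [Fintype n] {F : Matrix n n ℝ}
    (hF : F.PosSemidef) {e w w' : n → ℝ} (hw : F *ᵥ w' = w) (hw' : w' ⬝ᵥ w ≤ 2 * (w ⬝ᵥ w))
    (he : w ⬝ᵥ w = w ⬝ᵥ e) : w ⬝ᵥ w ≤ 2 * (e ⬝ᵥ (F *ᵥ e)) := by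
  -- Expanding the form at e − w'/2 gives eᵀFe ≥ w·e − (w'·w)/4, and the right side is at least ‖w‖²
  -- − ‖w‖²/2.
  have h := PosSemidef.dotProduct_mulVec_self_nonneg hF (e - (1 / 2 : ℝ) • w')
  have hsymm : w' ⬝ᵥ (F *ᵥ e) = w ⬝ᵥ e := by
    have hFt : Fᵀ = F := by simpa [conjTranspose_eq_transpose_of_trivial] using hF.1.eq
    rw [← transpose_mulVec_dotProduct, hFt, hw]
  rw [mulVec_sub, mulVec_smul, hw] at h
  simp only [sub_dotProduct, dotProduct_sub, smul_dotProduct, dotProduct_smul, smul_eq_mul, hsymm,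
    dotProduct_comm e w, ← he] at h
  linarith

theorem posSemidef_of_decomposition {n : Type*} [Fintype n] [DecidableEq n] {F V : Matrix n n ℝ}
    {f : n → ℝ} (hF : F = V * diagonal f * Vᵀ) (hf : ∀ j, 0 ≤ f j) : F.PosSemidef := by
  have h : (diagonal f).PosSemidef := PosSemidef.diagonal hf
  have := h.mul_mul_conjTranspose_same V
  rwa [conjTranspose_eq_transpose_of_trivial, ← hF] at this

/-- The function `x ↦ xᵐ / (xᵐ + tᵐ)` of a matrix. -/
noncomputable def powFilter {n : Type*} [Fintype n] [DecidableEq n] (M : Matrix n n ℝ)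
    (m : ℕ) (t : ℝ) : Matrix n n ℝ :=
  M ^ m * (M ^ m + t ^ m • 1)⁻¹

theorem pow_of_decomposition {n : Type*} [Fintype n] [DecidableEq n] {M V : Matrix n n ℝ}
    {l : n → ℝ} (hV : Vᵀ * V = 1) (hV' : V * Vᵀ = 1) (hM : M = V * diagonal l * Vᵀ) (m : ℕ) :
    M ^ m = V * diagonal (fun j => l j ^ m) * Vᵀ := by
  induction m with
  | zero => simp [hV']
  | succ m ih =>
    rw [pow_succ, ih, hM]
    calc V * diagonal (fun j => l j ^ m) * Vᵀ * (V * diagonal l * Vᵀ)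
        = V * (diagonal (fun j => l j ^ m) * (Vᵀ * V) * diagonal l) * Vᵀ := by
          simp only [Matrix.mul_assoc]
      _ = _ := by
          rw [hV, Matrix.mul_one, diagonal_mul_diagonal]
          simp only [pow_succ]

theorem powFilter_of_decomposition {n : Type*} [Fintype n] [DecidableEq n] {M V : Matrix n n ℝ}
    {l : n → ℝ} (hV : Vᵀ * V = 1) (hV' : V * Vᵀ = 1) (hM : M = V * diagonal l * Vᵀ)
    (hl : ∀ j, 0 ≤ l j) (m : ℕ) {t : ℝ} (ht : 0 < t) :
    IsUnit (M ^ m + t ^ m • (1 : Matrix n n ℝ)).det ∧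
    powFilter M m t = V * diagonal (fun j => l j ^ m / (l j ^ m + t ^ m)) * Vᵀ := by
  have hpos : ∀ j, 0 < l j ^ m + t ^ m := fun j => add_pos_of_nonneg_of_pos
    (pow_nonneg (hl j) m) (pow_pos ht m)
  have key : ∀ a b : n → ℝ, (V * diagonal a * Vᵀ) * (V * diagonal b * Vᵀ) =
      V * diagonal (fun i => a i * b i) * Vᵀ := by
    intro a b
    calc (V * diagonal a * Vᵀ) * (V * diagonal b * Vᵀ)
        = V * diagonal a * (Vᵀ * V) * diagonal b * Vᵀ := by simp only [Matrix.mul_assoc]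
      _ = _ := by rw [hV, Matrix.mul_one, Matrix.mul_assoc V, diagonal_mul_diagonal]
  have h1 : M ^ m + t ^ m • (1 : Matrix n n ℝ) = V * diagonal (fun j => l j ^ m + t ^ m) * Vᵀ := by
    have h2 : t ^ m • (1 : Matrix n n ℝ) = V * diagonal (fun _ => t ^ m) * Vᵀ := by
      rw [← smul_one_eq_diagonal, Matrix.mul_smul, Matrix.mul_one, Matrix.smul_mul, hV']
    rw [pow_of_decomposition hV hV' hM, h2, ← Matrix.add_mul, ← Matrix.mul_add, diagonal_add]
  have h3 : (M ^ m + t ^ m • (1 : Matrix n n ℝ)) *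
      (V * diagonal (fun j => (l j ^ m + t ^ m)⁻¹) * Vᵀ)
      = 1 := by
    rw [h1, key]
    have : (fun i => (l i ^ m + t ^ m) * (l i ^ m + t ^ m)⁻¹) = fun _ => (1 : ℝ) :=
      funext fun i => mul_inv_cancel₀ (hpos i).ne'
    rw [this, diagonal_one, Matrix.mul_one, hV']
  refine ⟨Matrix.isUnit_det_of_right_inverse h3, ?_⟩
  rw [powFilter, Matrix.inv_eq_right_inv h3, pow_of_decomposition hV hV' hM, key]
  rfl

theorem powFilter_posSemidef {n : Type*} [Fintype n] [DecidableEq n] {M : Matrix n n ℝ}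
    (hM : M.PosSemidef) (m : ℕ) {t : ℝ} (ht : 0 < t) :
    (powFilter M m t).PosSemidef ∧ (∀ u, u ⬝ᵥ (powFilter M m t *ᵥ u) ≤ u ⬝ᵥ u) := by
  obtain ⟨V, l, hV, hV', hMV⟩ := exists_spectral_decomposition hM.1
  have hl : ∀ j, 0 ≤ l j := fun j => by
    rw [eigenvalue_eq_dotProduct hV hMV]
    exact PosSemidef.dotProduct_mulVec_self_nonneg hM _
  obtain ⟨-, hF⟩ := powFilter_of_decomposition hV hV' hMV hl m ht
  have hp : ∀ j, 0 ≤ l j ^ m := fun j => pow_nonneg (hl j) m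
  have ht' := pow_pos ht m
  refine ⟨posSemidef_of_decomposition hF fun j => div_nonneg (hp j) (by linarith [hp j]),
    fun u => ?_⟩
  have hVt : Vᵀᵀ * Vᵀ = 1 := by rw [transpose_transpose, hV']
  rw [dotProduct_mulVec_of_decomposition hF, ← mulVec_dotProduct_self_of_orthogonal hVt u,
    dotProduct_self_eq_sum]
  refine Finset.sum_le_sum fun j _ => mul_le_of_le_one_left (sq_nonneg _) ?_
  exact div_le_one_of_le₀ (by linarith) (by linarith [hp j])

/-- If `M ≤ b` on a subspace of codimension `k` then the number of eigenvalues of `M` above `b` is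
at most `k`; the remaining ones contribute at most `1` to the trace of the filter. -/
theorem trace_powFilter_le {n k : ℕ} {M : Matrix (Fin n) (Fin n) ℝ}
    (hM : M.PosSemidef) {m : ℕ} {t b : ℝ} (ht : 0 < t) (hbt : n * b ^ m ≤ t ^ m)
    (L : Matrix (Fin k) (Fin n) ℝ) (hL : ∀ v, L *ᵥ v = 0 → v ⬝ᵥ (M *ᵥ v) ≤ b * (v ⬝ᵥ v)) :
    (powFilter M m t).trace ≤ k + 1 := by
  obtain ⟨V, l, hV, hV', hMV⟩ := exists_spectral_decomposition hM.1
  have hl : ∀ j, 0 ≤ l j := fun j => by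
    rw [eigenvalue_eq_dotProduct hV hMV]
    exact PosSemidef.dotProduct_mulVec_self_nonneg hM _
  obtain ⟨-, hF⟩ := powFilter_of_decomposition hV hV' hMV hl m ht
  have hp : ∀ j, 0 ≤ l j ^ m := fun j => pow_nonneg (hl j) m
  have ht' := pow_pos ht m
  rw [trace_of_decomposition hV hF]
  set J := Finset.univ.filter fun j => b < l j with hJ
  have hcard : J.card ≤ k := by
    by_contra! hlt
    -- `E` embeds coordinates indexed by J. If J had more than k elements, the span of its
    -- eigenvectors would meet the kernel of `L`, where M ≤ b, although M > b on that span away from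
    -- 0.
    let E : Matrix (Fin n) J ℝ := Matrix.of fun i j => if i = j then 1 else 0
    have hE : ∀ c : J → ℝ, ∀ i, (E *ᵥ c) i = if h : i ∈ J then c ⟨i, h⟩ else 0 := by
      intro c i
      simp only [mulVec, dotProduct, E, Matrix.of_apply, ite_mul, one_mul, zero_mul]
      split_ifs with h
      · rw [Finset.sum_eq_single ⟨i, h⟩]
        · simp
        · intro j _ hj
          exact if_neg fun hij => hj (Subtype.ext hij.symm)
        · simp
      · exact Finset.sum_eq_zero fun j _ => if_neg fun (hij : i = j) => h (hij ▸ j.2)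
    obtain ⟨c, hc, h0⟩ := exists_mulVec_eq_zero_of_card_lt (L * (V * E)) (by simpa using hlt)
    have h1 := hL (V *ᵥ (E *ᵥ c)) (by rw [mulVec_mulVec, mulVec_mulVec, Matrix.mul_assoc, h0])
    rw [dotProduct_mulVec_of_decomposition hMV, mulVec_mulVec _ Vᵀ V, hV, one_mulVec,
      mulVec_dotProduct_self_of_orthogonal hV, dotProduct_self_eq_sum, Finset.mul_sum] at h1
    refine absurd h1 (not_le.2 ?_)
    obtain ⟨j, hj⟩ : ∃ j, c j ≠ 0 := by
      by_contra! h; exact hc (funext h)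
    refine Finset.sum_lt_sum (fun i _ => ?_) ⟨j, Finset.mem_univ _, ?_⟩
    · rw [hE]
      split_ifs with h
      · exact mul_le_mul_of_nonneg_right (Finset.mem_filter.1 h).2.le (sq_nonneg _)
      · simp
    · rw [hE, dif_pos j.2]
      exact mul_lt_mul_of_pos_right (Finset.mem_filter.1 j.2).2 (by positivity)
  -- Eigenvalues above b count at most 1 each; the others at most bᵐ/tᵐ ≤ 1/n, so that all of them
  -- together add at most 1.
  have h1 : ∀ j, l j ^ m / (l j ^ m + t ^ m) ≤ (if j ∈ J then 1 else 0) + 1 / (n : ℝ) := by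
    intro j
    have hn : (0 : ℝ) < n := by exact_mod_cast (Fin.pos j)
    split_ifs with h
    · have : l j ^ m / (l j ^ m + t ^ m) ≤ 1 := div_le_one_of_le₀ (by linarith) (by linarith [hp j])
      have : 0 ≤ 1 / (n : ℝ) := by positivity
      linarith
    · rw [zero_add, div_le_div_iff₀ (by linarith [hp j]) hn]
      have hlb : l j ≤ b := by
        by_contra! hlt
        exact h (Finset.mem_filter.2 ⟨Finset.mem_univ _, hlt⟩)
      have h2 : l j ^ m ≤ b ^ m := pow_le_pow_left₀ (hl j) hlb m
      have h3 := mul_le_mul_of_nonneg_left h2 hn.le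
      linarith [hp j]
  refine (Finset.sum_le_sum fun j _ => h1 j).trans ?_
  rw [Finset.sum_add_distrib, Finset.sum_ite_mem]
  simp only [Finset.univ_inter, Finset.sum_const, nsmul_eq_mul, mul_one, Finset.card_univ,
    Fintype.card_fin]
  have h4 : (J.card : ℝ) ≤ k := by exact_mod_cast hcard
  have h5 : (n : ℝ) * (1 / n) ≤ 1 := by
    rw [mul_one_div]; exact div_self_le_one _
  linarith

/-- The projection onto the top left singular vectors is dominated by the filter. -/
theorem sq_proj_le_powFilter {n p k : ℕ} {X : Matrix (Fin n) (Fin p) ℝ}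
    {U : Matrix (Fin p) (Fin k) ℝ} (hU : IsTopRightSingular X U) {t : ℝ} (ht : 0 < t)
    (hT : ∀ j < k, t ≤ singVal X j ^ 2) (m : ℕ) (e : Fin n → ℝ) {w : Fin n → ℝ}
    (hw : w = (X * U) *ᵥ (pinv (X * U) *ᵥ e)) :
    w ⬝ᵥ w ≤ 2 * (e ⬝ᵥ (powFilter (X * Xᵀ) m t *ᵥ e)) := by
  set M := X * Xᵀ with hMdef
  have hM : M.PosSemidef := by
    simpa [conjTranspose_eq_transpose_of_trivial] using posSemidef_self_mul_conjTranspose X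
  set D := X * U with hD
  set c := pinv D *ᵥ e with hc
  have hMP : IsMoorePenrose D (pinv D) := isMoorePenrose_pinv D
  set s : Fin k → ℝ := fun j => singVal X j ^ 2 with hs
  have hspos : ∀ j, 0 < s j := fun j => ht.trans_le (hT j j.2)
  have hMD : M * D = D * diagonal s := by
    rw [hMdef, hD, Matrix.mul_assoc, ← Matrix.mul_assoc Xᵀ, hU.gram_mul, ← Matrix.mul_assoc]
  have hMmD : ∀ m, M ^ m * D = D * diagonal fun j => s j ^ m := by
    intro m
    induction m with
    | zero => simp
    | succ m ih =>
      rw [pow_succ, Matrix.mul_assoc, hMD, ← Matrix.mul_assoc, ih, Matrix.mul_assoc,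
        diagonal_mul_diagonal]
      simp only [pow_succ]
  have hpos : ∀ j, 0 < s j ^ m + t ^ m := fun j => by
    have := hspos j
    positivity
  have hunit : IsUnit (M ^ m + t ^ m • (1 : Matrix (Fin n) (Fin n) ℝ)).det := by
    obtain ⟨V, l, hV, hV', hMV⟩ := exists_spectral_decomposition hM.1
    refine (powFilter_of_decomposition hV hV' hMV (fun j => ?_) m ht).1
    rw [eigenvalue_eq_dotProduct hV hMV]
    exact PosSemidef.dotProduct_mulVec_self_nonneg hM _
  have hBD : (M ^ m + t ^ m • (1 : Matrix (Fin n) (Fin n) ℝ)) * D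
      = D * diagonal fun j => s j ^ m + t ^ m := by
    rw [Matrix.add_mul, hMmD, Matrix.smul_mul, Matrix.one_mul, ← diagonal_add, Matrix.mul_add,
      ← smul_one_eq_diagonal, Matrix.mul_smul, Matrix.mul_one]
  have hBinv : (M ^ m + t ^ m • (1 : Matrix (Fin n) (Fin n) ℝ))⁻¹ * D
      = D * diagonal fun j => (s j ^ m + t ^ m)⁻¹ := by
    have h1 : D = (M ^ m + t ^ m • (1 : Matrix (Fin n) (Fin n) ℝ)) *
        (D * diagonal fun j => (s j ^ m + t ^ m)⁻¹) := by
      rw [← Matrix.mul_assoc, hBD, Matrix.mul_assoc, diagonal_mul_diagonal]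
      have : (fun i => (s i ^ m + t ^ m) * (s i ^ m + t ^ m)⁻¹) = fun _ => (1 : ℝ) :=
        funext fun i => mul_inv_cancel₀ (hpos i).ne'
      rw [this, diagonal_one, Matrix.mul_one]
    conv_lhs => rw [h1]
    rw [nonsing_inv_mul_cancel_left _ _ hunit]
  have hFD : powFilter M m t * D = D * diagonal fun j => s j ^ m * (s j ^ m + t ^ m)⁻¹ := by
    rw [powFilter, Matrix.mul_assoc, hBinv, ← Matrix.mul_assoc, hMmD, Matrix.mul_assoc,
      diagonal_mul_diagonal]
  -- The vector w' is the preimage of w under the filter inside the range of D. It rescales the j-th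
  -- coordinate by 1 + (t/s_j)ᵐ, which is at most 2 because s_j ≥ t.
  refine sq_le_two_mul_of_eq_mulVec (powFilter_posSemidef hM m ht).1
    (w' := D *ᵥ (diagonal (fun j => (s j ^ m)⁻¹ * (s j ^ m + t ^ m)) *ᵥ c)) ?_ ?_ ?_
  · rw [mulVec_mulVec _ (powFilter M m t) D, hFD, mulVec_mulVec, Matrix.mul_assoc,
      diagonal_mul_diagonal]
    have : (fun j => s j ^ m * (s j ^ m + t ^ m)⁻¹ * ((s j ^ m)⁻¹ * (s j ^ m + t ^ m)))
        = fun _ => (1 : ℝ) := by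
      funext j
      have h1 := (hpos j).ne'
      have h2 := (pow_pos (hspos j) m).ne'
      field_simp
    rw [this, diagonal_one, Matrix.mul_one, hw]
  · rw [hw, mulVec_dotProduct_mulVec D D, mulVec_dotProduct_mulVec D D, hU.gram_mul_self]
    simp only [dotProduct, mulVec_diagonal, Finset.mul_sum]
    refine Finset.sum_le_sum fun j _ => ?_
    have h1 : (s j ^ m)⁻¹ * (s j ^ m + t ^ m) ≤ 2 := by
      rw [inv_mul_le_iff₀ (pow_pos (hspos j) m)]
      have := pow_le_pow_left₀ ht.le (hT j j.2) m
      simp only [hs] at this ⊢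
      linarith
    have h2 : 0 ≤ c j * (singVal X j ^ 2 * c j) := by
      have := hspos j
      nlinarith [mul_nonneg (sq_nonneg (singVal X j)) (sq_nonneg (c j))]
    calc _ = ((s j ^ m)⁻¹ * (s j ^ m + t ^ m)) * (c j * (singVal X j ^ 2 * c j)) := by ring
      _ ≤ _ := mul_le_mul_of_nonneg_right h1 h2
  · rw [hw]; exact hMP.sq_mulVec e

/-- The orthogonal projection onto the column space of a matrix of full column rank. -/
noncomputable def colProj {n k : Type*} [Fintype n] [Fintype k] [DecidableEq k] (Z : Matrix n k ℝ) :
    Matrix n n ℝ :=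
  Z * (Zᵀ * Z)⁻¹ * Zᵀ

theorem colProj_transpose {n k : Type*} [Fintype n] [Fintype k] [DecidableEq k]
    (Z : Matrix n k ℝ) : (colProj Z)ᵀ = colProj Z := by
  simp [colProj, transpose_mul, transpose_nonsing_inv, Matrix.mul_assoc]

theorem colProj_mul_self {n k : Type*} [Fintype n] [Fintype k] [DecidableEq k]
    (Z : Matrix n k ℝ) : colProj Z * colProj Z = colProj Z := by
  by_cases h : IsUnit (Zᵀ * Z).det
  · calc colProj Z * colProj Z = Z * ((Zᵀ * Z)⁻¹ * (Zᵀ * Z) * (Zᵀ * Z)⁻¹) * Zᵀ := by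
          simp only [colProj, Matrix.mul_assoc]
      _ = _ := by rw [nonsing_inv_mul _ h, Matrix.one_mul, colProj]
  -- For a singular Gram matrix the inverse is 0 by convention, and so is `colProj Z`; the bounds 0
  -- ≤ F ≤ 1 must hold for all data, not only on the good event.
  · simp [colProj, nonsing_inv_apply_not_isUnit _ h]

theorem dotProduct_colProj_mulVec {n k : Type*} [Fintype n] [Fintype k] [DecidableEq k]
    (Z : Matrix n k ℝ) (u : n → ℝ) :
    u ⬝ᵥ (colProj Z *ᵥ u) = (colProj Z *ᵥ u) ⬝ᵥ (colProj Z *ᵥ u) := by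
  rw [mulVec_dotProduct_mulVec, colProj_transpose, colProj_mul_self]

theorem colProj_posSemidef {n k : Type*} [Fintype n] [Fintype k] [DecidableEq k]
    (Z : Matrix n k ℝ) : (colProj Z).PosSemidef := by
  have := posSemidef_conjTranspose_mul_self (colProj Z)
  rwa [conjTranspose_eq_transpose_of_trivial, colProj_transpose, colProj_mul_self] at this

theorem colProj_le_one {n k : Type*} [Fintype n] [Fintype k] [DecidableEq k]
    (Z : Matrix n k ℝ) (u : n → ℝ) : u ⬝ᵥ (colProj Z *ᵥ u) ≤ u ⬝ᵥ u := by
  have h1 := dotProduct_colProj_mulVec Z u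
  have h2 := dotProduct_self_nonneg (u - colProj Z *ᵥ u)
  simp only [sub_dotProduct, dotProduct_sub, dotProduct_comm (colProj Z *ᵥ u) u] at h2
  linarith

theorem trace_colProj_le {n k : Type*} [Fintype n] [Fintype k] [DecidableEq k]
    (Z : Matrix n k ℝ) : (colProj Z).trace ≤ Fintype.card k := by
  rw [colProj, Matrix.mul_assoc, trace_mul_comm, Matrix.mul_assoc]
  by_cases h : IsUnit (Zᵀ * Z).det
  · rw [nonsing_inv_mul _ h, trace_one]
  · simp [nonsing_inv_apply_not_isUnit _ h]

/-- A vector in the column space is fixed by the projection, so w' = w is an admissible preimage. -/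
theorem sq_proj_le_colProj {n k : Type*} [Fintype n] [Fintype k] [DecidableEq k]
    {Z : Matrix n k ℝ} (hZ : IsUnit (Zᵀ * Z).det) {e w : n → ℝ} {c : k → ℝ} (hw : w = Z *ᵥ c)
    (he : w ⬝ᵥ w = w ⬝ᵥ e) : w ⬝ᵥ w ≤ 2 * (e ⬝ᵥ (colProj Z *ᵥ e)) := by
  refine sq_le_two_mul_of_eq_mulVec (colProj_posSemidef Z) (w' := w) ?_ ?_ he
  · rw [hw, mulVec_mulVec, colProj, Matrix.mul_assoc, Matrix.mul_assoc, nonsing_inv_mul _ hZ,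
      Matrix.mul_one]
  · linarith [dotProduct_self_nonneg w]

/-! ### Nets of the unit sphere -/

open Metric Module in
-- Volume comparison: the balls of radius ε/2 around the points are disjoint and lie in the ball of
-- radius 1 + ε/2 ≤ 3/2.
theorem card_le_of_pairwise_dist {E : Type*} [NormedAddCommGroup E] [NormedSpace ℝ E]
    [FiniteDimensional ℝ E] {ε : ℝ} (hε : 0 < ε) (hε1 : ε ≤ 1) (s : Finset E)
    (hs : ∀ c ∈ s, ‖c‖ ≤ 1) (h : ∀ c ∈ s, ∀ d ∈ s, c ≠ d → ε ≤ ‖c - d‖) :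
    (s.card : ℝ) ≤ (3 / ε) ^ finrank ℝ E := by
  borelize E
  let μ : Measure E := Measure.addHaar
  have hδ : 0 < ε / 2 := by positivity
  have hρ : (0 : ℝ) < 3 / 2 := by norm_num
  have D : Set.Pairwise (s : Set E) (Function.onFun Disjoint fun c => ball (c : E) (ε / 2)) := by
    rintro c hc d hd hcd
    apply ball_disjoint_ball
    rw [dist_eq_norm]
    linarith [h c hc d hd hcd]
  have hsub : (⋃ c ∈ s, ball (c : E) (ε / 2)) ⊆ ball (0 : E) (3 / 2) := by
    refine Set.iUnion₂_subset fun x hx => ball_subset_ball' ?_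
    rw [dist_zero_right]
    linarith [hs x hx]
  have I : (s.card : ENNReal) * ENNReal.ofReal ((ε / 2) ^ finrank ℝ E) * μ (ball 0 1) ≤
      ENNReal.ofReal ((3 / 2) ^ finrank ℝ E) * μ (ball 0 1) :=
    calc (s.card : ENNReal) * ENNReal.ofReal ((ε / 2) ^ finrank ℝ E) * μ (ball 0 1)
        = μ (⋃ c ∈ s, ball (c : E) (ε / 2)) := by
          rw [measure_biUnion_finset D fun c _ => measurableSet_ball]
          simp only [μ.addHaar_ball_of_pos _ hδ]
          simp only [Finset.sum_const, nsmul_eq_mul, mul_assoc]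
      _ ≤ μ (ball (0 : E) (3 / 2)) := measure_mono hsub
      _ = _ := by rw [μ.addHaar_ball_of_pos _ hρ]
  have J : (s.card : ENNReal) * ENNReal.ofReal ((ε / 2) ^ finrank ℝ E) ≤
      ENNReal.ofReal ((3 / 2) ^ finrank ℝ E) :=
    (ENNReal.mul_le_mul_iff_left (measure_ball_pos _ _ zero_lt_one).ne' measure_ball_lt_top.ne).1 I
  have K := ENNReal.toReal_le_of_le_ofReal (by positivity) J
  rw [ENNReal.toReal_mul, ENNReal.toReal_natCast, ENNReal.toReal_ofReal (by positivity),
    ← le_div_iff₀ (by positivity), ← div_pow] at K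
  refine K.trans (le_of_eq ?_)
  congr 1
  field_simp

theorem norm_sq_eq_dotProduct {d : ℕ} (x : EuclideanSpace ℝ (Fin d)) :
    ‖x‖ ^ 2 = WithLp.ofLp x ⬝ᵥ WithLp.ofLp x := by
  rw [EuclideanSpace.real_norm_sq_eq, dotProduct_self_eq_sum]

/-- `T` is an `ε`-net of the Euclidean unit sphere, made of unit vectors. -/
def IsSphereNet {d : ℕ} (T : Finset (Fin d → ℝ)) (ε : ℝ) : Prop :=
  (∀ t ∈ T, t ⬝ᵥ t = 1) ∧ ∀ v : Fin d → ℝ, v ⬝ᵥ v = 1 → ∃ t ∈ T, (v - t) ⬝ᵥ (v - t) ≤ ε ^ 2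

/-- An ε-separated subset of the sphere of maximal cardinality is a net, since a point far from it
could be added. The volume bound makes the maximum exist and bounds its size. -/
theorem exists_isSphereNet (d : ℕ) {ε : ℝ} (hε : 0 < ε) (hε1 : ε ≤ 1) :
    ∃ T : Finset (Fin d → ℝ), (T.card : ℝ) ≤ (3 / ε) ^ d ∧ IsSphereNet T ε := by
  classical
  let Sep : Finset (EuclideanSpace ℝ (Fin d)) → Prop := fun s =>
    (∀ c ∈ s, ‖c‖ = 1) ∧ ∀ c ∈ s, ∀ d ∈ s, c ≠ d → ε ≤ ‖c - d‖
  have hcard : ∀ s, Sep s → (s.card : ℝ) ≤ (3 / ε) ^ d := by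
    intro s hs
    have := card_le_of_pairwise_dist hε hε1 s (fun c hc => (hs.1 c hc).le) hs.2
    simpa using this
  have hmem := Nat.sSup_mem (s := {k | ∃ s, Sep s ∧ s.card = k})
    ⟨0, ∅, by simp [Sep], rfl⟩
    ⟨⌊(3 / ε) ^ d⌋₊, by
      rintro _ ⟨s, hs, rfl⟩
      exact Nat.le_floor (hcard s hs)⟩
  have hbdd : BddAbove {k | ∃ s, Sep s ∧ s.card = k} :=
    ⟨⌊(3 / ε) ^ d⌋₊, by
      rintro _ ⟨s, hs, rfl⟩
      exact Nat.le_floor (hcard s hs)⟩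
  obtain ⟨s, hs, hsc⟩ := hmem
  refine ⟨s.image WithLp.ofLp, ?_, ?_, ?_⟩
  · refine le_trans ?_ (hcard s hs)
    exact_mod_cast Finset.card_image_le
  · intro t ht
    obtain ⟨c, hc, rfl⟩ := Finset.mem_image.1 ht
    rw [← norm_sq_eq_dotProduct, hs.1 c hc, one_pow]
  · intro v hv
    set x : EuclideanSpace ℝ (Fin d) := WithLp.toLp 2 v with hx
    have hx1 : ‖x‖ = 1 := by
      have : ‖x‖ ^ 2 = 1 := by rw [norm_sq_eq_dotProduct, ← hv]
      nlinarith [norm_nonneg x]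
    obtain ⟨c, hc, hcx⟩ : ∃ c ∈ s, ‖x - c‖ ≤ ε := by
      by_contra! hcon
      have hxs : x ∉ s := fun h => by
        have := hcon x h
        rw [sub_self, norm_zero] at this
        linarith
      have hsep : Sep (insert x s) := by
        refine ⟨fun c hc => ?_, fun c hc d hd hcd => ?_⟩
        · rcases Finset.mem_insert.1 hc with rfl | hc
          · exact hx1
          · exact hs.1 c hc
        · rcases Finset.mem_insert.1 hc with rfl | hc <;>
            rcases Finset.mem_insert.1 hd with rfl | hd
          · exact absurd rfl hcd
          · exact (hcon d hd).le
          · rw [norm_sub_rev]; exact (hcon c hc).le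
          · exact hs.2 c hc d hd hcd
      have := le_csSup hbdd ⟨_, hsep, rfl⟩
      rw [Finset.card_insert_of_notMem hxs, hsc] at this
      omega
    refine ⟨WithLp.ofLp c, Finset.mem_image_of_mem _ hc, ?_⟩
    have h1 : (v - WithLp.ofLp c) ⬝ᵥ (v - WithLp.ofLp c) = ‖x - c‖ ^ 2 :=
      (norm_sq_eq_dotProduct (x - c)).symm
    rw [h1]
    exact pow_le_pow_left₀ (norm_nonneg _) hcx 2

theorem exists_unit_sq_mulVec_eq {d : ℕ} {m : Type*} [Fintype m] (M : Matrix m (Fin d) ℝ)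
    (v : Fin d → ℝ) (hv : v ≠ 0) : ∃ u, u ⬝ᵥ u = 1 ∧
      (M *ᵥ v) ⬝ᵥ (M *ᵥ v) = (v ⬝ᵥ v) * ((M *ᵥ u) ⬝ᵥ (M *ᵥ u)) := by
  have hpos := dotProduct_self_pos hv
  have hs := Real.sqrt_pos.2 hpos
  have hss := Real.mul_self_sqrt hpos.le
  refine ⟨(√(v ⬝ᵥ v))⁻¹ • v, ?_, ?_⟩
  · rw [smul_dotProduct, dotProduct_smul, smul_eq_mul, smul_eq_mul]
    nth_rewrite 3 [← hss]
    field_simp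
  · rw [mulVec_smul, smul_dotProduct, dotProduct_smul, smul_eq_mul, smul_eq_mul]
    nth_rewrite 1 [← hss]
    field_simp

/-- Approximating a unit vector by a net point gives ‖M‖ ≤ √B + ‖M‖/2, hence ‖M‖ ≤ 2√B. -/
theorem sq_mulVec_le_of_net {d n : ℕ} {T : Finset (Fin d → ℝ)} {ε : ℝ} (hε0 : 0 ≤ ε)
    (hε : ε ≤ 1 / 2) (hT : IsSphereNet T ε) (M : Matrix (Fin n) (Fin d) ℝ) {B : ℝ} (hB : 0 ≤ B)
    (h : ∀ t ∈ T, (M *ᵥ t) ⬝ᵥ (M *ᵥ t) ≤ B) (v : Fin d → ℝ) :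
    (M *ᵥ v) ⬝ᵥ (M *ᵥ v) ≤ 4 * B * (v ⬝ᵥ v) := by
  let f : EuclideanSpace ℝ (Fin d) →L[ℝ] EuclideanSpace ℝ (Fin n) :=
    LinearMap.toContinuousLinearMap (Matrix.toEuclideanLin M)
  have hf : ∀ x, ‖f x‖ ^ 2 = (M *ᵥ WithLp.ofLp x) ⬝ᵥ (M *ᵥ WithLp.ofLp x) := fun x =>
    norm_sq_eq_dotProduct (f x)
  have h1 : ‖f‖ ≤ √B + ‖f‖ / 2 := by
    refine ContinuousLinearMap.opNorm_le_of_unit_norm (by positivity) fun x hx => ?_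
    obtain ⟨t, ht, hxt⟩ := hT.2 (WithLp.ofLp x) (by rw [← norm_sq_eq_dotProduct, hx, one_pow])
    have h2 : ‖f (WithLp.toLp 2 t)‖ ≤ √B := by
      apply Real.le_sqrt_of_sq_le
      rw [hf]
      exact h t ht
    have h3 : ‖x - WithLp.toLp 2 t‖ ≤ 1 / 2 := by
      have h4 : ‖x - WithLp.toLp 2 t‖ ^ 2 ≤ ε ^ 2 := by
        rw [norm_sq_eq_dotProduct]; exact hxt
      exact ((le_abs_self _).trans (abs_le_of_sq_le_sq h4 hε0)).trans hε
    calc ‖f x‖ = ‖f (WithLp.toLp 2 t) + f (x - WithLp.toLp 2 t)‖ := by rw [← map_add]; congr 2; abel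
      _ ≤ ‖f (WithLp.toLp 2 t)‖ + ‖f (x - WithLp.toLp 2 t)‖ := norm_add_le _ _
      _ ≤ √B + ‖f‖ * (1 / 2) := add_le_add h2 ((f.le_opNorm _).trans
          (mul_le_mul_of_nonneg_left h3 (norm_nonneg _)))
      _ = _ := by ring
  have h2 : ‖f‖ ≤ 2 * √B := by linarith
  have h3 := f.le_opNorm (WithLp.toLp 2 v)
  have h4 : ‖f (WithLp.toLp 2 v)‖ ≤ 2 * √B * ‖WithLp.toLp 2 v‖ :=
    h3.trans (mul_le_mul_of_nonneg_right h2 (norm_nonneg _))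
  have h5 := pow_le_pow_left₀ (norm_nonneg _) h4 2
  rw [hf, mul_pow, mul_pow, Real.sq_sqrt hB, norm_sq_eq_dotProduct] at h5
  norm_num at h5
  exact h5

/-- For a net point t near u, b ≤ ‖Mt‖² ≤ 2‖Mu‖² + 2‖M(u − t)‖², and the last term is at most 8ε²B ≤
b/2. -/
theorem le_sq_mulVec_of_net {d n : ℕ} {T : Finset (Fin d → ℝ)} {ε : ℝ}
    (hT : IsSphereNet T ε) (M : Matrix (Fin n) (Fin d) ℝ) {B b : ℝ} (hB : 0 ≤ B)
    (hbB : 16 * ε ^ 2 * B ≤ b) (hup : ∀ v, (M *ᵥ v) ⬝ᵥ (M *ᵥ v) ≤ 4 * B * (v ⬝ᵥ v))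
    (h : ∀ t ∈ T, b ≤ (M *ᵥ t) ⬝ᵥ (M *ᵥ t)) (v : Fin d → ℝ) :
    b / 4 * (v ⬝ᵥ v) ≤ (M *ᵥ v) ⬝ᵥ (M *ᵥ v) := by
  rcases eq_or_ne v 0 with rfl | hv
  · simp
  obtain ⟨u, hu, huv⟩ := exists_unit_sq_mulVec_eq M v hv
  rw [huv, mul_comm]
  refine mul_le_mul_of_nonneg_left ?_ (dotProduct_self_nonneg v)
  obtain ⟨t, ht, hut⟩ := hT.2 u hu
  have h1 := h t ht
  have h2 := (hup (u - t)).trans (mul_le_mul_of_nonneg_left hut (by positivity))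
  have h3 : (M *ᵥ t) ⬝ᵥ (M *ᵥ t) ≤
      2 * ((M *ᵥ u) ⬝ᵥ (M *ᵥ u)) + 2 * ((M *ᵥ (u - t)) ⬝ᵥ (M *ᵥ (u - t))) := by
    have h4 := dotProduct_self_nonneg (M *ᵥ u + M *ᵥ (u - t))
    have h5 : M *ᵥ t = M *ᵥ u - M *ᵥ (u - t) := by rw [mulVec_sub]; abel
    rw [h5]
    simp only [add_dotProduct, dotProduct_add, sub_dotProduct, dotProduct_sub] at h4 ⊢
    linarith
  linarith

/-! ### Sub-Gaussian vectors -/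

theorem lintegral_exp_le_of_hasSubgaussianMGF {Ω : Type*} [MeasurableSpace Ω] {P : Measure Ω}
    {x : Ω → ℝ} {c : NNReal} (h : HasSubgaussianMGF x c P) :
    ∫⁻ ω, ENNReal.ofReal (Real.exp (x ω)) ∂P ≤ ENNReal.ofReal (Real.exp (c / 2)) := by
  have h1 := h.integrable_exp_mul 1
  have h2 := h.mgf_le 1
  simp only [one_mul, mgf, one_pow, mul_one] at h1 h2
  rw [← ofReal_integral_eq_lintegral_ofReal h1 (ae_of_all _ fun ω => (Real.exp_pos _).le)]
  exact ENNReal.ofReal_le_ofReal h2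

theorem hasSubgaussianMGF_const_mul {Ω : Type*} [MeasurableSpace Ω] {P : Measure Ω}
    {y : Ω → ℝ} {a : ℝ} (h : HasSubgaussianMGF y a.toNNReal P) (r : ℝ) :
    HasSubgaussianMGF (fun ω => r * y ω) (r ^ 2 * a).toNNReal P := by
  rw [Real.toNNReal_mul (sq_nonneg r), Real.toNNReal_of_nonneg (sq_nonneg r)]
  exact h.const_mul r

theorem hasSubgaussianMGF_sum_mul {Ω ι : Type*} [MeasurableSpace Ω] [Fintype ι] {P : Measure Ω}
    {y : ι → Ω → ℝ} {a : ℝ} (ha : 0 ≤ a) (hind : iIndepFun y P)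
    (h : ∀ i, HasSubgaussianMGF (y i) a.toNNReal P) (u : ι → ℝ) :
    HasSubgaussianMGF (fun ω => ∑ i, u i * y i ω) (a * (u ⬝ᵥ u)).toNNReal P := by
  have hind' : iIndepFun (fun i ω => u i * y i ω) P :=
    hind.comp (fun i t => u i * t) fun i => by fun_prop
  have h1 := HasSubgaussianMGF.sum_of_iIndepFun hind' (s := Finset.univ)
    (fun i _ => hasSubgaussianMGF_const_mul (h i) (u i))
  convert h1 using 1
  ext
  rw [Real.coe_toNNReal _ (mul_nonneg ha (dotProduct_self_nonneg u)), NNReal.coe_sum,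
    dotProduct_self_eq_sum, Finset.mul_sum]
  refine Finset.sum_congr rfl fun i _ => ?_
  rw [Real.coe_toNNReal _ (mul_nonneg (sq_nonneg _) ha), mul_comm]

theorem IsPSDSqrt.transpose_eq {d : ℕ} {R S : Matrix (Fin d) (Fin d) ℝ} (h : IsPSDSqrt R S) :
    Rᵀ = R := by
  simpa [conjTranspose_eq_transpose_of_trivial] using h.1.1.eq

theorem IsPSDSqrt.dotProduct_mulVec {d : ℕ} {R S : Matrix (Fin d) (Fin d) ℝ} (h : IsPSDSqrt R S)
    (v : Fin d → ℝ) : v ⬝ᵥ (S *ᵥ v) = (R *ᵥ v) ⬝ᵥ (R *ᵥ v) := by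
  rw [mulVec_dotProduct_mulVec, h.transpose_eq, h.2]

theorem IsPSDSqrt.posSemidef {d : ℕ} {R S : Matrix (Fin d) (Fin d) ℝ} (h : IsPSDSqrt R S) :
    S.PosSemidef := by
  have := posSemidef_conjTranspose_mul_self R
  rwa [conjTranspose_eq_transpose_of_trivial, h.transpose_eq, h.2] at this

theorem IsSubGaussianVec.hasSubgaussianMGF {Ω : Type*} [MeasurableSpace Ω] {P : Measure Ω}
    [IsProbabilityMeasure P] {d : ℕ} {x : Ω → Fin d → ℝ} {γ : ℝ} (h : IsSubGaussianVec P x γ)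
    (v : Fin d → ℝ) :
    HasSubgaussianMGF (fun ω => x ω ⬝ᵥ v) (γ ^ 2 * (v ⬝ᵥ v)).toNNReal P := by
  rcases eq_or_ne v 0 with rfl | hv
  · simp
  have hpos := dotProduct_self_pos hv
  have hs := Real.sqrt_pos.2 hpos
  have hss := Real.mul_self_sqrt hpos.le
  have h1 := hasSubgaussianMGF_const_mul (h ((√(v ⬝ᵥ v))⁻¹ • v) (by
    rw [smul_dotProduct, dotProduct_smul, smul_eq_mul, smul_eq_mul]
    nth_rewrite 3 [← hss]
    field_simp)).2 (√(v ⬝ᵥ v))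
  convert h1 using 1
  · funext ω
    rw [dotProduct_smul, smul_eq_mul, mul_inv_cancel_left₀ hs.ne']
  · rw [Real.sq_sqrt hpos.le, mul_comm]

/-- Symmetry of R gives x·v = x'·(Rv), and ‖Rv‖² = vᵀSv; S may be singular. -/
theorem IsWhitenedSubGaussian.hasSubgaussianMGF {Ω : Type*} [MeasurableSpace Ω] {P : Measure Ω}
    [IsProbabilityMeasure P] {d : ℕ} {x : Ω → Fin d → ℝ} {S : Matrix (Fin d) (Fin d) ℝ} {γ : ℝ}
    (h : IsWhitenedSubGaussian P x S γ) (v : Fin d → ℝ) :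
    HasSubgaussianMGF (fun ω => x ω ⬝ᵥ v) (γ ^ 2 * (v ⬝ᵥ (S *ᵥ v))).toNNReal P := by
  obtain ⟨R, x', hR, -, hx, hsub, -⟩ := h
  rw [hR.dotProduct_mulVec]
  refine (hsub.hasSubgaussianMGF (R *ᵥ v)).congr ?_
  filter_upwards [hx] with ω hω
  rw [hω, ← transpose_mulVec_dotProduct, hR.transpose_eq]

theorem dotProduct_mulVec_le_opNorm {d : ℕ} (S : Matrix (Fin d) (Fin d) ℝ) (v : Fin d → ℝ) :
    v ⬝ᵥ (S *ᵥ v) ≤ opNorm S * (v ⬝ᵥ v) := by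
  set x : EuclideanSpace ℝ (Fin d) := WithLp.toLp 2 v with hx
  set f := Matrix.toEuclideanCLM (n := Fin d) (𝕜 := ℝ) S with hf
  have h1 : v ⬝ᵥ (S *ᵥ v) = inner ℝ x (f x) := by
    rw [PiLp.inner_apply]
    exact Finset.sum_congr rfl fun i _ => mul_comm _ _
  have h2 : v ⬝ᵥ v = ‖x‖ ^ 2 := (norm_sq_eq_dotProduct x).symm
  rw [h1, h2]
  calc inner ℝ x (f x) ≤ ‖x‖ * ‖f x‖ := real_inner_le_norm _ _
    _ ≤ ‖x‖ * (‖f‖ * ‖x‖) := mul_le_mul_of_nonneg_left (f.le_opNorm x) (norm_nonneg _)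
    _ = _ := by rw [opNorm]; ring

theorem opNorm_nonneg {d : ℕ} (S : Matrix (Fin d) (Fin d) ℝ) : 0 ≤ opNorm S := norm_nonneg _

theorem eq_zero_of_opNorm_eq_zero {d : ℕ} {S : Matrix (Fin d) (Fin d) ℝ} (h : opNorm S = 0) :
    S = 0 := by
  have h1 : Matrix.toEuclideanCLM (n := Fin d) (𝕜 := ℝ) S = 0 := norm_eq_zero.1 h
  exact (map_eq_zero_iff _ (Matrix.toEuclideanCLM (n := Fin d) (𝕜 := ℝ)).injective).1 h1

/-! ### The operator norm of the noise matrix -/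

theorem exp_neg_le_inv {x : ℝ} (hx : 0 < x) : Real.exp (-x) ≤ 1 / x := by
  rw [Real.exp_neg, ← one_div]
  exact one_div_le_one_div_of_le hx (by linarith [Real.add_one_le_exp x])

/-- For unit t in ℝⁿ the vector Wᵀt is sub-Gaussian with proxy γ²S, and its squared norm is
controlled by the norm and trace of S. Working with Wᵀ puts the net in ℝⁿ, so p never enters a union
bound. -/
theorem measure_op_noise_le {Ω : Type*} [MeasurableSpace Ω] {P : Measure Ω}
    [IsProbabilityMeasure P] {n p : ℕ} (hn : 1 ≤ n) {Ws : Fin n → Ω → Fin p → ℝ}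
    (hmeas : ∀ i, AEMeasurable (Ws i) P) (hind : iIndepFun Ws P) {γ : ℝ} (hγ : 0 < γ)
    {S : Matrix (Fin p) (Fin p) ℝ} (hS : S.PosSemidef)
    (hsub : ∀ i v, HasSubgaussianMGF (fun ω => Ws i ω ⬝ᵥ v) (γ ^ 2 * (v ⬝ᵥ (S *ᵥ v))).toNNReal P) :
    P {ω | ¬ ∀ u, ((Matrix.of fun i => Ws i ω)ᵀ *ᵥ u) ⬝ᵥ ((Matrix.of fun i => Ws i ω)ᵀ *ᵥ u)
      ≤ n * (48 * γ ^ 2 * (opNorm S + S.trace / n)) * (u ⬝ᵥ u)} ≤ ENNReal.ofReal (1 / n) := by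
  have hn' : (0 : ℝ) < n := by exact_mod_cast hn
  have htr : 0 ≤ S.trace := hS.trace_nonneg
  -- The Chernoff bound needs a positive b; if S = 0 the noise vanishes almost surely.
  rcases (opNorm_nonneg S).eq_or_lt with h0 | h0
  · have hS0 := eq_zero_of_opNorm_eq_zero h0.symm
    have hz : ∀ᵐ ω ∂P, ∀ i j, Ws i ω j = 0 := by
      refine ae_all_iff.2 fun i => ae_all_iff.2 fun j => ?_
      have h1 := hsub i (Pi.single j 1)
      rw [hS0] at h1
      simp only [zero_mulVec, dotProduct_zero, mul_zero, Real.toNNReal_zero] at h1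
      filter_upwards [h1.ae_eq_zero_of_hasSubgaussianMGF_zero] with ω hω
      simpa using hω
    refine le_trans (le_of_eq ?_) zero_le
    rw [← ae_iff]
    filter_upwards [hz] with ω hω u
    have : (Matrix.of fun i => Ws i ω) = 0 := by ext i j; exact hω i j
    rw [this]
    have h2 := dotProduct_self_nonneg u
    simp only [transpose_zero, zero_mulVec, zero_dotProduct]
    rw [← h0]
    positivity
  set b := γ ^ 2 * opNorm S with hb
  have hb0 : 0 < b := by positivity
  obtain ⟨T, hTc, hT⟩ := exists_isSphereNet n (ε := 1 / 2) (by norm_num) (by norm_num)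
  -- r = 3n outweighs the net, of size at most 6ⁿ ≤ exp(2n). The net costs a factor 4, and 4 · 4 · 3
  -- = 48 is the constant in the statement.
  set B := 4 * b * (3 * n) + 2 * (γ ^ 2 • S).trace with hB
  have htr' : (γ ^ 2 • S).trace = γ ^ 2 * S.trace := by rw [trace_smul, smul_eq_mul]
  have hB0 : 0 ≤ B := by rw [hB, htr']; positivity
  have htail : ∀ t ∈ T, P {ω | B < ((Matrix.of fun i => Ws i ω)ᵀ *ᵥ t) ⬝ᵥ
      ((Matrix.of fun i => Ws i ω)ᵀ *ᵥ t)} ≤ ENNReal.ofReal (Real.exp (-(3 * n))) := by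
    intro t ht
    have hxeq : ∀ ω, (Matrix.of fun i => Ws i ω)ᵀ *ᵥ t = ∑ i, t i • Ws i ω := by
      intro ω
      ext j
      simp [mulVec, dotProduct, mul_comm]
    refine measure_sq_gt_le (x := fun ω => (Matrix.of fun i => Ws i ω)ᵀ *ᵥ t) ?_
      (hS.smul (sq_nonneg γ)) (b := b) ?_ hb0 ?_ _
    · simp_rw [hxeq]
      exact Finset.aemeasurable_fun_sum _ fun i _ => (hmeas i).fun_const_smul _
    · intro u
      rw [smul_mulVec, dotProduct_smul, smul_eq_mul, hb, mul_assoc]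
      exact mul_le_mul_of_nonneg_left (dotProduct_mulVec_le_opNorm S u) (sq_nonneg γ)
    · intro u
      have hnn : 0 ≤ γ ^ 2 * (u ⬝ᵥ (S *ᵥ u)) :=
        mul_nonneg (sq_nonneg γ) (PosSemidef.dotProduct_mulVec_self_nonneg hS u)
      have h1 := hasSubgaussianMGF_sum_mul (y := fun i ω => Ws i ω ⬝ᵥ u) hnn
        (hind.comp (fun _ w => w ⬝ᵥ u) fun _ => by simp only [dotProduct]; fun_prop)
        (fun i => hsub i u) t
      have h2 := lintegral_exp_le_of_hasSubgaussianMGF h1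
      rw [hT.1 t ht, mul_one, Real.coe_toNNReal _ hnn] at h2
      refine le_trans (le_of_eq ?_) (h2.trans (le_of_eq ?_))
      · refine lintegral_congr fun ω => ?_
        rw [hxeq, dotProduct_sum]
        simp only [dotProduct_comm u, smul_dotProduct, smul_eq_mul]
      · rw [smul_mulVec, dotProduct_smul, smul_eq_mul]
  have hsubset : {ω | ¬ ∀ u, ((Matrix.of fun i => Ws i ω)ᵀ *ᵥ u) ⬝ᵥ
      ((Matrix.of fun i => Ws i ω)ᵀ *ᵥ u)
      ≤ n * (48 * γ ^ 2 * (opNorm S + S.trace / n)) * (u ⬝ᵥ u)} ⊆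
      ⋃ t ∈ T, {ω | B < ((Matrix.of fun i => Ws i ω)ᵀ *ᵥ t) ⬝ᵥ
        ((Matrix.of fun i => Ws i ω)ᵀ *ᵥ t)} := by
    intro ω hω
    by_contra hcon
    simp only [Set.mem_iUnion, Set.mem_ofPred_eq, not_exists, not_lt] at hcon
    refine hω fun u => ?_
    refine (sq_mulVec_le_of_net (by norm_num) le_rfl hT _ hB0 hcon u).trans ?_
    refine mul_le_mul_of_nonneg_right ?_ (dotProduct_self_nonneg u)
    rw [hB, htr', hb]
    have : (n : ℝ) * (48 * γ ^ 2 * (opNorm S + S.trace / n))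
        = 48 * n * γ ^ 2 * opNorm S + 48 * γ ^ 2 * S.trace := by field_simp
    rw [this]
    have : 0 ≤ γ ^ 2 * S.trace := by positivity
    linarith
  calc _ ≤ P (⋃ t ∈ T, {ω | B < ((Matrix.of fun i => Ws i ω)ᵀ *ᵥ t) ⬝ᵥ
        ((Matrix.of fun i => Ws i ω)ᵀ *ᵥ t)}) := measure_mono hsubset
    _ ≤ ∑ t ∈ T, P {ω | B < ((Matrix.of fun i => Ws i ω)ᵀ *ᵥ t) ⬝ᵥ
        ((Matrix.of fun i => Ws i ω)ᵀ *ᵥ t)} := measure_biUnion_finset_le _ _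
    _ ≤ ∑ t ∈ T, ENNReal.ofReal (Real.exp (-(3 * n))) := Finset.sum_le_sum htail
    _ = ENNReal.ofReal (T.card * Real.exp (-(3 * n))) := by
        rw [Finset.sum_const, nsmul_eq_mul, ENNReal.ofReal_mul (by positivity),
          ENNReal.ofReal_natCast]
    _ ≤ ENNReal.ofReal (1 / n) := by
        apply ENNReal.ofReal_le_ofReal
        have h6 : (6 : ℝ) ≤ Real.exp 2 := by
          have h1 := Real.exp_one_gt_d9
          have h2 : Real.exp 2 = Real.exp 1 * Real.exp 1 := by rw [← Real.exp_add]; norm_num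
          rw [h2]
          nlinarith
        have h7 : (T.card : ℝ) ≤ Real.exp (2 * n) := by
          refine hTc.trans ?_
          rw [mul_comm, Real.exp_nat_mul]
          refine pow_le_pow_left₀ (by norm_num) ?_ n
          norm_num
          exact h6
        calc (T.card : ℝ) * Real.exp (-(3 * n)) ≤ Real.exp (2 * n) * Real.exp (-(3 * n)) :=
              mul_le_mul_of_nonneg_right h7 (Real.exp_pos _).le
          _ = Real.exp (-n) := by rw [← Real.exp_add]; congr 1; ring
          _ ≤ 1 / n := exp_neg_le_inv hn'

/-! ### The smallest singular value of an isotropic sub-Gaussian sample -/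

/-- Because (1 − x + x²/2)(1 + x + x²/2) = 1 + x⁴/4 ≥ 1, the lower bound for exp(x) inverts to this
upper bound. -/
theorem exp_neg_le_quadratic {x : ℝ} (hx : 0 ≤ x) : Real.exp (-x) ≤ 1 - x + x ^ 2 / 2 := by
  have h1 := Real.quadratic_le_exp_of_nonneg hx
  rw [Real.exp_neg, inv_le_iff_one_le_mul₀ (Real.exp_pos _)]
  have h2 : 0 ≤ 1 - x + x ^ 2 / 2 := by nlinarith [sq_nonneg (x - 1)]
  calc (1 : ℝ) ≤ (1 - x + x ^ 2 / 2) * (1 + x + x ^ 2 / 2) := by nlinarith [sq_nonneg (x ^ 2)]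
    _ ≤ _ := mul_le_mul_of_nonneg_left h1 h2

theorem lintegral_exp_sq_le_of_hasSubgaussianMGF {Ω : Type*} [MeasurableSpace Ω] {P : Measure Ω}
    [IsProbabilityMeasure P] {y : Ω → ℝ} {a : ℝ} (ha : 0 < a)
    (h : HasSubgaussianMGF y a.toNNReal P) :
    ∫⁻ ω, ENNReal.ofReal (Real.exp (1 / (4 * a) * y ω ^ 2)) ∂P
      ≤ ENNReal.ofReal (Real.exp (1 / 2)) := by
  have h1 := lintegral_exp_sq_le_of_diagonal (P := P) (x := fun ω (_ : Unit) => y ω)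
    (aemeasurable_pi_lambda _ fun _ => h.aemeasurable) (l := fun _ => a) (fun _ => ha.le)
    (fun u => by
      have h2 := lintegral_exp_le_of_hasSubgaussianMGF (hasSubgaussianMGF_const_mul h (u ()))
      rw [Real.coe_toNNReal _ (by positivity)] at h2
      simpa [dotProduct, mul_comm] using h2)
    (s := 1 / (4 * a)) (by positivity) (fun _ => by field_simp; norm_num)
  have h3 : 2 * (1 / (4 * a)) * a = 1 / 2 := by field_simp; norm_num
  simp only [dotProduct, Finset.univ_unique, Finset.sum_singleton, ← pow_two, h3] at h1
  exact h1

/-- With x = y²/(4a), the bound x²/2 ≤ exp(x) reads y⁴ ≤ 32a² exp(y²/(4a)); the exponential moment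
is at most √e ≤ 2. -/
theorem integral_pow_four_le {Ω : Type*} [MeasurableSpace Ω] {P : Measure Ω}
    [IsProbabilityMeasure P] {y : Ω → ℝ} {a : ℝ} (ha : 0 < a)
    (h : HasSubgaussianMGF y a.toNNReal P) :
    Integrable (fun ω => y ω ^ 4) P ∧ ∫ ω, y ω ^ 4 ∂P ≤ 64 * a ^ 2 := by
  have hint : Integrable (fun ω => y ω ^ 4) P := by
    have := (h.memLp 4).integrable_norm_pow (by norm_num : (4 : ℕ) ≠ 0)
    simpa [Real.norm_eq_abs, Even.pow_abs (by decide : Even 4)] using this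
  refine ⟨hint, ?_⟩
  rw [integral_eq_lintegral_of_nonneg_ae (ae_of_all _ fun ω => by positivity)
    hint.aestronglyMeasurable]
  refine ENNReal.toReal_le_of_le_ofReal (by positivity) ?_
  have hpt : ∀ ω, ENNReal.ofReal (y ω ^ 4)
      ≤ ENNReal.ofReal (32 * a ^ 2) * ENNReal.ofReal (Real.exp (1 / (4 * a) * y ω ^ 2)) := by
    intro ω
    rw [← ENNReal.ofReal_mul (by positivity)]
    apply ENNReal.ofReal_le_ofReal
    have h1 := Real.quadratic_le_exp_of_nonneg (x := 1 / (4 * a) * y ω ^ 2) (by positivity)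
    have h2 : 0 ≤ 1 / (4 * a) * y ω ^ 2 := by positivity
    calc y ω ^ 4 = 32 * a ^ 2 * ((1 / (4 * a) * y ω ^ 2) ^ 2 / 2) := by field_simp; ring
      _ ≤ _ := mul_le_mul_of_nonneg_left (by linarith) (by positivity)
  calc ∫⁻ ω, ENNReal.ofReal (y ω ^ 4) ∂P
      ≤ ∫⁻ ω, ENNReal.ofReal (32 * a ^ 2) *
          ENNReal.ofReal (Real.exp (1 / (4 * a) * y ω ^ 2)) ∂P := lintegral_mono hpt
    _ = ENNReal.ofReal (32 * a ^ 2) *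
          ∫⁻ ω, ENNReal.ofReal (Real.exp (1 / (4 * a) * y ω ^ 2)) ∂P :=
        lintegral_const_mul' _ _ ENNReal.ofReal_ne_top
    _ ≤ ENNReal.ofReal (32 * a ^ 2) * ENNReal.ofReal (Real.exp (1 / 2)) :=
        mul_le_mul_right (lintegral_exp_sq_le_of_hasSubgaussianMGF ha h) _
    _ ≤ ENNReal.ofReal (64 * a ^ 2) := by
        rw [← ENNReal.ofReal_mul (by positivity)]
        apply ENNReal.ofReal_le_ofReal
        have h3 : Real.exp (1 / 2) ≤ 2 := by
          have h4 : Real.exp (1 / 2) ^ 2 = Real.exp 1 := by rw [← Real.exp_nat_mul]; norm_num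
          have := Real.exp_one_lt_d9
          nlinarith [Real.exp_pos (1 / 2)]
        nlinarith [sq_nonneg a]

/-- For lower deviations the exponent is negative, so a second-order expansion suffices and only the
fourth moment enters. -/
theorem mgf_sq_le {Ω : Type*} [MeasurableSpace Ω] {P : Measure Ω}
    [IsProbabilityMeasure P] {y : Ω → ℝ} {a s : ℝ} (ha : 0 < a) (hs : 0 ≤ s)
    (h : HasSubgaussianMGF y a.toNNReal P) (h1 : ∫ ω, y ω ^ 2 ∂P = 1) :
    mgf (fun ω => y ω ^ 2) P (-s) ≤ Real.exp (-s + 32 * s ^ 2 * a ^ 2) := by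
  obtain ⟨hi4, h4⟩ := integral_pow_four_le ha h
  have hi2 : Integrable (fun ω => y ω ^ 2) P := (h.memLp 2).integrable_sq
  have hpt : ∀ ω, Real.exp (-s * y ω ^ 2) ≤ 1 - s * y ω ^ 2 + s ^ 2 / 2 * y ω ^ 4 := by
    intro ω
    have := exp_neg_le_quadratic (x := s * y ω ^ 2) (by positivity)
    rw [neg_mul]
    refine this.trans (le_of_eq ?_)
    ring
  have hint : Integrable (fun ω => 1 - s * y ω ^ 2 + s ^ 2 / 2 * y ω ^ 4) P :=
    ((integrable_const _).sub (hi2.const_mul _)).add (hi4.const_mul _)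
  calc mgf (fun ω => y ω ^ 2) P (-s) ≤ ∫ ω, (1 - s * y ω ^ 2 + s ^ 2 / 2 * y ω ^ 4) ∂P :=
        integral_mono_of_nonneg (ae_of_all _ fun ω => (Real.exp_pos _).le) hint (ae_of_all _ hpt)
    _ = 1 - s * 1 + s ^ 2 / 2 * ∫ ω, y ω ^ 4 ∂P := by
        have e1 : ∫ ω, (1 - s * y ω ^ 2 + s ^ 2 / 2 * y ω ^ 4) ∂P
            = ∫ ω, (1 - s * y ω ^ 2) ∂P + ∫ ω, s ^ 2 / 2 * y ω ^ 4 ∂P :=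
          integral_add ((integrable_const _).sub (hi2.const_mul _)) (hi4.const_mul _)
        have e2 : ∫ ω, (1 - s * y ω ^ 2) ∂P = ∫ _, (1 : ℝ) ∂P - ∫ ω, s * y ω ^ 2 ∂P :=
          integral_sub (integrable_const _) (hi2.const_mul _)
        rw [e1, e2, integral_const_mul, integral_const_mul, h1]
        simp
    _ ≤ (-s + 32 * s ^ 2 * a ^ 2) + 1 := by nlinarith [sq_nonneg s]
    _ ≤ _ := Real.add_one_le_exp _

/-- Lower deviations of `∑ y_i²` for independent normalized sub-Gaussian variables. -/
theorem measure_sum_sq_lt_le {Ω : Type*} [MeasurableSpace Ω] {P : Measure Ω}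
    [IsProbabilityMeasure P] {n : ℕ} {y : Fin n → Ω → ℝ} {a : ℝ} (ha : 0 < a)
    (hind : iIndepFun y P) (h : ∀ i, HasSubgaussianMGF (y i) a.toNNReal P)
    (h1 : ∀ i, ∫ ω, y i ω ^ 2 ∂P = 1) :
    P {ω | ∑ i, y i ω ^ 2 < n / 2} ≤ ENNReal.ofReal (Real.exp (-(1 / (512 * a ^ 2) * n))) := by
  -- The minimizer of −s/2 + 32s²a², the Chernoff exponent per observation at level n/2; the minimum
  -- is −1/(512a²).
  set s : ℝ := 1 / (128 * a ^ 2) with hs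
  have hs0 : 0 ≤ s := by positivity
  have hm : ∀ i, AEMeasurable (fun ω => y i ω ^ 2) P := fun i => (h i).aemeasurable.pow_const 2
  have hind' : iIndepFun (fun i ω => y i ω ^ 2) P :=
    hind.comp (fun _ t => t ^ 2) fun _ => by fun_prop
  have hsum : (∑ i, fun ω => y i ω ^ 2) = fun ω => ∑ i, y i ω ^ 2 := by
    ext ω; simp
  have hmgf := hind'.mgf_sum₀ hm Finset.univ (t := -s)
  have hint : Integrable (fun ω => Real.exp (-s * ∑ i, y i ω ^ 2)) P := by
    refine Integrable.of_bound (C := 1) ?_ (ae_of_all _ fun ω => ?_)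
    · exact (Real.measurable_exp.comp_aemeasurable
        ((Finset.aemeasurable_fun_sum _ fun i _ => hm i).const_mul _)).aestronglyMeasurable
    · rw [Real.norm_eq_abs, Real.abs_exp, Real.exp_le_one_iff]
      have : 0 ≤ ∑ i, y i ω ^ 2 := Finset.sum_nonneg fun i _ => sq_nonneg _
      nlinarith
  have hch := measure_le_le_exp_mul_mgf (μ := P) (X := fun ω => ∑ i, y i ω ^ 2) (t := -s)
    ((n : ℝ) / 2) (by linarith) hint
  rw [hsum] at hmgf
  rw [hmgf] at hch
  have hprod : ∏ i, mgf (fun ω => y i ω ^ 2) P (-s) ≤ Real.exp (-s + 32 * s ^ 2 * a ^ 2) ^ n := by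
    refine (Finset.prod_le_prod (fun i _ => mgf_nonneg)
      fun i _ => mgf_sq_le ha hs0 (h i) (h1 i)).trans (le_of_eq ?_)
    simp
  calc P {ω | ∑ i, y i ω ^ 2 < n / 2} ≤ P {ω | ∑ i, y i ω ^ 2 ≤ n / 2} :=
        measure_mono fun ω hω => by
          simp only [Set.mem_ofPred_eq] at hω ⊢
          exact hω.le
    _ = ENNReal.ofReal (P.real {ω | ∑ i, y i ω ^ 2 ≤ n / 2}) := by
        rw [ofReal_measureReal]
    _ ≤ _ := by
        apply ENNReal.ofReal_le_ofReal
        refine hch.trans ((mul_le_mul_of_nonneg_left hprod (Real.exp_pos _).le).trans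
          (le_of_eq ?_))
        rw [← Real.exp_nat_mul, ← Real.exp_add]
        congr 1
        rw [hs]
        field_simp
        ring

/-- Upper deviations of `∑ y_i²` for independent sub-Gaussian variables. -/
theorem measure_sum_sq_gt_le {Ω : Type*} [MeasurableSpace Ω] {P : Measure Ω}
    [IsProbabilityMeasure P] {n : ℕ} {y : Fin n → Ω → ℝ} {a : ℝ} (ha : 0 < a)
    (hind : iIndepFun y P) (h : ∀ i, HasSubgaussianMGF (y i) a.toNNReal P) :
    P {ω | 6 * a * n < ∑ i, y i ω ^ 2} ≤ ENNReal.ofReal (Real.exp (-n)) := by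
  have h1 := measure_sq_gt_le (P := P) (x := fun ω i => y i ω)
    (aemeasurable_pi_lambda _ fun i => (h i).aemeasurable) (S := a • 1)
    (PosSemidef.one.smul ha.le) (b := a) (fun u => by
      rw [smul_mulVec, one_mulVec, dotProduct_smul, smul_eq_mul]) ha
    (fun u => by
      have h2 := lintegral_exp_le_of_hasSubgaussianMGF (hasSubgaussianMGF_sum_mul ha.le hind h u)
      rw [Real.coe_toNNReal _ (mul_nonneg ha.le (dotProduct_self_nonneg u))] at h2
      rw [smul_mulVec, one_mulVec, dotProduct_smul, smul_eq_mul]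
      exact h2) n
  refine le_trans (le_of_eq ?_) h1
  congr 1
  ext ω
  simp only [Set.mem_ofPred_eq, dotProduct_self_eq_sum, trace_smul, trace_one, Fintype.card_fin,
    smul_eq_mul]
  ring_nf

/-- With a constant depending only on the sub-Gaussian parameter, the smallest singular value of
a sample of `n` independent isotropic sub-Gaussian vectors of dimension `K ≤ C n / log n` is of
order `√n`. -/
theorem exists_measure_smallest_singular_le {γ : ℝ} (hγ : 0 < γ) : ∃ C : ℝ, 0 < C ∧
    ∀ (n K : ℕ), 3 ≤ n → (K : ℝ) * Real.log n ≤ C * n →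
    ∀ (Ω : Type*) [MeasurableSpace Ω] (P : Measure Ω) [IsProbabilityMeasure P]
      (G : Fin n → Ω → Fin K → ℝ), iIndepFun G P →
      (∀ i v, v ⬝ᵥ v = 1 → HasSubgaussianMGF (fun ω => G i ω ⬝ᵥ v) (γ ^ 2).toNNReal P) →
      (∀ i v, v ⬝ᵥ v = 1 → ∫ ω, (G i ω ⬝ᵥ v) ^ 2 ∂P = 1) →
      P {ω | ¬ ∀ v, (n : ℝ) / 8 * (v ⬝ᵥ v) ≤
        ((Matrix.of fun i => G i ω) *ᵥ v) ⬝ᵥ ((Matrix.of fun i => G i ω) *ᵥ v)}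
      ≤ ENNReal.ofReal (2 / n) := by
  have ha : 0 < γ ^ 2 := by positivity
  set a := γ ^ 2 with hadef
  -- The mesh must be at most 1/2 for the upper bound from the net, and small against 1/γ so that
  -- 16ε² · 6a ≤ 1/2 for the lower one; 96/14² is just below 1/2.
  set ε : ℝ := min (1 / 2) (1 / (14 * γ)) with hε
  have hε0 : 0 < ε := by positivity
  have hε2 : ε ≤ 1 / 2 := min_le_left _ _
  have hε3 : 16 * ε ^ 2 * (6 * a) ≤ 1 / 2 := by
    have h1 : ε ≤ 1 / (14 * γ) := min_le_right _ _
    have h2 : ε ^ 2 ≤ (1 / (14 * γ)) ^ 2 := pow_le_pow_left₀ hε0.le h1 2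
    have h3 : 16 * (1 / (14 * γ)) ^ 2 * (6 * a) ≤ 1 / 2 := by
      rw [hadef]; field_simp; norm_num
    nlinarith
  set q := Real.log (3 / ε) with hq
  have hq0 : 0 < q := Real.log_pos (by rw [lt_div_iff₀ hε0]; linarith)
  set c : ℝ := min 1 (1 / (512 * a ^ 2)) with hc
  have hc0 : 0 < c := by positivity
  -- The tail exponent cn is split in halves: one pays for the net entropy qK, the other for log n,
  -- which leaves 2/n.
  refine ⟨min (c / (2 * q)) (c / 2), by positivity, ?_⟩
  intro n K hn hK Ω _ P _ G hind hsub hvar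
  have hn' : (3 : ℝ) ≤ n := by exact_mod_cast hn
  have hn0 : (0 : ℝ) < n := by linarith
  -- For K = 0 the assumption on K log n does not control log n, but there is nothing to prove.
  rcases Nat.eq_zero_or_pos K with rfl | hKpos
  · refine le_trans (le_of_eq ?_) zero_le
    rw [← ae_iff]
    refine ae_of_all _ fun ω v => ?_
    have : v ⬝ᵥ v = 0 := by simp [dotProduct]
    rw [this, mul_zero]
    exact dotProduct_self_nonneg _
  have hlog : 1 ≤ Real.log n := by
    rw [Real.le_log_iff_exp_le hn0]
    linarith [Real.exp_one_lt_d9]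
  have hK1 : (1 : ℝ) ≤ K := by exact_mod_cast hKpos
  have hKn : q * K ≤ c / 2 * n := by
    have h1 : (K : ℝ) ≤ c / (2 * q) * n := by
      refine le_trans ?_ (hK.trans (mul_le_mul_of_nonneg_right (min_le_left _ _) hn0.le))
      nlinarith
    calc q * K ≤ q * (c / (2 * q) * n) := mul_le_mul_of_nonneg_left h1 hq0.le
      _ = _ := by field_simp
  have hlogn : Real.log n ≤ c / 2 * n := by
    refine le_trans ?_ (hK.trans (mul_le_mul_of_nonneg_right (min_le_right _ _) hn0.le))
    nlinarith
  obtain ⟨T, hTc, hT⟩ := exists_isSphereNet K hε0 (hε2.trans (by norm_num))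
  have hsq : ∀ ω v, ((Matrix.of fun i => G i ω) *ᵥ v) ⬝ᵥ ((Matrix.of fun i => G i ω) *ᵥ v)
      = ∑ i, (G i ω ⬝ᵥ v) ^ 2 := fun ω v => dotProduct_self_eq_sum _
  have hindv : ∀ v : Fin K → ℝ, iIndepFun (fun i ω => G i ω ⬝ᵥ v) P := fun v =>
    hind.comp (fun _ w => w ⬝ᵥ v) fun _ => by simp only [dotProduct]; fun_prop
  have hsubset : {ω | ¬ ∀ v, (n : ℝ) / 8 * (v ⬝ᵥ v) ≤
      ((Matrix.of fun i => G i ω) *ᵥ v) ⬝ᵥ ((Matrix.of fun i => G i ω) *ᵥ v)} ⊆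
      ⋃ t ∈ T, ({ω | 6 * a * n < ∑ i, (G i ω ⬝ᵥ t) ^ 2} ∪
        {ω | ∑ i, (G i ω ⬝ᵥ t) ^ 2 < n / 2}) := by
    intro ω hω
    by_contra hcon
    simp only [Set.mem_iUnion, Set.mem_union, Set.mem_ofPred_eq, not_exists, not_or, not_lt] at hcon
    refine hω fun v => ?_
    have hup := sq_mulVec_le_of_net hε0.le hε2 hT (Matrix.of fun i => G i ω) (B := 6 * a * n)
      (by positivity) fun t ht => by rw [hsq]; exact (hcon t ht).1
    have := le_sq_mulVec_of_net hT (Matrix.of fun i => G i ω) (b := n / 2) (B := 6 * a * n)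
      (by positivity) (by nlinarith) hup (fun t ht => by rw [hsq]; exact (hcon t ht).2) v
    refine le_trans (le_of_eq ?_) this
    ring
  have hexp : Real.exp (-(n : ℝ)) ≤ Real.exp (-(c * n)) := by
    refine Real.exp_le_exp.2 (neg_le_neg ?_)
    exact mul_le_of_le_one_left hn0.le (min_le_left _ _)
  have hexp' : Real.exp (-(1 / (512 * a ^ 2) * n)) ≤ Real.exp (-(c * n)) := by
    refine Real.exp_le_exp.2 (neg_le_neg ?_)
    exact mul_le_mul_of_nonneg_right (min_le_right _ _) hn0.le
  have htail : ∀ t ∈ T, P ({ω | 6 * a * n < ∑ i, (G i ω ⬝ᵥ t) ^ 2} ∪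
        {ω | ∑ i, (G i ω ⬝ᵥ t) ^ 2 < n / 2}) ≤ ENNReal.ofReal (2 * Real.exp (-(c * n))) := by
    intro t ht
    have h1 := measure_sum_sq_gt_le ha (hindv t) fun i => hsub i t (hT.1 t ht)
    have h2 := measure_sum_sq_lt_le ha (hindv t) (fun i => hsub i t (hT.1 t ht))
      fun i => hvar i t (hT.1 t ht)
    refine (measure_union_le _ _).trans ?_
    rw [two_mul, ENNReal.ofReal_add (Real.exp_pos _).le (Real.exp_pos _).le]
    exact add_le_add (h1.trans (ENNReal.ofReal_le_ofReal hexp))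
      (h2.trans (ENNReal.ofReal_le_ofReal hexp'))
  calc _ ≤ P (⋃ t ∈ T, ({ω | 6 * a * n < ∑ i, (G i ω ⬝ᵥ t) ^ 2} ∪
        {ω | ∑ i, (G i ω ⬝ᵥ t) ^ 2 < n / 2})) := measure_mono hsubset
    _ ≤ ∑ t ∈ T, P ({ω | 6 * a * n < ∑ i, (G i ω ⬝ᵥ t) ^ 2} ∪
        {ω | ∑ i, (G i ω ⬝ᵥ t) ^ 2 < n / 2}) := measure_biUnion_finset_le _ _
    _ ≤ ∑ t ∈ T, ENNReal.ofReal (2 * Real.exp (-(c * n))) := Finset.sum_le_sum htail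
    _ = ENNReal.ofReal (T.card * (2 * Real.exp (-(c * n)))) := by
        rw [Finset.sum_const, nsmul_eq_mul, ENNReal.ofReal_mul (p := T.card) (by positivity),
          ENNReal.ofReal_natCast]
    _ ≤ ENNReal.ofReal (2 / n) := by
        apply ENNReal.ofReal_le_ofReal
        have h7 : (T.card : ℝ) ≤ Real.exp (q * K) := by
          refine hTc.trans (le_of_eq ?_)
          rw [mul_comm, Real.exp_nat_mul, hq, Real.exp_log (by positivity)]
        calc (T.card : ℝ) * (2 * Real.exp (-(c * n)))
            ≤ Real.exp (q * K) * (2 * Real.exp (-(c * n))) :=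
              mul_le_mul_of_nonneg_right h7 (by positivity)
          _ = 2 * Real.exp (q * K - c * n) := by
              rw [sub_eq_add_neg, Real.exp_add]; ring
          _ ≤ 2 * Real.exp (-Real.log n) := by
              refine mul_le_mul_of_nonneg_left (Real.exp_le_exp.2 ?_) (by norm_num)
              linarith
          _ = 2 / n := by rw [Real.exp_neg, Real.exp_log hn0]; rfl

/-! ### Quadratic forms of the regression noise -/

theorem dotProduct_sq_le {m : Type*} [Fintype m] (u v : m → ℝ) :
    (u ⬝ᵥ v) ^ 2 ≤ (u ⬝ᵥ u) * (v ⬝ᵥ v) := by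
  rw [dotProduct_self_eq_sum, dotProduct_self_eq_sum]
  exact Finset.sum_mul_sq_le_sq_mul_sq _ _ _

/-- For y = Mᵀu, Cauchy–Schwarz gives ‖y‖² = u·My ≤ ‖u‖ √B ‖y‖; divide by ‖y‖. -/
theorem sq_transpose_mulVec_le_of_sq_mulVec_le {m n : Type*} [Fintype m] [Fintype n]
    {M : Matrix m n ℝ} {B : ℝ} (hB : 0 ≤ B) (h : ∀ v, (M *ᵥ v) ⬝ᵥ (M *ᵥ v) ≤ B * (v ⬝ᵥ v))
    (u : m → ℝ) : (Mᵀ *ᵥ u) ⬝ᵥ (Mᵀ *ᵥ u) ≤ B * (u ⬝ᵥ u) := by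
  set y := Mᵀ *ᵥ u with hy
  have h1 : y ⬝ᵥ y = u ⬝ᵥ (M *ᵥ y) := transpose_mulVec_dotProduct M u y
  have h2 := dotProduct_sq_le u (M *ᵥ y)
  rw [← h1] at h2
  have h3 : (y ⬝ᵥ y) ^ 2 ≤ (u ⬝ᵥ u) * (B * (y ⬝ᵥ y)) :=
    h2.trans (mul_le_mul_of_nonneg_left (h y) (dotProduct_self_nonneg u))
  rcases (dotProduct_self_nonneg y).eq_or_lt with h0 | h0
  · rw [← h0]
    exact mul_nonneg hB (dotProduct_self_nonneg u)
  · refine le_of_mul_le_mul_right ?_ h0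
    calc y ⬝ᵥ y * (y ⬝ᵥ y) = (y ⬝ᵥ y) ^ 2 := by ring
      _ ≤ _ := h3
      _ = _ := by ring

/-- The Chernoff bound for a quadratic form `eᵀ F e` of a sub-Gaussian vector, `0 ≤ F ≤ 1`. -/
theorem measure_quadratic_gt_le {n : ℕ} {ν : Measure (Fin n → ℝ)} [IsProbabilityMeasure ν] {a : ℝ}
    (ha : 0 < a) (hν : ∀ u : Fin n → ℝ, ∫⁻ e, ENNReal.ofReal (Real.exp (u ⬝ᵥ e)) ∂ν
      ≤ ENNReal.ofReal (Real.exp (a * (u ⬝ᵥ u) / 2)))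
    {F : Matrix (Fin n) (Fin n) ℝ} (hF : F.PosSemidef) (hF1 : ∀ u, u ⬝ᵥ (F *ᵥ u) ≤ u ⬝ᵥ u)
    {k : ℝ} (hk : F.trace ≤ k) (r : ℝ) :
    ν {e | 4 * a * r + 2 * a * k < e ⬝ᵥ (F *ᵥ e)} ≤ ENNReal.ofReal (Real.exp (-r)) := by
  -- Writing F = CᵀC turns the form into ‖Ce‖², where Ce has proxy aCCᵀ: norm at most a, and trace a
  -- tr F.
  obtain ⟨C, hC⟩ : ∃ C : Matrix (Fin n) (Fin n) ℝ, F = Cᵀ * C := by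
    obtain ⟨V, l, hV, hV', hFV⟩ := exists_spectral_decomposition hF.1
    have hl : ∀ j, 0 ≤ l j := fun j => by
      rw [eigenvalue_eq_dotProduct hV hFV]
      exact PosSemidef.dotProduct_mulVec_self_nonneg hF _
    refine ⟨diagonal (fun j => √(l j)) * Vᵀ, ?_⟩
    have h1 : diagonal (fun j => √(l j)) * diagonal (fun j => √(l j)) = diagonal l := by
      rw [diagonal_mul_diagonal]
      congr 1
      funext j
      exact Real.mul_self_sqrt (hl j)
    rw [transpose_mul, transpose_transpose, diagonal_transpose, Matrix.mul_assoc,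
      ← Matrix.mul_assoc (diagonal _), h1, hFV, Matrix.mul_assoc]
  have hsq : ∀ e, e ⬝ᵥ (F *ᵥ e) = (C *ᵥ e) ⬝ᵥ (C *ᵥ e) := fun e => by
    rw [mulVec_dotProduct_mulVec, hC]
  have hC1 : ∀ u, (Cᵀ *ᵥ u) ⬝ᵥ (Cᵀ *ᵥ u) ≤ 1 * (u ⬝ᵥ u) :=
    sq_transpose_mulVec_le_of_sq_mulVec_le zero_le_one fun v => by rw [← hsq, one_mul]; exact hF1 v
  have hCC : ∀ u, u ⬝ᵥ ((a • (C * Cᵀ)) *ᵥ u) = a * ((Cᵀ *ᵥ u) ⬝ᵥ (Cᵀ *ᵥ u)) := fun u => by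
    rw [smul_mulVec, dotProduct_smul, smul_eq_mul, mulVec_dotProduct_mulVec, transpose_transpose]
  have htr : (a • (C * Cᵀ)).trace = a * F.trace := by
    rw [trace_smul, smul_eq_mul, trace_mul_comm, hC]
  have hS : (C * Cᵀ).PosSemidef := by
    simpa [conjTranspose_eq_transpose_of_trivial] using posSemidef_self_mul_conjTranspose C
  have h1 := measure_sq_gt_le (P := ν) (x := fun e => C *ᵥ e)
    (Continuous.matrix_mulVec continuous_const continuous_id).measurable.aemeasurable
    (hS.smul ha.le) (b := a) (fun u => by
      rw [hCC]
      exact mul_le_mul_of_nonneg_left ((hC1 u).trans_eq (one_mul _)) ha.le) ha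
    (fun u => by
      rw [hCC]
      refine le_trans (le_of_eq ?_) (hν (Cᵀ *ᵥ u))
      simp_rw [transpose_mulVec_dotProduct]) r
  refine (measure_mono fun e he => ?_).trans h1
  simp only [Set.mem_ofPred_eq] at he ⊢
  rw [← hsq, htr]
  have := mul_le_mul_of_nonneg_left hk ha.le
  linarith

/-- Conditionally on the first coordinate the matrix is deterministic. Keeping the trace condition
inside the event makes the conditional bound uniform: slices that violate it are empty. -/
theorem measure_prod_quadratic_gt_le {α : Type*} [MeasurableSpace α] {μ : Measure α}
    [IsProbabilityMeasure μ] {n : ℕ} {ν : Measure (Fin n → ℝ)} [IsProbabilityMeasure ν] {a : ℝ}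
    (ha : 0 < a) (hν : ∀ u : Fin n → ℝ, ∫⁻ e, ENNReal.ofReal (Real.exp (u ⬝ᵥ e)) ∂ν
      ≤ ENNReal.ofReal (Real.exp (a * (u ⬝ᵥ u) / 2)))
    {F : α → Matrix (Fin n) (Fin n) ℝ} (hFm : ∀ i j, Measurable fun x => F x i j)
    (hF : ∀ x, (F x).PosSemidef) (hF1 : ∀ x u, u ⬝ᵥ (F x *ᵥ u) ≤ u ⬝ᵥ u) (k r : ℝ) :
    MeasurableSet {q : α × (Fin n → ℝ) | (F q.1).trace ≤ k ∧
      4 * a * r + 2 * a * k < q.2 ⬝ᵥ (F q.1 *ᵥ q.2)} ∧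
    (μ.prod ν) {q : α × (Fin n → ℝ) | (F q.1).trace ≤ k ∧
      4 * a * r + 2 * a * k < q.2 ⬝ᵥ (F q.1 *ᵥ q.2)} ≤ ENNReal.ofReal (Real.exp (-r)) := by
  have hmeas : MeasurableSet {q : α × (Fin n → ℝ) | (F q.1).trace ≤ k ∧
      4 * a * r + 2 * a * k < q.2 ⬝ᵥ (F q.1 *ᵥ q.2)} := by
    have hFm' : ∀ i j, Measurable fun q : α × (Fin n → ℝ) => F q.1 i j := fun i j =>
      (hFm i j).comp measurable_fst
    have h1 : Measurable fun q : α × (Fin n → ℝ) => (F q.1).trace := by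
      simp only [trace, diag_apply]
      exact Finset.measurable_fun_sum _ fun i _ => hFm' i i
    have h2 : Measurable fun q : α × (Fin n → ℝ) => q.2 ⬝ᵥ (F q.1 *ᵥ q.2) := by
      simp only [dotProduct, mulVec]
      refine Finset.measurable_fun_sum _ fun i _ => Measurable.mul (by fun_prop) ?_
      exact Finset.measurable_fun_sum _ fun j _ => (hFm' i j).mul (by fun_prop)
    exact (measurableSet_le h1 measurable_const).inter (measurableSet_lt measurable_const h2)
  refine ⟨hmeas, ?_⟩
  rw [Measure.prod_apply hmeas]
  calc _ ≤ ∫⁻ _, ENNReal.ofReal (Real.exp (-r)) ∂μ := by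
        refine lintegral_mono fun x => ?_
        by_cases hx : (F x).trace ≤ k
        · refine (measure_mono fun e he => ?_).trans
            (measure_quadratic_gt_le ha hν (hF x) (hF1 x) hx r)
          exact he.2
        · have : Prod.mk x ⁻¹' {q : α × (Fin n → ℝ) | (F q.1).trace ≤ k ∧
              4 * a * r + 2 * a * k < q.2 ⬝ᵥ (F q.1 *ᵥ q.2)} = ∅ := by
            ext e
            simp [hx]
          rw [this, measure_empty]
          exact zero_le
    _ = _ := by simp

theorem lintegral_exp_pi_le {n : ℕ} {μ : Measure ℝ} [IsProbabilityMeasure μ] {a : ℝ} (ha : 0 ≤ a)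
    (h : HasSubgaussianMGF id a.toNNReal μ) (u : Fin n → ℝ) :
    ∫⁻ e, ENNReal.ofReal (Real.exp (u ⬝ᵥ e)) ∂(Measure.pi fun _ : Fin n => μ)
      ≤ ENNReal.ofReal (Real.exp (a * (u ⬝ᵥ u) / 2)) := by
  have h1 : ∀ e : Fin n → ℝ, ENNReal.ofReal (Real.exp (u ⬝ᵥ e))
      = ∏ j, ENNReal.ofReal (Real.exp (u j * e j)) := fun e => by
    rw [← ENNReal.ofReal_prod_of_nonneg fun _ _ => (Real.exp_pos _).le, ← Real.exp_sum]
    rfl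
  simp_rw [h1]
  rw [lintegral_prod_pi _ (fun j t => ENNReal.ofReal (Real.exp (u j * t))) fun j => by fun_prop]
  calc _ ≤ ∏ j, ENNReal.ofReal (Real.exp (u j ^ 2 * a / 2)) := by
        refine Finset.prod_le_prod' fun j _ => ?_
        have h2 := lintegral_exp_le_of_hasSubgaussianMGF (hasSubgaussianMGF_const_mul h (u j))
        rwa [Real.coe_toNNReal _ (by positivity)] at h2
    _ = _ := by
        rw [← ENNReal.ofReal_prod_of_nonneg fun _ _ => (Real.exp_pos _).le, ← Real.exp_sum,
          dotProduct_self_eq_sum, Finset.mul_sum, Finset.sum_div]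
        congr 2
        exact Finset.sum_congr rfl fun j _ => by ring

/-- The joint law of an i.i.d. sample `(x_i, y_i)` with `x` independent of `y`. -/
theorem map_sample_eq_prod {Ω Ω₀ α β : Type*} [MeasurableSpace Ω] [MeasurableSpace Ω₀]
    [MeasurableSpace α] [MeasurableSpace β] {P : Measure Ω} {P₀ : Measure Ω₀}
    [IsProbabilityMeasure P] [IsProbabilityMeasure P₀] {n : ℕ} {x : Fin n → Ω → α}
    {y : Fin n → Ω → β} {x₀ : Ω₀ → α} {y₀ : Ω₀ → β} (hx₀ : AEMeasurable x₀ P₀)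
    (hy₀ : AEMeasurable y₀ P₀) (hind₀ : IndepFun x₀ y₀ P₀)
    (hind : iIndepFun (fun i ω => (x i ω, y i ω)) P)
    (hid : ∀ i, IdentDistrib (fun ω => (x i ω, y i ω)) (fun ω => (x₀ ω, y₀ ω)) P P₀) :
    P.map (fun ω => (fun i => x i ω, fun i => y i ω))
      = (Measure.pi fun _ : Fin n => P₀.map x₀).prod (Measure.pi fun _ : Fin n => P₀.map y₀) := by
  have := Measure.isProbabilityMeasure_map (μ := P₀) hx₀
  have := Measure.isProbabilityMeasure_map (μ := P₀) hy₀
  have hae : ∀ i, AEMeasurable (fun ω => (x i ω, y i ω)) P := fun i => (hid i).aemeasurable_fst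
  have h1 : P.map (fun ω i => (x i ω, y i ω))
      = Measure.pi fun _ : Fin n => (P₀.map x₀).prod (P₀.map y₀) := by
    rw [(iIndepFun_iff_map_fun_eq_pi_map hae).1 hind]
    congr 1
    funext i
    rw [(hid i).map_eq, (indepFun_iff_map_prod_eq_prod_map_map hx₀ hy₀).1 hind₀]
  have h2 := (measurePreserving_arrowProdEquivProdArrow α β (Fin n) (fun _ => P₀.map x₀)
    (fun _ => P₀.map y₀)).map_eq
  rw [← h2, ← h1, AEMeasurable.map_map_of_aemeasurable
    (MeasurableEquiv.measurable _).aemeasurable (aemeasurable_pi_lambda _ hae)]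
  rfl

/-- The quadratic form bound for the noise of an i.i.d. sample, where the matrix of the quadratic
form depends on variables that are independent of the noise. -/
theorem measure_sample_quadratic_gt_le {Ω Ω₀ α : Type*} [MeasurableSpace Ω] [MeasurableSpace Ω₀]
    [MeasurableSpace α] {P : Measure Ω} {P₀ : Measure Ω₀}
    [IsProbabilityMeasure P] [IsProbabilityMeasure P₀] {n : ℕ} {x : Fin n → Ω → α}
    {y : Fin n → Ω → ℝ} {x₀ : Ω₀ → α} {y₀ : Ω₀ → ℝ} (hx₀ : AEMeasurable x₀ P₀)
    (hind₀ : IndepFun x₀ y₀ P₀) (hind : iIndepFun (fun i ω => (x i ω, y i ω)) P)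
    (hid : ∀ i, IdentDistrib (fun ω => (x i ω, y i ω)) (fun ω => (x₀ ω, y₀ ω)) P P₀)
    {a : ℝ} (ha : 0 ≤ a) (hsub : HasSubgaussianMGF y₀ a.toNNReal P₀)
    {F : (Fin n → α) → Matrix (Fin n) (Fin n) ℝ} (hFm : ∀ i j, Measurable fun x => F x i j)
    (hF : ∀ x, (F x).PosSemidef) (hF1 : ∀ x u, u ⬝ᵥ (F x *ᵥ u) ≤ u ⬝ᵥ u) (k r : ℝ) :
    P {ω | (F fun i => x i ω).trace ≤ k ∧
      4 * a * r + 2 * a * k < (fun i => y i ω) ⬝ᵥ ((F fun i => x i ω) *ᵥ fun i => y i ω)}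
      ≤ ENNReal.ofReal (Real.exp (-r)) := by
  have hy₀ := hsub.aemeasurable
  -- For a = 0 the noise vanishes almost surely and the strict inequality reads 0 < 0.
  rcases ha.eq_or_lt with rfl | ha
  · have hz : ∀ᵐ ω ∂P, ∀ i, y i ω = 0 := by
      refine ae_all_iff.2 fun i => ?_
      have h1 := hsub.congr_identDistrib ((hid i).comp measurable_snd).symm
      rw [Real.toNNReal_zero] at h1
      exact h1.ae_eq_zero_of_hasSubgaussianMGF_zero
    refine le_trans (le_of_eq ?_) zero_le
    refine measure_mono_null (fun ω hω => ?_) (ae_iff.1 hz)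
    simp only [Set.mem_ofPred_eq] at hω ⊢
    intro h0
    have : (fun i => y i ω) = 0 := funext h0
    simp [this] at hω
  have := Measure.isProbabilityMeasure_map (μ := P₀) hx₀
  have := Measure.isProbabilityMeasure_map (μ := P₀) hy₀
  have hae : ∀ i, AEMeasurable (fun ω => (x i ω, y i ω)) P := fun i => (hid i).aemeasurable_fst
  obtain ⟨hm, hle⟩ := measure_prod_quadratic_gt_le (μ := Measure.pi fun _ : Fin n => P₀.map x₀)
    (ν := Measure.pi fun _ : Fin n => P₀.map y₀) ha
    (lintegral_exp_pi_le ha.le ((HasSubgaussianMGF.id_map_iff hy₀).2 hsub)) hFm hF hF1 k r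
  rw [← map_sample_eq_prod hx₀ hy₀ hind₀ hind hid, Measure.map_apply_of_aemeasurable ?_ hm] at hle
  · exact hle
  · exact (aemeasurable_pi_lambda _ fun i => (measurable_fst.comp_aemeasurable (hae i))).prodMk
      (aemeasurable_pi_lambda _ fun i => (measurable_snd.comp_aemeasurable (hae i)))

/-! ### The prediction risk -/

theorem HasSecondMoment.memLp_dotProduct {Ω : Type*} [MeasurableSpace Ω] {P : Measure Ω} {d : ℕ}
    {x : Ω → Fin d → ℝ} {S : Matrix (Fin d) (Fin d) ℝ} (h : HasSecondMoment P x S)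
    (v : Fin d → ℝ) : MemLp (fun ω => x ω ⬝ᵥ v) 2 P := by
  have h1 : (fun ω => x ω ⬝ᵥ v) = fun ω => ∑ i, v i * x ω i := by
    funext ω
    exact Finset.sum_congr rfl fun i _ => mul_comm _ _
  rw [h1]
  exact memLp_finsetSum _ fun i _ => (h.1 i).const_mul (v i)

theorem HasSecondMoment.integral_dotProduct_sq {Ω : Type*} [MeasurableSpace Ω] {P : Measure Ω}
    {d : ℕ} {x : Ω → Fin d → ℝ} {S : Matrix (Fin d) (Fin d) ℝ} (h : HasSecondMoment P x S)
    (v : Fin d → ℝ) : ∫ ω, (x ω ⬝ᵥ v) ^ 2 ∂P = v ⬝ᵥ (S *ᵥ v) := by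
  have hint : ∀ i j, Integrable (fun ω => x ω i * x ω j) P := fun i j =>
    (h.1 i).integrable_mul (h.1 j)
  have h1 : ∀ ω, (x ω ⬝ᵥ v) ^ 2 = ∑ i, ∑ j, (v i * v j) * (x ω i * x ω j) := fun ω => by
    rw [pow_two, dotProduct, Finset.sum_mul_sum]
    exact Finset.sum_congr rfl fun i _ => Finset.sum_congr rfl fun j _ => by ring
  simp_rw [h1]
  rw [integral_finsetSum _ fun i _ => integrable_finsetSum _ fun j _ => (hint i j).const_mul _]
  simp only [dotProduct, mulVec, Finset.mul_sum]
  refine Finset.sum_congr rfl fun i _ => ?_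
  rw [integral_finsetSum _ fun j _ => (hint i j).const_mul _]
  refine Finset.sum_congr rfl fun j _ => ?_
  rw [integral_const_mul, h.2]
  ring

theorem integral_dotProduct_eq_zero {Ω : Type*} [MeasurableSpace Ω] {P : Measure Ω}
    [IsFiniteMeasure P] {d : ℕ}
    {x : Ω → Fin d → ℝ} {S : Matrix (Fin d) (Fin d) ℝ} (h : HasSecondMoment P x S)
    (h0 : ∀ i, ∫ ω, x ω i ∂P = 0) (v : Fin d → ℝ) : ∫ ω, x ω ⬝ᵥ v ∂P = 0 := by
  simp only [dotProduct]
  rw [integral_finsetSum _ fun i _ => ((h.1 i).integrable (by norm_num)).mul_const _]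
  refine Finset.sum_eq_zero fun i _ => ?_
  rw [integral_mul_const, h0, zero_mul]

/-- The residual is Z·u − W·α + ε; independence and zero means make the three terms orthogonal in
L². -/
theorem IsFRM.risk_sub_eq {Ω : Type*} [MeasurableSpace Ω] {P : Measure Ω} [IsProbabilityMeasure P]
    {p K : ℕ} {θ : Param p K} {Z : Ω → Fin K → ℝ} {W : Ω → Fin p → ℝ} {ε : Ω → ℝ}
    (h : IsFRM P θ Z W ε) (α : Fin p → ℝ) :
    θ.risk P Z W ε α - θ.σ ^ 2 =
      (θ.β - θ.Aᵀ *ᵥ α) ⬝ᵥ (θ.SigmaZ *ᵥ (θ.β - θ.Aᵀ *ᵥ α)) + α ⬝ᵥ (θ.SigmaW *ᵥ α) := by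
  set u := θ.β - θ.Aᵀ *ᵥ α with hu
  set f : Ω → ℝ := fun ω => Z ω ⬝ᵥ u with hf
  set g : Ω → ℝ := fun ω => W ω ⬝ᵥ α with hg
  have hfm : MemLp f 2 P := h.moment_Z.memLp_dotProduct u
  have hgm : MemLp g 2 P := h.moment_W.memLp_dotProduct α
  have hdotZ : Measurable fun z : Fin K → ℝ => z ⬝ᵥ u := by simp only [dotProduct]; fun_prop
  have hdotW : Measurable fun w : Fin p → ℝ => w ⬝ᵥ α := by simp only [dotProduct]; fun_prop
  have hfg : ∫ ω, f ω * g ω ∂P = 0 := by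
    have hi : IndepFun f g P := h.indep_ZW.comp hdotZ hdotW
    rw [hi.integral_fun_mul_eq_mul_integral hfm.1 hgm.1,
      integral_dotProduct_eq_zero h.moment_Z h.mean_Z, zero_mul]
  have hfe : ∫ ω, f ω * ε ω ∂P = 0 := by
    have hi : IndepFun f ε P := h.indep_ZW_ε.comp (hdotZ.comp measurable_fst) measurable_id
    rw [hi.integral_fun_mul_eq_mul_integral hfm.1 h.memLp_ε.1, h.mean_ε, mul_zero]
  have hge : ∫ ω, g ω * ε ω ∂P = 0 := by
    have hi : IndepFun g ε P := h.indep_ZW_ε.comp (hdotW.comp measurable_snd) measurable_id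
    rw [hi.integral_fun_mul_eq_mul_integral hgm.1 h.memLp_ε.1, h.mean_ε, mul_zero]
  have hpt : ∀ ω, (θ.Y (Z ω) (ε ω) - θ.X (Z ω) (W ω) ⬝ᵥ α) ^ 2
      = f ω ^ 2 + g ω ^ 2 + ε ω ^ 2 + (-2) * (f ω * g ω) + 2 * (f ω * ε ω)
        + (-2) * (g ω * ε ω) := by
    intro ω
    have h1 : θ.X (Z ω) (W ω) ⬝ᵥ α = Z ω ⬝ᵥ (θ.Aᵀ *ᵥ α) + g ω := by
      rw [Param.X, add_dotProduct, ← transpose_mulVec_dotProduct θ.Aᵀ, transpose_transpose]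
    have h2 : f ω = Z ω ⬝ᵥ θ.β - Z ω ⬝ᵥ (θ.Aᵀ *ᵥ α) := by rw [hf, hu, ← dotProduct_sub]
    rw [h1, Param.Y, h2]
    ring
  have i1 := hfm.integrable_sq
  have i2 := hgm.integrable_sq
  have i3 := h.memLp_ε.integrable_sq
  have i4 : Integrable (fun ω => (-2) * (f ω * g ω)) P := (hfm.integrable_mul hgm).const_mul _
  have i5 : Integrable (fun ω => 2 * (f ω * ε ω)) P := (hfm.integrable_mul h.memLp_ε).const_mul _
  have i6 : Integrable (fun ω => (-2) * (g ω * ε ω)) P :=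
    (hgm.integrable_mul h.memLp_ε).const_mul _
  rw [Param.risk]
  simp_rw [hpt]
  have j1 := i1.fun_add i2
  have j2 := j1.fun_add i3
  have j3 := j2.fun_add i4
  rw [integral_add (j3.fun_add i5) i6, integral_add j3 i5, integral_add j2 i4, integral_add j1 i3,
    integral_add i1 i2, integral_const_mul, integral_const_mul,
    integral_const_mul, hfg, hfe, hge, h.moment_ε]
  rw [show ∫ ω, f ω ^ 2 ∂P = _ from h.moment_Z.integral_dotProduct_sq u,
    show ∫ ω, g ω ^ 2 ∂P = _ from h.moment_W.integral_dotProduct_sq α]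
  ring

/-! ### Consequences of the rank conditions -/

theorem isUnit_det_of_rank_eq {d : ℕ} {M : Matrix (Fin d) (Fin d) ℝ} (h : M.rank = d) :
    IsUnit M.det := by
  rw [← isUnit_iff_isUnit_det, ← mulVec_surjective_iff_isUnit]
  have : LinearMap.range M.mulVecLin = ⊤ :=
    Submodule.eq_top_of_finrank_eq (by rw [Module.finrank_fin_fun]; exact h)
  exact LinearMap.range_eq_top.1 this

/-- The vector is A(AᵀA)⁻¹β, the solution of Aᵀa = β of least norm. It lets X stand in for the
unobserved factors. -/
theorem exists_coef_of_rank {p K : ℕ} (θ : Param p K) (h : θ.A.rank = K) :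
    ∃ a : Fin p → ℝ, θ.Aᵀ *ᵥ a = θ.β ∧ a ⬝ᵥ a = θ.quad := by
  have hu : IsUnit (θ.Aᵀ * θ.A).det :=
    isUnit_det_of_rank_eq (by rw [rank_transpose_mul_self, h])
  have h1 : (θ.Aᵀ * θ.A) *ᵥ ((θ.Aᵀ * θ.A)⁻¹ *ᵥ θ.β) = θ.β := by
    rw [mulVec_mulVec, mul_nonsing_inv _ hu, one_mulVec]
  refine ⟨θ.A *ᵥ ((θ.Aᵀ * θ.A)⁻¹ *ᵥ θ.β), ?_, ?_⟩
  · rw [mulVec_mulVec, h1]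
  · rw [mulVec_dotProduct_mulVec, h1, Param.quad, dotProduct_comm]

theorem dataX_eq {n p K : ℕ} (θ : Param p K) (z : Fin n → Fin K → ℝ) (w : Fin n → Fin p → ℝ) :
    θ.dataX z w = Matrix.of z * θ.Aᵀ + Matrix.of w := by
  ext i j
  simp [Param.dataX, Param.X, Matrix.mul_apply, mulVec, dotProduct, mul_comm]

theorem dataY_eq {n p K : ℕ} (θ : Param p K) (z : Fin n → Fin K → ℝ) (e : Fin n → ℝ) :
    θ.dataY z e = Matrix.of z *ᵥ θ.β + e := rfl

/-! ### Measurable majorants of the noise projection -/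

/-- The inverse is the adjugate times the inverse determinant, so it is measurable even across
singular matrices, where it is not continuous. -/
theorem measurable_mul_inv_apply {α : Type*} [TopologicalSpace α] [MeasurableSpace α]
    [OpensMeasurableSpace α] {m n : ℕ} {A : α → Matrix (Fin m) (Fin n) ℝ}
    {B : α → Matrix (Fin n) (Fin n) ℝ} (hA : Continuous A) (hB : Continuous B)
    (i : Fin m) (j : Fin n) : Measurable fun x => (A x * (B x)⁻¹) i j := by
  simp only [Matrix.mul_apply, inv_def, Matrix.smul_apply, Ring.inverse_eq_inv', smul_eq_mul]
  refine Finset.measurable_fun_sum _ fun k _ => ?_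
  exact (hA.matrix_elem i k).measurable.mul
    (hB.matrix_det.measurable.inv.mul (hB.matrix_adjugate.matrix_elem k j).measurable)

theorem continuous_dataX {n p K : ℕ} (θ : Param p K) :
    Continuous fun x : Fin n → (Fin K → ℝ) × (Fin p → ℝ) =>
      θ.dataX (fun i => (x i).1) (fun i => (x i).2) := by
  refine continuous_matrix fun i j => ?_
  simp only [Param.dataX, Param.X, Matrix.of_apply, Pi.add_apply, mulVec, dotProduct]
  fun_prop

/-- There is a measurable function `F` of the latent data with values in the matrices between `0`
and `1` whose trace is at most `K + 1` and which dominates the noise projection of principal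
component regression, whenever the noise matrix is bounded. -/
theorem exists_noise_majorant {n p K : ℕ} (hn : 1 ≤ n) (θ : Param p K) {d C₀ : ℝ} (hd : 0 ≤ d)
    (hC₀ : 1 < C₀) :
    ∃ F : (Fin n → (Fin K → ℝ) × (Fin p → ℝ)) → Matrix (Fin n) (Fin n) ℝ,
      (∀ i j, Measurable fun x => F x i j) ∧ (∀ x, (F x).PosSemidef) ∧
      (∀ x u, u ⬝ᵥ (F x *ᵥ u) ≤ u ⬝ᵥ u) ∧
      ∀ (z : Fin n → Fin K → ℝ) (w : Fin n → Fin p → ℝ),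
        (∀ u, ((Matrix.of w)ᵀ *ᵥ u) ⬝ᵥ ((Matrix.of w)ᵀ *ᵥ u) ≤ n * d * (u ⬝ᵥ u)) →
        IsUnit ((Matrix.of z)ᵀ * Matrix.of z).det →
        (F fun i => (z i, w i)).trace ≤ K + 1 ∧
        ∀ U : Matrix (Fin p) (Fin (sHat (θ.dataX z w) (C₀ * d))) ℝ,
          IsTopRightSingular (θ.dataX z w) U → ∀ e v : Fin n → ℝ,
          v = (θ.dataX z w * U) *ᵥ (pinv (θ.dataX z w * U) *ᵥ e) →
          v ⬝ᵥ v ≤ 2 * (e ⬝ᵥ ((F fun i => (z i, w i)) *ᵥ e)) := by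
  have hn' : (0 : ℝ) < n := by exact_mod_cast hn
  -- At d = 0 the filter has no positive threshold. On the event W = 0 the range of XU lies in the
  -- column space of Z, whose projection serves instead.
  rcases hd.eq_or_lt with rfl | hd
  · refine ⟨fun x => colProj (Matrix.of fun i => (x i).1), ?_, fun x => colProj_posSemidef _,
      fun x u => colProj_le_one _ u, ?_⟩
    · intro i j
      have hc : Continuous fun x : Fin n → (Fin K → ℝ) × (Fin p → ℝ) =>
          (Matrix.of fun i => (x i).1 : Matrix (Fin n) (Fin K) ℝ) := by
        refine continuous_matrix fun i j => ?_
        simp only [Matrix.of_apply]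
        fun_prop
      simp only [colProj]
      simp_rw [Matrix.mul_apply (M := _ * _)]
      refine Finset.measurable_fun_sum _ fun k _ => ?_
      exact (measurable_mul_inv_apply hc (hc.matrix_transpose.matrix_mul hc) i k).mul
        (hc.matrix_elem j k).measurable
    · intro z w hw hz
      refine ⟨(trace_colProj_le _).trans (by simp), fun U hU e v hv => ?_⟩
      have hw0 : Matrix.of w = 0 := by
        ext i j
        have h1 := hw (Pi.single i 1)
        rw [mul_zero, zero_mul] at h1
        have h2 := dotProduct_self_eq_zero.1 (le_antisymm h1 (dotProduct_self_nonneg _))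
        have h3 := congrFun h2 j
        simpa using h3
      have hX : θ.dataX z w = Matrix.of z * θ.Aᵀ := by rw [dataX_eq, hw0, add_zero]
      refine sq_proj_le_colProj hz (c := θ.Aᵀ *ᵥ (U *ᵥ (pinv (θ.dataX z w * U) *ᵥ e))) ?_ ?_
      · rw [hv, ← mulVec_mulVec _ (θ.dataX z w) U]
        nth_rewrite 1 [hX]
        rw [← mulVec_mulVec]
      · rw [hv]
        exact (isMoorePenrose_pinv _).sq_mulVec e
  · obtain ⟨m, hm⟩ := pow_unbounded_of_one_lt (n : ℝ) hC₀
    have ht : 0 < n * (C₀ * d) := by positivity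
    have hgram : ∀ X : Matrix (Fin n) (Fin p) ℝ, (X * Xᵀ).PosSemidef := fun X => by
      simpa [conjTranspose_eq_transpose_of_trivial] using posSemidef_self_mul_conjTranspose X
    refine ⟨fun x => powFilter (θ.dataX (fun i => (x i).1) (fun i => (x i).2) *
      (θ.dataX (fun i => (x i).1) (fun i => (x i).2))ᵀ) m (n * (C₀ * d)), ?_,
      fun x => (powFilter_posSemidef (hgram _) m ht).1,
      fun x u => (powFilter_posSemidef (hgram _) m ht).2 u, ?_⟩
    · intro i j
      have hc := continuous_dataX (n := n) θ
      have hc2 := (hc.matrix_mul hc.matrix_transpose).pow m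
      exact measurable_mul_inv_apply hc2 (hc2.add continuous_const) i j
    · intro z w hw _
      refine ⟨?_, fun U hU e v hv => ?_⟩
      -- On the kernel of Zᵀ, of codimension at most K, the signal drops out and Xᵀ acts as Wᵀ.
      · refine trace_powFilter_le (hgram _) (b := n * d) ht ?_ (Matrix.of z)ᵀ fun v hv => ?_
        · calc (n : ℝ) * (n * d) ^ m ≤ C₀ ^ m * (n * d) ^ m :=
                mul_le_mul_of_nonneg_right hm.le (by positivity)
            _ = _ := by rw [← mul_pow]; ring
        · have h1 : (θ.dataX z w)ᵀ *ᵥ v = (Matrix.of w)ᵀ *ᵥ v := by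
            rw [dataX_eq, transpose_add, add_mulVec, transpose_mul, ← mulVec_mulVec, hv]
            simp
          have h2 : v ⬝ᵥ ((θ.dataX z w * (θ.dataX z w)ᵀ) *ᵥ v)
              = ((θ.dataX z w)ᵀ *ᵥ v) ⬝ᵥ ((θ.dataX z w)ᵀ *ᵥ v) := by
            rw [mulVec_dotProduct_mulVec, transpose_transpose]
          exact h2.trans_le (h1 ▸ hw v)
      · exact sq_proj_le_powFilter hU ht
          (fun j hj => le_singVal_sq_of_lt_sHat hn _ _ hj) m e hv

/-! ### The risk of principal component regression -/

/-- The excess risk of principal component regression with fixed data, on the event where the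
noise matrix is bounded and the design of the factors is well conditioned. -/
theorem risk_coef_sub_le {Ω : Type*} [MeasurableSpace Ω] {P : Measure Ω} [IsProbabilityMeasure P]
    {n p K : ℕ} (hn : 1 ≤ n) {θ : Param p K} {Z : Ω → Fin K → ℝ} {W : Ω → Fin p → ℝ} {ε : Ω → ℝ}
    (h : IsFRM P θ Z W ε) (hSW : θ.SigmaW.PosSemidef) {cW C₀ d : ℝ} (hcW : 0 < cW) (hC₀ : 1 < C₀)
    (hd : d = θ.deltaW cW n)
    {z : Fin n → Fin K → ℝ} {w : Fin n → Fin p → ℝ} {e : Fin n → ℝ}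
    (hw : ∀ u, ((Matrix.of w)ᵀ *ᵥ u) ⬝ᵥ ((Matrix.of w)ᵀ *ᵥ u) ≤ n * d * (u ⬝ᵥ u))
    (hz : ∀ u, (n : ℝ) / 8 * (u ⬝ᵥ (θ.SigmaZ *ᵥ u)) ≤ (Matrix.of z *ᵥ u) ⬝ᵥ (Matrix.of z *ᵥ u))
    {U : Matrix (Fin p) (Fin (sHat (θ.dataX z w) (C₀ * d))) ℝ}
    (hU : IsTopRightSingular (θ.dataX z w) U) {v : Fin n → ℝ}
    (hv : v = (θ.dataX z w * U) *ᵥ (pinv (θ.dataX z w * U) *ᵥ e)) {N : ℝ} (hN : v ⬝ᵥ v ≤ N) :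
    θ.risk P Z W ε (coef (θ.dataX z w) (θ.dataY z e) U) - θ.σ ^ 2 ≤
      (32 * (C₀ + 7) + 6 / cW) * (d * θ.quad) + (128 + 3 / cW) * (N / n) := by
  have hn' : (0 : ℝ) < n := by exact_mod_cast hn
  have hop := opNorm_nonneg θ.SigmaW
  have htr : 0 ≤ θ.SigmaW.trace / n := div_nonneg hSW.trace_nonneg hn'.le
  have hd0 : 0 ≤ d := by rw [hd, Param.deltaW]; positivity
  -- The operator norm inside δ_W converts control of d‖α‖² into control of αᵀΣ_W α, at the price
  -- 1/cW.
  have hopd : opNorm θ.SigmaW ≤ d / cW := by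
    rw [hd, Param.deltaW, mul_div_cancel_left₀ _ hcW.ne']
    linarith
  have hB : 0 ≤ n * d := by positivity
  have hBT : n * d ≤ n * (C₀ * d) := by
    have : 0 ≤ n * d * (C₀ - 1) := mul_nonneg hB (by linarith)
    linarith
  obtain ⟨a, ha, haq⟩ := exists_coef_of_rank θ h.rank_A
  have hw' : ∀ u, (Matrix.of w *ᵥ u) ⬝ᵥ (Matrix.of w *ᵥ u) ≤ n * d * (u ⬝ᵥ u) := fun u => by
    have := sq_transpose_mulVec_le_of_sq_mulVec_le hB hw u
    rwa [transpose_transpose] at this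
  have horth : ∀ u, Uᵀ *ᵥ u = 0 → (θ.dataX z w *ᵥ u) ⬝ᵥ (θ.dataX z w *ᵥ u)
      ≤ n * (C₀ * d) * (u ⬝ᵥ u) := fun u hu =>
    (hU.sq_mulVec_le_of_orthogonal (singVal_sHat_gap hn _ _) hu).trans
      (mul_le_mul_of_nonneg_right (singVal_sHat_sq_le hn _ (by positivity))
        (dotProduct_self_nonneg u))
  obtain ⟨h1, h2⟩ := coef_error_le (dataX_eq θ z w) ha e hU hB hBT
    (fun j hj => (singVal_pos_iff _).2 (hj.trans_le (sHat_le_rank _ _)))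
    (fun j hj => le_singVal_sq_of_lt_sHat hn _ _ hj) horth hw' hv
  rw [← dataY_eq] at h1 h2
  rw [h.risk_sub_eq]
  set α := coef (θ.dataX z w) (θ.dataY z e) U with hα
  rw [haq] at h1 h2
  have h3 := (hz (θ.β - θ.Aᵀ *ᵥ α)).trans h2
  have h4 := dotProduct_mulVec_le_opNorm θ.SigmaW α
  have h5 : opNorm θ.SigmaW * (α ⬝ᵥ α) ≤ (6 * d * θ.quad + 3 * (N / n)) / cW := by
    calc opNorm θ.SigmaW * (α ⬝ᵥ α) ≤ d / cW * (α ⬝ᵥ α) :=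
          mul_le_mul_of_nonneg_right hopd (dotProduct_self_nonneg α)
      _ = (n * d * (α ⬝ᵥ α)) / n / cW := by field_simp
      _ ≤ (6 * (n * d) * θ.quad + 3 * N) / n / cW := by
          gcongr
          linarith
      _ = _ := by field_simp
  have h6 : (θ.β - θ.Aᵀ *ᵥ α) ⬝ᵥ (θ.SigmaZ *ᵥ (θ.β - θ.Aᵀ *ᵥ α))
      ≤ 32 * (C₀ + 7) * (d * θ.quad) + 128 * (N / n) := by
    have h7 : (n : ℝ) * ((θ.β - θ.Aᵀ *ᵥ α) ⬝ᵥ (θ.SigmaZ *ᵥ (θ.β - θ.Aᵀ *ᵥ α)))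
        ≤ n * (32 * (C₀ + 7) * (d * θ.quad) + 128 * (N / n)) := by
      have h8 : (n : ℝ) * (32 * (C₀ + 7) * (d * θ.quad) + 128 * (N / n))
          = 32 * (n * (C₀ * d) * θ.quad + 7 * (n * d) * θ.quad) + 128 * N := by
        field_simp
      rw [h8]
      linarith
    exact le_of_mul_le_mul_left h7 hn'
  have h9 : (6 * d * θ.quad + 3 * (N / n)) / cW
      = 6 / cW * (d * θ.quad) + 3 / cW * (N / n) := by ring
  linarith

/-- Well conditioned factor designs have full column rank. -/
theorem isUnit_det_gram {n K : ℕ} (hn : 1 ≤ n) {S R : Matrix (Fin K) (Fin K) ℝ}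
    (hR : IsPSDSqrt R S) (hdet : IsUnit R.det) {M : Matrix (Fin n) (Fin K) ℝ}
    (hM : ∀ u, (n : ℝ) / 8 * (u ⬝ᵥ (S *ᵥ u)) ≤ (M *ᵥ u) ⬝ᵥ (M *ᵥ u)) : IsUnit (Mᵀ * M).det := by
  have hn' : (0 : ℝ) < n := by exact_mod_cast hn
  rw [isUnit_iff_ne_zero]
  intro h0
  obtain ⟨v, hv, hMv⟩ := exists_mulVec_eq_zero_iff.2 h0
  have h1 := hM v
  rw [mulVec_dotProduct_mulVec, hMv, dotProduct_zero, hR.dotProduct_mulVec] at h1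
  have h2 := dotProduct_self_nonneg (R *ᵥ v)
  have h3 : (R *ᵥ v) ⬝ᵥ (R *ᵥ v) = 0 := by
    refine le_antisymm ?_ h2
    by_contra! hlt
    have : 0 < (n : ℝ) / 8 * ((R *ᵥ v) ⬝ᵥ (R *ᵥ v)) := by positivity
    linarith
  have h4 := dotProduct_self_eq_zero.1 h3
  apply hv
  have h5 : R⁻¹ *ᵥ (R *ᵥ v) = v := by rw [mulVec_mulVec, nonsing_inv_mul _ hdet, one_mulVec]
  rw [← h5, h4, mulVec_zero]

/-- The factor design is well conditioned with high probability. -/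
theorem exists_measure_design_le {γ : ℝ} (hγ : 0 < γ) : ∃ C : ℝ, 0 < C ∧
    ∀ (n K : ℕ), 3 ≤ n → (K : ℝ) * Real.log n ≤ C * n →
    ∀ (Ω₀ : Type*) [MeasurableSpace Ω₀] (P₀ : Measure Ω₀) [IsProbabilityMeasure P₀]
      (Ω : Type*) [MeasurableSpace Ω] (P : Measure Ω) [IsProbabilityMeasure P]
      (Z : Ω₀ → Fin K → ℝ) (Zs : Fin n → Ω → Fin K → ℝ) (S R : Matrix (Fin K) (Fin K) ℝ),
      IsWhitenedSubGaussian P₀ Z S γ → HasSecondMoment P₀ Z S → IsPSDSqrt R S → IsUnit R.det →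
      iIndepFun Zs P → (∀ i, IdentDistrib (Zs i) Z P P₀) →
      P {ω | ¬ ∀ u, (n : ℝ) / 8 * (u ⬝ᵥ (S *ᵥ u)) ≤
        ((Matrix.of fun i => Zs i ω) *ᵥ u) ⬝ᵥ ((Matrix.of fun i => Zs i ω) *ᵥ u)}
      ≤ ENNReal.ofReal (2 / n) := by
  obtain ⟨C, hC, h⟩ := exists_measure_smallest_singular_le hγ
  refine ⟨C, hC, ?_⟩
  intro n K hn hK Ω₀ _ P₀ _ Ω _ P _ Z Zs S R hsub hmom hR hdet hind hid
  have hRt : (R⁻¹)ᵀ = R⁻¹ := by rw [transpose_nonsing_inv, hR.transpose_eq]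
  have hdot : ∀ x v : Fin K → ℝ, (R⁻¹ *ᵥ x) ⬝ᵥ v = x ⬝ᵥ (R⁻¹ *ᵥ v) := fun x v => by
    rw [← transpose_mulVec_dotProduct, hRt]
  have hS : ∀ v : Fin K → ℝ, (R⁻¹ *ᵥ v) ⬝ᵥ (S *ᵥ (R⁻¹ *ᵥ v)) = v ⬝ᵥ v := fun v => by
    rw [hR.dotProduct_mulVec, mulVec_mulVec, mul_nonsing_inv _ hdet, one_mulVec]
  have hm : ∀ v : Fin K → ℝ, Measurable fun x : Fin K → ℝ => x ⬝ᵥ v := fun v => by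
    simp only [dotProduct]; fun_prop
  -- Whitening by R⁻¹ reduces to the isotropic case; taking v = Ru afterwards restores uᵀSu.
  have h1 := h n K hn hK Ω P (fun i ω => R⁻¹ *ᵥ Zs i ω)
    (hind.comp (fun _ x => R⁻¹ *ᵥ x) fun _ =>
      (Continuous.matrix_mulVec continuous_const continuous_id).measurable)
    (fun i v hv => by
      simp_rw [hdot]
      have h2 := hsub.hasSubgaussianMGF (R⁻¹ *ᵥ v)
      rw [hS, hv, mul_one] at h2
      exact h2.congr_identDistrib ((hid i).comp (hm _)).symm)
    (fun i v hv => by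
      simp_rw [hdot]
      rw [← hv, ← hS v, ← hmom.integral_dotProduct_sq]
      exact ((hid i).comp ((hm (R⁻¹ *ᵥ v)).pow_const 2)).integral_eq)
  refine (measure_mono fun ω hω => ?_).trans h1
  simp only [Set.mem_ofPred_eq] at hω ⊢
  contrapose! hω
  intro u
  have h2 := hω (R *ᵥ u)
  have h3 : (Matrix.of fun i => R⁻¹ *ᵥ Zs i ω) *ᵥ (R *ᵥ u) = (Matrix.of fun i => Zs i ω) *ᵥ u := by
    ext i
    change (R⁻¹ *ᵥ Zs i ω) ⬝ᵥ (R *ᵥ u) = Zs i ω ⬝ᵥ u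
    rw [hdot, mulVec_mulVec, nonsing_inv_mul _ hdet, one_mulVec]
  rwa [h3, ← hR.dotProduct_mulVec] at h2

end FactorRegression

/-! ### The risk bound for the elbow rule -/

open FactorRegression in
/-- The constant `c` is absolute, `C` depends on `γz`, `c₀` on `γw`, and the constant `C₁` behind
`≲` on the sub-Gaussian constants, on the constant `cW` of `δ_W` and on `C₀`. -/
theorem corollary3 :
    ∃ c : ℝ, 0 < c ∧
    ∀ γz : ℝ, 0 < γz → ∃ C : ℝ, 0 < C ∧
    ∀ γw : ℝ, 0 < γw → ∃ c₀ : ℝ, 0 < c₀ ∧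
    ∀ cW : ℝ, c₀ ≤ cW → ∀ γε : ℝ, 0 < γε → ∀ C₀ : ℝ, 1 < C₀ →
    ∃ C₁ : ℝ, 0 < C₁ ∧
    ∀ (n p K : ℕ) (θ : Param p K), 1 ≤ n → (K : ℝ) * Real.log n ≤ C * n →
    -- the population: a new data point `(X_*, Y_*)` follows sG-FRM(θ)
    ∀ (Ω₀ : Type*) [MeasurableSpace Ω₀] (P₀ : Measure Ω₀) [IsProbabilityMeasure P₀]
      (Z : Ω₀ → Fin K → ℝ) (W : Ω₀ → Fin p → ℝ) (ε : Ω₀ → ℝ),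
    IsSGFRM P₀ θ γε γw γz Z W ε →
    -- the sample: `n` independent copies
    ∀ (Ω : Type*) [MeasurableSpace Ω] (P : Measure Ω) [IsProbabilityMeasure P]
      (Zs : Fin n → Ω → Fin K → ℝ) (Ws : Fin n → Ω → Fin p → ℝ) (εs : Fin n → Ω → ℝ),
    iIndepFun (fun i ω => (Zs i ω, Ws i ω, εs i ω)) P →
    (∀ i, IdentDistrib (fun ω => (Zs i ω, Ws i ω, εs i ω)) (fun ω => (Z ω, W ω, ε ω)) P P₀) →
    P.real {ω | ¬ ∀ U : Matrix (Fin p)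
          (Fin (sHat (θ.dataX (Zs · ω) (Ws · ω)) (C₀ * θ.deltaW cW n))) ℝ,
        IsTopRightSingular (θ.dataX (Zs · ω) (Ws · ω)) U →
        θ.risk P₀ Z W ε (coef (θ.dataX (Zs · ω) (Ws · ω)) (θ.dataY (Zs · ω) (εs · ω)) U)
            - θ.σ ^ 2 ≤
          C₁ * (((K : ℝ) + Real.log n) * θ.σ ^ 2 / n + θ.deltaW cW n * θ.quad)} ≤ c / n := by
  -- 4 = 1 + 2 + 1, from the noise matrix, the design and the quadratic form; 4/n > 1 also disposes
  -- of n < 3, below which log n ≥ 1 fails.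
  refine ⟨4, by norm_num, fun γz hγz => ?_⟩
  obtain ⟨C, hC, hdesign⟩ := exists_measure_design_le hγz
  refine ⟨C, hC, fun γw hγw => ⟨48 * γw ^ 2, by positivity, fun cW hcW γε hγε C₀ hC₀ => ?_⟩⟩
  have hcW0 : 0 < cW := lt_of_lt_of_le (by positivity) hcW
  have hC₀0 : 0 < C₀ := by linarith
  refine ⟨(32 * (C₀ + 7) + 6 / cW) + (128 + 3 / cW) * (16 * γε ^ 2), by positivity, ?_⟩
  intro n p K θ hn hK Ω₀ _ P₀ _ Z W ε hmod Ω _ P _ Zs Ws εs hind hid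
  have hn' : (0 : ℝ) < n := by exact_mod_cast hn
  rcases lt_or_ge n 3 with hn3 | hn3
  · refine measureReal_le_one.trans ?_
    rw [le_div_iff₀ hn']
    have : (n : ℝ) < 3 := by exact_mod_cast hn3
    linarith
  have hn3' : (3 : ℝ) ≤ n := by exact_mod_cast hn3
  have hlog : 1 ≤ Real.log n := by
    rw [Real.le_log_iff_exp_le hn']
    linarith [Real.exp_one_lt_d9]
  obtain ⟨RZ, -, hRZ, -⟩ := hmod.subGaussian_Z
  obtain ⟨RW, -, hRW, -⟩ := hmod.subGaussian_W
  have hSW := hRW.posSemidef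
  have hdetZ : IsUnit RZ.det := by
    have h1 := isUnit_det_of_rank_eq hmod.rank_SigmaZ
    rw [← hRZ.2, det_mul] at h1
    exact isUnit_of_mul_isUnit_left h1
  have hidZ : ∀ i, IdentDistrib (Zs i) Z P P₀ := fun i => (hid i).comp measurable_fst
  have hidW : ∀ i, IdentDistrib (Ws i) W P P₀ := fun i =>
    (hid i).comp (measurable_fst.comp measurable_snd)
  have hindZ : iIndepFun Zs P := hind.comp (fun _ t => t.1) fun _ => measurable_fst
  have hindW : iIndepFun Ws P :=
    hind.comp (fun _ t => t.2.1) fun _ => measurable_fst.comp measurable_snd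
  have hassoc : Measurable fun t : (Fin K → ℝ) × (Fin p → ℝ) × ℝ => ((t.1, t.2.1), t.2.2) := by
    fun_prop
  set d := θ.deltaW cW n with hd
  have hd0 : 0 ≤ d := by
    have h1 := opNorm_nonneg θ.SigmaW
    have h2 : 0 ≤ θ.SigmaW.trace / n := div_nonneg hSW.trace_nonneg hn'.le
    rw [hd, Param.deltaW]
    positivity
  have hE1 := measure_op_noise_le hn (fun i => (hidW i).aemeasurable_fst) hindW hγw hSW
    fun i v => (hmod.subGaussian_W.hasSubgaussianMGF v).congr_identDistrib
      ((hidW i).comp (show Measurable fun x : Fin p → ℝ => x ⬝ᵥ v by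
        simp only [dotProduct]; fun_prop)).symm
  have hE2 := hdesign n K hn3 hK Ω₀ P₀ Ω P Z Zs θ.SigmaZ RZ hmod.subGaussian_Z hmod.moment_Z hRZ
    hdetZ hindZ hidZ
  obtain ⟨F, hFm, hF0, hF1, hF⟩ := exists_noise_majorant hn θ hd0 hC₀
  have hE3 := measure_sample_quadratic_gt_le (x := fun i ω => (Zs i ω, Ws i ω)) (y := εs)
    (x₀ := fun ω => (Z ω, W ω)) (y₀ := ε) (hmod.aemeasurable_Z.prodMk hmod.aemeasurable_W)
    hmod.indep_ZW_ε (hind.comp _ fun _ => hassoc) (fun i => (hid i).comp hassoc)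
    (sq_nonneg (θ.σ * γε)) hmod.subGaussian_ε.2 hFm hF0 hF1 (K + 1) (Real.log n)
  rw [Real.exp_neg, Real.exp_log hn', ← one_div] at hE3
  refine ENNReal.toReal_le_of_le_ofReal (by positivity) ?_
  have hsum : ENNReal.ofReal (4 / n)
      = ENNReal.ofReal (1 / n) + ENNReal.ofReal (2 / n) + ENNReal.ofReal (1 / n) := by
    rw [← ENNReal.ofReal_add (by positivity) (by positivity),
      ← ENNReal.ofReal_add (by positivity) (by positivity)]
    congr 1
    ring
  rw [hsum]
  refine le_trans (measure_mono ?_) ((measure_union_le _ _).trans (add_le_add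
    ((measure_union_le _ _).trans (add_le_add hE1 hE2)) hE3))
  intro ω hω
  by_contra hcon
  simp only [Set.mem_union, Set.mem_ofPred_eq, not_or, not_not, not_and, not_lt] at hcon
  obtain ⟨⟨g1, g2⟩, g3⟩ := hcon
  refine hω fun U hU => ?_
  have g1' : ∀ u, ((Matrix.of fun i => Ws i ω)ᵀ *ᵥ u) ⬝ᵥ ((Matrix.of fun i => Ws i ω)ᵀ *ᵥ u)
      ≤ n * d * (u ⬝ᵥ u) := fun u => by
    refine (g1 u).trans (mul_le_mul_of_nonneg_right (mul_le_mul_of_nonneg_left ?_ hn'.le)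
      (dotProduct_self_nonneg u))
    have h1 := opNorm_nonneg θ.SigmaW
    have h2 : 0 ≤ θ.SigmaW.trace / n := div_nonneg hSW.trace_nonneg hn'.le
    exact mul_le_mul_of_nonneg_right hcW (by positivity)
  obtain ⟨f1, f2⟩ := hF (fun i => Zs i ω) (fun i => Ws i ω) g1' (isUnit_det_gram hn hRZ hdetZ g2)
  have g4 := f2 U hU (fun i => εs i ω) _ rfl
  have g5 := g3 f1
  have hN := g4.trans (mul_le_mul_of_nonneg_left g5 zero_le_two)
  refine (risk_coef_sub_le hn hmod.toIsFRM hSW hcW0 hC₀ hd g1' g2 hU rfl hN).trans ?_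
  have hq : 0 ≤ d * θ.quad := by
    obtain ⟨a, -, haq⟩ := exists_coef_of_rank θ hmod.rank_A
    rw [← haq]
    exact mul_nonneg hd0 (dotProduct_self_nonneg a)
  have hL : 0 ≤ ((K : ℝ) + Real.log n) * θ.σ ^ 2 / n := by positivity
  -- Since log n ≥ 1, it absorbs the additive 1 in the trace bound K + 1: 8 log n + 4K + 4 ≤ 16(K +
  -- log n).
  have hNle : 2 * (4 * (θ.σ * γε) ^ 2 * Real.log n + 2 * (θ.σ * γε) ^ 2 * (K + 1)) / n
      ≤ 16 * γε ^ 2 * (((K : ℝ) + Real.log n) * θ.σ ^ 2 / n) := by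
    rw [← mul_div_assoc]
    refine div_le_div_of_nonneg_right ?_ hn'.le
    have h1 : (0 : ℝ) ≤ K := Nat.cast_nonneg K
    have h2 : 0 ≤ (θ.σ * γε) ^ 2 * (8 * Real.log n - 4 + 12 * K) :=
      mul_nonneg (sq_nonneg _) (by linarith)
    nlinarith
  have hk1 : 0 ≤ 32 * (C₀ + 7) + 6 / cW := by positivity
  have hk2 : 0 ≤ 128 + 3 / cW := by positivity
  have t1 := mul_le_mul_of_nonneg_left hNle hk2
  have t2 : 0 ≤ (32 * (C₀ + 7) + 6 / cW) * (((K : ℝ) + Real.log n) * θ.σ ^ 2 / n) := by positivity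
  have t3 : 0 ≤ (128 + 3 / cW) * (16 * γε ^ 2) * (d * θ.quad) := by positivity
  linarith
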